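/- Let $j_1,j_2,j_3\in\mathbb{C}$ be pairwise distinct and $k_1,k_2,k_3\in\mathbb{C}$ arbitrary; $(\alpha,\beta,\gamma)$ always denotes a cyclic permutation of $(1,2,3)$. Let $\mathcal{A}=\mathbb{C}\langle S_0,S_1,S_2,S_3\rangle$ be the free associative algebra, with the derivation $\frac{d}{dt}$ (the lifted Zhukovsky–Volterra top) given by $$\frac{dS_0}{dt}=0,\qquad \frac{dS_\gamma}{dt}=(j_\alpha-j_\beta)(S_\alpha S_\beta+S_\beta S_\alpha)+2(k_\alpha S_\beta-k_\beta S_\alpha).$$ A two-sided ideal $\mathcal J\subset\mathcal A$ is a *quantisation ideal* if $\frac{d}{dt}\mathcal J\subset\mathcal J$ and the normally ordered monomials $S_0^{n_0}S_1^{n_1}S_2^{n_2}S_3^{n_3}$ form a basis of $\mathcal A/\mathcal J$. For six quadratic relations $r_1,\dots,r_6\in\mathcal A$ let $V_N$ be the span of the products $u\,r_i\,v$ with monomials $u,v$ such that $\deg u+2+\deg v\le N$. The relations define a *quantisation ideal up to cubic polynomials* if $\frac{d r_i}{dt}\in V_3$ for all $i$ and if, for $N=2$ and $N=3$, every polynomial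 of degree $\le N$ is congruent modulo $V_N$ to a unique linear combination of normally ordered monomials of degree $\le N$. Consider ideals generated by six relations of the form $$F_\gamma=S_\alpha S_\beta-S_\beta S_\alpha+A_\gamma(S_0S_\gamma+S_\gamma S_0)+K_\gamma S_0+M_\gamma S_\gamma+N_\gamma,$$ $$G_\gamma=S_\gamma S_0-S_0S_\gamma+B_\gamma(S_\alpha S_\beta+S_\beta S_\alpha)+l_\alpha S_\beta-l_\beta S_\alpha,$$ with constants $A_\gamma,B_\gamma,K_\gamma,M_\gamma,N_\gamma,l_\gamma\in\mathbb C$. For $h,A,B,C,D\in\mathbb{C}$ consider the commutation relations $$[S_\alpha,S_\beta]=-\frac{2h}{1+h^2j_\gamma(C+(j_\alpha+j_\beta)D)}\Bigl((C+Dj_\gamma)\tfrac{S_0S_\gamma+S_\gamma S_0}{2}+(A+Bj_\gamma)S_\gamma+Dk_\gamma S_0+Bk_\gamma\Bigr),$$ $$[S_\gamma,S_0]=-h\Bigl((j_\alpha-j_\beta)(S_\alpha S_\beta+S_\beta S_\alpha)+2(k_\alpha S_\beta-k_\beta S_\alpha)\Bigr)\qquad(\ast)$$ and the inequalities $$\bigl(h^2(C(j_1+j_2-j_3)+2Dj_1j_2)+1\bigr)^4-16h^4(j_1-j_3)(j_2-j_3)(C+Dj_1)(C+Dj_2)\bigl(h^2j_2(C+D(j_1+j_3))+1\bigr)\bigl(h^2j_1(C+D(j_2+j_3))+1\bigr)\ne0,$$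 $$1+h^2(C(j_\alpha+j_\beta-j_\gamma)+2Dj_\alpha j_\beta)\ne0,\qquad 1+h^2j_\gamma(C+D(j_\alpha+j_\beta))\ne0\quad\text{for all }\gamma.\qquad(\ast\ast)$$ 1. Assume that $B_\gamma\ne0$ and $(A_\gamma B_\gamma)^2\ne1$ for all $\gamma$, and that $\sum_\gamma J_\gamma j_\alpha j_\beta(j_\alpha-j_\beta)\ne0$ for every $(J_1,J_2,J_3)\neq 0$ with $A_\gamma B_\gamma J_\gamma=J_\alpha-J_\beta$ for all $\gamma$. If the ideal generated by the $F_\gamma,G_\gamma$ is a quantisation ideal, or if these relations define a quantisation ideal up to cubic polynomials, then there are $h\ne0$ and $A,B,C,D$ satisfying $(\ast\ast)$ such that the relations $F_\gamma=0$, $G_\gamma=0$ are the relations $(\ast)$. 2. Conversely, for all $h,A,B,C,D$ satisfying $(\ast\ast)$, the relations $(\ast)$ are of the form $F_\gamma=0$, $G_\gamma=0$, the ideal that they generate is stable under $\frac{d}{dt}$, and they define a quantisation ideal up to cubic polynomials. 3. For $e,a,b,c,d\in\mathbb C$ let $\{\,,\}^{e}_{a,b,c,d}$ be the antisymmetric biderivation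 of $\mathbb C[S_0,S_1,S_2,S_3]$ with $$\{S_\alpha,S_\beta\}=2\bigl((c+dj_\gamma)S_0S_\gamma+(a+bj_\gamma)S_\gamma+dk_\gamma S_0+bk_\gamma\bigr),\qquad \{S_0,S_\gamma\}=2e\bigl((j_\alpha-j_\beta)S_\alpha S_\beta+k_\alpha S_\beta-k_\beta S_\alpha\bigr).$$ It is a Poisson bracket. If $A,B,C,D$ are functions of $h$, analytic at $h=0$, with values $a,b,c,d$ at $h=0$, then $(\ast\ast)$ holds for all $h$ near $0$. Moreover, as $h\to0$, the right-hand sides of $(\ast)$, taken with commuting variables and divided by $-h$, converge to the brackets $\{S_\alpha,S_\beta\}$, $\{S_\gamma,S_0\}$ of $\{\,,\}^{-1}_{a,b,c,d}$; divided by $h$ they converge to those of $\{\,,\}^{1}_{-a,-b,-c,-d}$. -/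

import Mathlib

open Filter Topology

namespace ZhukovskyVolterra

noncomputable section

/-- The free associative algebra over the complex numbers on four generators. -/
abbrev FA : Type := FreeAlgebra ℂ (Fin 4)

/-- The generator with index `0`. -/
def S0 : FA := FreeAlgebra.ι ℂ 0

/-- The three remaining generators. The indices `1, 2, 3` are modelled by `Fin 3`, so that
`(γ + 1, γ + 2, γ)` is the cyclic triple `(α, β, γ)`. -/
def S (γ : Fin 3) : FA := FreeAlgebra.ι ℂ γ.succ

/-! ### The dynamics on the free algebra -/

/-- The value of the time derivative on the generators:
`dS₀/dt = 0`, `dS_γ/dt = (j_α - j_β)(S_α S_β + S_β S_α) + 2 (k_α S_β - k_β S_α)`. -/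
def velocity (j k : Fin 3 → ℂ) : Fin 4 → FA :=
  Fin.cons 0 fun γ =>
    (j (γ + 1) - j (γ + 2)) • (S (γ + 1) * S (γ + 2) + S (γ + 2) * S (γ + 1))
      + (2 : ℂ) • (k (γ + 1) • S (γ + 2) - k (γ + 2) • S (γ + 1))

/-- The algebra homomorphism `x ↦ x + ε (dx/dt)` to the dual numbers over the free algebra. -/
def flow (j k : Fin 3 → ℂ) : FA →ₐ[ℂ] TrivSqZeroExt FA FA :=
  FreeAlgebra.lift ℂ fun i =>
    TrivSqZeroExt.inl (FreeAlgebra.ι ℂ i) + TrivSqZeroExt.inr (velocity j k i)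

/-- The time derivative `d/dt`: the derivation of the free algebra with the prescribed
values on the generators (see `ddt_ι` and `ddt_mul`). -/
def ddt (j k : Fin 3 → ℂ) : FA →ₗ[ℂ] FA where
  toFun x := (flow j k x).snd
  map_add' x y := by simp
  map_smul' c x := by simp

theorem ddt_ι (j k : Fin 3 → ℂ) (i : Fin 4) :
    ddt j k (FreeAlgebra.ι ℂ i) = velocity j k i := by
  simp [ddt, flow]

theorem flow_fst (j k : Fin 3 → ℂ) (x : FA) : (flow j k x).fst = x := by
  have h : (TrivSqZeroExt.fstHom ℂ FA FA).comp (flow j k) = AlgHom.id ℂ FA := by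
    apply FreeAlgebra.hom_ext
    funext i
    simp [flow]
  exact DFunLike.congr_fun h x

theorem ddt_mul (j k : Fin 3 → ℂ) (x y : FA) :
    ddt j k (x * y) = x * ddt j k y + ddt j k x * y := by
  simp [ddt, flow_fst]

/-! ### Ideals generated by six relations, and their quotients -/

/-- A system of six relations, three of each of two kinds. -/
abbrev Relations : Type := Fin 3 ⊕ Fin 3 → FA

/-- The two-sided ideal generated by the relations. -/
def idealOf (r : Relations) : TwoSidedIdeal FA := TwoSidedIdeal.span (Set.range r)

/-- The ideal is stable under the dynamics. -/
def IsStable (j k : Fin 3 → ℂ) (I : TwoSidedIdeal FA) : Prop :=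
  ∀ x ∈ I, ddt j k x ∈ I

/-- The normally ordered monomial `S₀^n₀ S₁^n₁ S₂^n₂ S₃^n₃`. -/
def orderedMonomial (n : Fin 4 → ℕ) : FA :=
  S0 ^ n 0 * S 0 ^ n 1 * S 1 ^ n 2 * S 2 ^ n 3

/-- The images of the normally ordered monomials form a basis of the quotient algebra. -/
def HasPBWBasis (I : TwoSidedIdeal FA) : Prop :=
  LinearIndependent ℂ (fun n : Fin 4 → ℕ => (I.ringCon.mk' (orderedMonomial n))) ∧
    Submodule.span ℂ (Set.range fun n : Fin 4 → ℕ => (I.ringCon.mk' (orderedMonomial n))) = ⊤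

/-- A quantisation ideal: stable under the dynamics, and with a quotient algebra that has the
normally ordered monomials as a basis. -/
def IsQuantisationIdeal (j k : Fin 3 → ℂ) (I : TwoSidedIdeal FA) : Prop :=
  IsStable j k I ∧ HasPBWBasis I

/-- The monomial given by a word in the generators. -/
def word (w : List (Fin 4)) : FA := (w.map (FreeAlgebra.ι ℂ)).prod

/-- The polynomials of degree at most `N`. -/
def polyLE (N : ℕ) : Submodule ℂ FA :=
  Submodule.span ℂ {x | ∃ w : List (Fin 4), w.length ≤ N ∧ x = word w}

/-- The linear combinations of normally ordered monomials of degree at most `N`. -/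
def orderedLE (N : ℕ) : Submodule ℂ FA :=
  Submodule.span ℂ {x | ∃ n : Fin 4 → ℕ, ∑ i, n i ≤ N ∧ x = orderedMonomial n}

/-- The consequences of degree at most `N` of quadratic relations: the span of the products
`u r v`, with `r` one of the relations and `u`, `v` monomials, of total degree at most `N`.
For `N = 2` these are the combinations of the six relations; for `N = 3` one adds the `48`
products of a relation with a generator, on the left or on the right. -/
def consequencesLE (r : Relations) (N : ℕ) : Submodule ℂ FA :=
  Submodule.span ℂ {x | ∃ (u v : List (Fin 4)) (i : Fin 3 ⊕ Fin 3),
    u.length + 2 + v.length ≤ N ∧ x = word u * r i * word v}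

/-- By means of the relations, polynomials of degree at most `N` can be brought to a unique
normally ordered form. -/
def HasNormalOrdering (r : Relations) (N : ℕ) : Prop :=
  ∀ p ∈ polyLE N, ∃! q : FA, q ∈ orderedLE N ∧ p - q ∈ consequencesLE r N

/-- The relations define a quantisation ideal up to cubic polynomials: the time derivatives of
the generators of the ideal vanish by cubic consequences of the relations, and quadratic and
cubic polynomials have unique normal orderings. -/
def IsCubicQuantisation (j k : Fin 3 → ℂ) (r : Relations) : Prop :=
  (∀ i, ddt j k (r i) ∈ consequencesLE r 3) ∧ HasNormalOrdering r 2 ∧ HasNormalOrdering r 3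

/-! ### The quadratic form of the ideal -/

/-- The eighteen parameters of the quadratic form of the ideal. -/
structure Coeffs where
  A : Fin 3 → ℂ
  B : Fin 3 → ℂ
  K : Fin 3 → ℂ
  M : Fin 3 → ℂ
  N : Fin 3 → ℂ
  l : Fin 3 → ℂ

/-- The generators of the ideal of quadratic form,
`F_γ = S_α S_β - S_β S_α + A_γ (S₀ S_γ + S_γ S₀) + K_γ S₀ + M_γ S_γ + N_γ` and
`G_γ = S_γ S₀ - S₀ S_γ + B_γ (S_α S_β + S_β S_α) + l_α S_β - l_β S_α`. -/
def Coeffs.rel (P : Coeffs) : Relations :=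
  Sum.elim
    (fun γ => S (γ + 1) * S (γ + 2) - S (γ + 2) * S (γ + 1)
      + P.A γ • (S0 * S γ + S γ * S0) + P.K γ • S0 + P.M γ • S γ + algebraMap ℂ FA (P.N γ))
    (fun γ => S γ * S0 - S0 * S γ
      + P.B γ • (S (γ + 1) * S (γ + 2) + S (γ + 2) * S (γ + 1))
      + (P.l (γ + 1) • S (γ + 2) - P.l (γ + 2) • S (γ + 1)))

/-- The non-degenerate case: `B_γ ≠ 0` and `(A_γ B_γ)² ≠ 1`. -/
def Coeffs.Nondegenerate (P : Coeffs) : Prop :=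
  ∀ γ, P.B γ ≠ 0 ∧ (P.A γ * P.B γ) ^ 2 ≠ 1

/-- A nonzero triple `(J₁ : J₂ : J₃)` with `A_γ B_γ = (J_α - J_β) / J_γ`; for
`B_γ = h (j_α - j_β)` this reads `A_γ = (J_α - J_β) / (h J_γ (j_α - j_β))`. -/
def Coeffs.IsParametrisedBy (P : Coeffs) (J : Fin 3 → ℂ) : Prop :=
  J ≠ 0 ∧ ∀ γ, P.A γ * P.B γ * J γ = J (γ + 1) - J (γ + 2)

/-- The parameters do not lie at infinity of the affine chart:
`∑ J_γ j_α j_β (j_α - j_β) ≠ 0`. -/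
def Coeffs.IsAffine (j : Fin 3 → ℂ) (P : Coeffs) : Prop :=
  ∀ J : Fin 3 → ℂ, P.IsParametrisedBy J →
    ∑ γ, J γ * j (γ + 1) * j (γ + 2) * (j (γ + 1) - j (γ + 2)) ≠ 0

/-! ### The five-parameter quantum algebra -/

/-- The commutator `[S_α, S_β]` in the quantum algebra. -/
def commRhs (j k : Fin 3 → ℂ) (h A B C D : ℂ) (γ : Fin 3) : FA :=
  (-(2 * h / (1 + h ^ 2 * j γ * (C + (j (γ + 2) + j (γ + 1)) * D)))) •
    ((C + D * j γ) • ((1 / 2 : ℂ) • (S0 * S γ + S γ * S0)) + (A + B * j γ) • S γ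
      + (D * k γ) • S0 + algebraMap ℂ FA (B * k γ))

/-- The commutator `[S_γ, S₀]` in the quantum algebra. -/
def commRhs₀ (j k : Fin 3 → ℂ) (h : ℂ) (γ : Fin 3) : FA :=
  (-h) • ((j (γ + 1) - j (γ + 2)) • (S (γ + 1) * S (γ + 2) + S (γ + 2) * S (γ + 1))
    + (2 : ℂ) • (k (γ + 1) • S (γ + 2) - k (γ + 2) • S (γ + 1)))

/-- The commutation relations of the quantum algebra. -/
def quantumRel (j k : Fin 3 → ℂ) (h A B C D : ℂ) : Relations :=
  Sum.elim
    (fun γ => S (γ + 1) * S (γ + 2) - S (γ + 2) * S (γ + 1) - commRhs j k h A B C D γ)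
    (fun γ => S γ * S0 - S0 * S γ - commRhs₀ j k h γ)

/-- The non-degeneracy inequalities for the parameters. -/
def Inequalities (j : Fin 3 → ℂ) (h C D : ℂ) : Prop :=
  (h ^ 2 * (C * (j 0 + j 1 - j 2) + 2 * D * j 0 * j 1) + 1) ^ 4
      - 16 * h ^ 4 * (j 0 - j 2) * (j 1 - j 2) * (C + D * j 0) * (C + D * j 1)
        * (h ^ 2 * j 1 * (C + D * (j 0 + j 2)) + 1)
        * (h ^ 2 * j 0 * (C + D * (j 1 + j 2)) + 1) ≠ 0 ∧
  (∀ γ, 1 + h ^ 2 * (C * (j (γ + 1) + j (γ + 2) - j γ) + 2 * D * j (γ + 1) * j (γ + 2)) ≠ 0) ∧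
  (∀ γ, 1 + h ^ 2 * j γ * (C + D * (j (γ + 1) + j (γ + 2))) ≠ 0)

/-! ### The classical side -/

/-- The commutative polynomials in `S₀, S₁, S₂, S₃`. -/
abbrev CP : Type := MvPolynomial (Fin 4) ℂ

/-- The canonical map from the free algebra to commutative polynomials. -/
def abel : FA →ₐ[ℂ] CP := FreeAlgebra.lift ℂ MvPolynomial.X

/-- The classical coordinates `S₁, S₂, S₃`. -/
def s (γ : Fin 3) : CP := MvPolynomial.X γ.succ

/-- The classical coordinate `S₀`. -/
def s0 : CP := MvPolynomial.X 0

/-- The value `{S_α, S_β} = 2 ((c + d j_γ) S₀ S_γ + (a + b j_γ) S_γ + d k_γ S₀ + b k_γ)`. -/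
def bracketSS (j k : Fin 3 → ℂ) (a b c d : ℂ) (γ : Fin 3) : CP :=
  (2 : ℂ) • ((c + d * j γ) • (s0 * s γ) + (a + b * j γ) • s γ + (d * k γ) • s0
    + MvPolynomial.C (b * k γ))

/-- The value `{S₀, S_γ} = e (2 (j_α - j_β) S_α S_β + 2 (k_α S_β - k_β S_α))`. -/
def bracketS0S (j k : Fin 3 → ℂ) (e : ℂ) (γ : Fin 3) : CP :=
  e • ((2 * (j (γ + 1) - j (γ + 2))) • (s (γ + 1) * s (γ + 2))
    + (2 : ℂ) • (k (γ + 1) • s (γ + 2) - k (γ + 2) • s (γ + 1)))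

/-- The bracket `{ , }_{a,b,c,d}` with normalisation `e` of `{S₀, S_γ}`, extended from the
coordinates to all polynomials as an antisymmetric biderivation. -/
def bracket (j k : Fin 3 → ℂ) (e a b c d : ℂ) (f g : CP) : CP :=
  ∑ γ : Fin 3,
    (bracketSS j k a b c d γ *
        (MvPolynomial.pderiv (γ + 1).succ f * MvPolynomial.pderiv (γ + 2).succ g
          - MvPolynomial.pderiv (γ + 2).succ f * MvPolynomial.pderiv (γ + 1).succ g)
      + bracketS0S j k e γ *
        (MvPolynomial.pderiv 0 f * MvPolynomial.pderiv γ.succ g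
          - MvPolynomial.pderiv γ.succ f * MvPolynomial.pderiv 0 g))

/-- Coefficientwise convergence of a family of polynomials, as `h → 0` with `h ≠ 0`. -/
def ClassicalLimit (p : ℂ → CP) (q : CP) : Prop :=
  ∀ m : Fin 4 →₀ ℕ,
    Tendsto (fun h => MvPolynomial.coeff m (p h)) (𝓝[≠] 0) (𝓝 (MvPolynomial.coeff m q))

end

end ZhukovskyVolterra

/-!
Everything is decided by linear algebra in degree at most three.

*Leading parts.* The leading parts of `F_γ`, `G_γ` are homogeneous for the grading by `(ℤ/2)²` in
which `S₀` has degree zero and `S₁, S₂, S₃` have the three nonzero degrees. Modulo the relations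
and lower degrees, the cubic words therefore split into one sector for each `S_γ` and one for
`S₀`, and within a sector the combinations that are even and odd under reversal of words are
nearly decoupled (`IsCubicModel.sector`, `IsCubicModel.sector_zero`). With `J` defined by
`A_γ B_γ J_γ = J_α - J_β`, all of them can be solved explicitly, and cubic words can be reduced to
normally ordered ones when the numbers `sig J γ` and `quartic J` do not vanish. For the
five-parameter family `J_γ` is the denominator `den j h C D γ`, and these conditions together with
`J_γ ≠ 0` are the inequalities of the theorem (`inequalities_iff`).

*The family defines quantisation ideals up to cubic polynomials.* Existence of normal orderings
follows by sectors (`Coeffs.polyLE_three_le_sup`). For uniqueness, dimensions are counted: the 54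
relations and products of relations with a letter satisfy four independent linear relations
(`Coeffs.syzygy_zero`, `Coeffs.syzygy`), so that they span at most 50 dimensions, and
`85 = 50 + 35` with 85 words and 35 normally ordered monomials (`Coeffs.IsCompatible.disjoint`).
Stability holds because `h d/dt` is, modulo the relations, the inner derivation `[S₀, ·]`; for
`h = 0` the relations are those of commuting variables.

*Every quantisation ideal belongs to the family.* Only the independence of the normally ordered
monomials of degree at most three and the membership of the time derivatives of the relations are
used (`Coeffs.Admits`). Independence in the sector of `S₀` forces the existence of `J`
(`exists_param`) and `quartic J ≠ 0`. The time derivative of `G_γ` would shrink the sector of `S_γ`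
unless `B_γ = h (j_α - j_β)` (`B_proportional`). Then `(h d/dt - [S₀, ·]) G_γ` is an element of the
ideal that products with the relations reduce to a quadratic one, which yields `l_γ = 2 h k_γ`
(`l_eq`). The combinations of cubic products in `Coeffs.syzygy` reduce to quadratic elements of the
ideal too, and their vanishing gives linear equations for `K`, `M`, `N` (`syzygy_coeffs`). The
affine normalisation of `J` identifies it with the denominators, and the equations for the
remaining coefficients can be solved
(`exists_eq_den`, `Coeffs.exists_eq_quantumCoeffs`).

*Classical limit.* The Jacobi identity is checked on coordinates, the jacobiator being a derivation
in each argument (`jacobi`); the limits follow by continuity.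
-/

namespace ZhukovskyVolterra

noncomputable section

/-! ### The cubic part of the relations -/

theorem add_one_one (γ : Fin 3) : γ + 1 + 1 = γ + 2 := by decide +revert
theorem add_one_two (γ : Fin 3) : γ + 1 + 2 = γ := by decide +revert
theorem add_two_one (γ : Fin 3) : γ + 2 + 1 = γ := by decide +revert
theorem add_two_two (γ : Fin 3) : γ + 2 + 2 = γ + 1 := by decide +revert

section CubicModel

variable {Q : Type*} [AddCommGroup Q] [Module ℂ Q]

/-- A family of vectors `T x y z`, indexed by the words of length three, that satisfies the
leading cubic parts of all products of the relations `F_γ`, `G_γ` with a letter on the left or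
on the right. These equations respect the grading of words by `(ℤ/2)²` in which `S₀` has degree
zero and `S₁, S₂, S₃` have the three nonzero degrees; the words of length three with the degree of
a letter form the sector of that letter. -/
structure IsCubicModel (A B : Fin 3 → ℂ) (T : Fin 4 → Fin 4 → Fin 4 → Q) : Prop where
  Fl : ∀ γ x, T x (γ + 1).succ (γ + 2).succ - T x (γ + 2).succ (γ + 1).succ
    + A γ • (T x 0 γ.succ + T x γ.succ 0) = 0
  Fr : ∀ γ x, T (γ + 1).succ (γ + 2).succ x - T (γ + 2).succ (γ + 1).succ x
    + A γ • (T 0 γ.succ x + T γ.succ 0 x) = 0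
  Gl : ∀ γ x, T x γ.succ 0 - T x 0 γ.succ
    + B γ • (T x (γ + 1).succ (γ + 2).succ + T x (γ + 2).succ (γ + 1).succ) = 0
  Gr : ∀ γ x, T γ.succ 0 x - T 0 γ.succ x
    + B γ • (T (γ + 1).succ (γ + 2).succ x + T (γ + 2).succ (γ + 1).succ x) = 0

/-- The sum of a word and its reversal. -/
def sym (T : Fin 4 → Fin 4 → Fin 4 → Q) (x y z : Fin 4) : Q := T x y z + T z y x

/-- The difference of a word and its reversal. -/
def skew (T : Fin 4 → Fin 4 → Fin 4 → Q) (x y z : Fin 4) : Q := T x y z - T z y x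

theorem eq_zero_of_sym_skew {T : Fin 4 → Fin 4 → Fin 4 → Q} {x y z : Fin 4}
    (h : sym T x y z = 0) (h' : skew T x y z = 0) : T x y z = 0 ∧ T z y x = 0 := by
  simp only [sym, skew] at h h'
  constructor
  · linear_combination (norm := module) (1 / 2 : ℂ) • h + (1 / 2 : ℂ) • h'
  · linear_combination (norm := module) (1 / 2 : ℂ) • h - (1 / 2 : ℂ) • h'

variable {A B : Fin 3 → ℂ} {T : Fin 4 → Fin 4 → Fin 4 → Q}

/-- The consequences of the relations in the sector of `S₀`, for the words that contain each of
`S₁, S₂, S₃` once, or `S₀` once and `S_γ` twice. The symmetrised words `S_α S_β S_γ` decouple from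
the antisymmetrised ones. -/
theorem IsCubicModel.sector_zero (h : IsCubicModel A B T) (γ : Fin 3) :
    (1 - A γ * B γ) • sym T (γ + 2).succ (γ + 1).succ γ.succ
      = (1 + A γ * B γ) • sym T (γ + 1).succ (γ + 2).succ γ.succ ∧
    skew T 0 γ.succ γ.succ = B γ • (sym T (γ + 2).succ (γ + 1).succ γ.succ
        + sym T (γ + 1).succ (γ + 2).succ γ.succ) ∧
    (2 : ℂ) • T γ.succ 0 γ.succ = sym T 0 γ.succ γ.succ
      - B γ • (skew T (γ + 2).succ (γ + 1).succ γ.succ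
        + skew T (γ + 1).succ (γ + 2).succ γ.succ) ∧
    (1 + A γ * B γ) • skew T (γ + 2).succ (γ + 1).succ γ.succ
      = (1 - A γ * B γ) • skew T (γ + 1).succ (γ + 2).succ γ.succ
      + (2 * A γ) • sym T 0 γ.succ γ.succ := by
  have h1 := h.Fl γ γ.succ
  have h2 := h.Fr γ γ.succ
  have h3 := h.Gl γ γ.succ
  have h4 := h.Gr γ γ.succ
  simp only [sym, skew]
  refine ⟨?_, ?_, ?_, ?_⟩
  · linear_combination (norm := module) h1 - h2 - A γ • h3 - A γ • h4
  · linear_combination (norm := module) -h3 - h4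
  · linear_combination (norm := module) h4 - h3
  · linear_combination (norm := module) -h1 - h2 - A γ • h3 + A γ • h4

/-- The consequences of the relations in the sector of `S_γ`, for the words that contain
`S₀, S_α, S_β` once each, or `S_γ` once and another letter twice. -/
theorem IsCubicModel.sector (h : IsCubicModel A B T) (γ : Fin 3) :
    ((1 + A γ * B γ) • sym T 0 (γ + 1).succ (γ + 2).succ
      = (1 - A γ * B γ) • sym T 0 (γ + 2).succ (γ + 1).succ) ∧
    ((1 + A (γ + 2) * B (γ + 2)) • sym T 0 (γ + 2).succ (γ + 1).succ
      = (1 - A (γ + 2) * B (γ + 2)) • sym T (γ + 1).succ 0 (γ + 2).succ) ∧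
    skew T 0 0 γ.succ
      = B γ • (sym T 0 (γ + 1).succ (γ + 2).succ + sym T 0 (γ + 2).succ (γ + 1).succ) ∧
    skew T (γ + 1).succ (γ + 1).succ γ.succ
      = A (γ + 2) • (sym T (γ + 1).succ 0 (γ + 2).succ + sym T 0 (γ + 2).succ (γ + 1).succ) ∧
    skew T (γ + 2).succ (γ + 2).succ γ.succ
      = -A (γ + 1) • (sym T (γ + 1).succ 0 (γ + 2).succ + sym T 0 (γ + 1).succ (γ + 2).succ) ∧
    (2 : ℂ) • T 0 γ.succ 0 = sym T 0 0 γ.succ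
      - B γ • (skew T 0 (γ + 1).succ (γ + 2).succ + skew T 0 (γ + 2).succ (γ + 1).succ) ∧
    (2 : ℂ) • T (γ + 1).succ γ.succ (γ + 1).succ = sym T (γ + 1).succ (γ + 1).succ γ.succ
      - A (γ + 2) • (skew T (γ + 1).succ 0 (γ + 2).succ
        - skew T 0 (γ + 2).succ (γ + 1).succ) ∧
    (2 : ℂ) • T (γ + 2).succ γ.succ (γ + 2).succ = sym T (γ + 2).succ (γ + 2).succ γ.succ
      - A (γ + 1) • (skew T 0 (γ + 1).succ (γ + 2).succ
        + skew T (γ + 1).succ 0 (γ + 2).succ) ∧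
    (1 + A γ * B γ) • skew T 0 (γ + 2).succ (γ + 1).succ
      = (1 - A γ * B γ) • skew T 0 (γ + 1).succ (γ + 2).succ
        + (2 * A γ) • sym T 0 0 γ.succ ∧
    (1 - A (γ + 2) * B (γ + 2)) • skew T 0 (γ + 2).succ (γ + 1).succ
      = -(1 + A (γ + 2) * B (γ + 2)) • skew T (γ + 1).succ 0 (γ + 2).succ
        + (2 * B (γ + 2)) • sym T (γ + 1).succ (γ + 1).succ γ.succ ∧
    (1 + A (γ + 1) * B (γ + 1)) • skew T 0 (γ + 1).succ (γ + 2).succ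
      = (1 - A (γ + 1) * B (γ + 1)) • skew T (γ + 1).succ 0 (γ + 2).succ
        + (2 * B (γ + 1)) • sym T (γ + 2).succ (γ + 2).succ γ.succ := by
  have f1 := h.Fl γ 0
  have f2 := h.Fr γ 0
  have f3 := h.Gl γ 0
  have f4 := h.Gr γ 0
  have b1 := h.Fl (γ + 2) (γ + 1).succ
  have b2 := h.Fr (γ + 2) (γ + 1).succ
  have b3 := h.Gl (γ + 2) (γ + 1).succ
  have b4 := h.Gr (γ + 2) (γ + 1).succ
  have a1 := h.Fl (γ + 1) (γ + 2).succ
  have a2 := h.Fr (γ + 1) (γ + 2).succ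
  have a3 := h.Gl (γ + 1) (γ + 2).succ
  have a4 := h.Gr (γ + 1) (γ + 2).succ
  simp only [add_one_one, add_one_two, add_two_one, add_two_two] at b1 b2 b3 b4 a1 a2 a3 a4
  simp only [sym, skew]
  refine ⟨?_, ?_, ?_, ?_, ?_, ?_, ?_, ?_, ?_, ?_, ?_⟩
  · linear_combination (norm := module) f1 - f2 + A γ • f3 + A γ • f4
  · linear_combination (norm := module) b3 - b4 + B (γ + 2) • (b1 + b2)
  · linear_combination (norm := module) - f3 - f4
  · linear_combination (norm := module) - b1 - b2
  · linear_combination (norm := module) a1 + a2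
  · linear_combination (norm := module) f3 - f4
  · linear_combination (norm := module) b1 - b2
  · linear_combination (norm := module) a2 - a1
  · linear_combination (norm := module) -f1 - f2 + A γ • (f3 - f4)
  · linear_combination (norm := module) -b3 - b4 + B (γ + 2) • (b1 - b2)
  · linear_combination (norm := module) -a3 - a4 + B (γ + 1) • (a2 - a1)

/-- The words of the sector of `S_γ` vanish as soon as a few of their combinations do. -/
theorem IsCubicModel.sector_eq_zero (h : IsCubicModel A B T)
    (ht : ∀ γ, (A γ * B γ) ^ 2 ≠ 1) (γ : Fin 3)
    (hE : sym T (γ + 1).succ 0 (γ + 2).succ = 0) (hD : skew T (γ + 1).succ 0 (γ + 2).succ = 0)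
    (hDα : skew T 0 (γ + 1).succ (γ + 2).succ = 0) (hDβ : skew T 0 (γ + 2).succ (γ + 1).succ = 0)
    (hs : sym T 0 0 γ.succ = 0 ∨ T 0 0 γ.succ = 0)
    (hα : sym T (γ + 1).succ (γ + 1).succ γ.succ = 0 ∨ T (γ + 1).succ (γ + 1).succ γ.succ = 0 ∨
      T γ.succ (γ + 1).succ (γ + 1).succ = 0)
    (hβ : sym T (γ + 2).succ (γ + 2).succ γ.succ = 0 ∨ T (γ + 2).succ (γ + 2).succ γ.succ = 0 ∨
      T γ.succ (γ + 2).succ (γ + 2).succ = 0) :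
    (T 0 0 γ.succ = 0 ∧ T γ.succ 0 0 = 0 ∧ T 0 γ.succ 0 = 0) ∧
    (T (γ + 1).succ (γ + 1).succ γ.succ = 0 ∧ T γ.succ (γ + 1).succ (γ + 1).succ = 0 ∧
      T (γ + 1).succ γ.succ (γ + 1).succ = 0) ∧
    (T (γ + 2).succ (γ + 2).succ γ.succ = 0 ∧ T γ.succ (γ + 2).succ (γ + 2).succ = 0 ∧
      T (γ + 2).succ γ.succ (γ + 2).succ = 0) ∧
    (T (γ + 1).succ 0 (γ + 2).succ = 0 ∧ T (γ + 2).succ 0 (γ + 1).succ = 0) ∧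
    (T 0 (γ + 1).succ (γ + 2).succ = 0 ∧ T (γ + 2).succ (γ + 1).succ 0 = 0) ∧
    (T 0 (γ + 2).succ (γ + 1).succ = 0 ∧ T (γ + 1).succ (γ + 2).succ 0 = 0) := by
  obtain ⟨e1, e2, d0, d1, d2, m0, m1, m2, -, -, -⟩ := h.sector γ
  have hp : ∀ γ, 1 + A γ * B γ ≠ 0 := fun γ h0 =>
    ht γ (by linear_combination (A γ * B γ - 1) * h0)
  have hEβ : sym T 0 (γ + 2).succ (γ + 1).succ = 0 := by
    rw [hE, smul_zero] at e2
    exact (smul_eq_zero.1 e2).resolve_left (hp _)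
  have hEα : sym T 0 (γ + 1).succ (γ + 2).succ = 0 := by
    rw [hEβ, smul_zero] at e1
    exact (smul_eq_zero.1 e1).resolve_left (hp _)
  rw [hEα, hEβ, add_zero, smul_zero] at d0
  rw [hE, hEβ, add_zero, smul_zero] at d1
  rw [hE, hEα, add_zero, smul_zero] at d2
  have key : ∀ x y : Fin 4, skew T x x y = 0 → (sym T x x y = 0 ∨ T x x y = 0 ∨ T y x x = 0) →
      sym T x x y = 0 := by
    intro x y h1 h2
    simp only [sym, skew] at *
    rcases h2 with h2 | h2 | h2
    · exact h2
    · linear_combination (norm := module) (2 : ℂ) • h2 - h1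
    · linear_combination (norm := module) (2 : ℂ) • h2 + h1
  have s0 := key _ _ d0 (hs.imp_right Or.inl)
  have s1 := key _ _ d1 hα
  have s2 := key _ _ d2 hβ
  rw [s0, hDα, hDβ, add_zero, smul_zero, sub_zero] at m0
  rw [s1, hD, hDβ, sub_zero, smul_zero, sub_zero] at m1
  rw [s2, hD, hDα, add_zero, smul_zero, sub_zero] at m2
  have two : ∀ q : Q, (2 : ℂ) • q = 0 → q = 0 := fun q hq =>
    (smul_eq_zero.1 hq).resolve_left two_ne_zero
  have w0 := eq_zero_of_sym_skew s0 d0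
  have w1 := eq_zero_of_sym_skew s1 d1
  have w2 := eq_zero_of_sym_skew s2 d2
  exact ⟨⟨w0.1, w0.2, two _ m0⟩, ⟨w1.1, w1.2, two _ m1⟩, ⟨w2.1, w2.2, two _ m2⟩,
    eq_zero_of_sym_skew hE hD, eq_zero_of_sym_skew hEα hDα, eq_zero_of_sym_skew hEβ hDβ⟩

end CubicModel

/-! ### Normal ordering of cubic words -/

section Spanning

/-- The combination `J_α + J_β - J_γ`. When `A_γ B_γ J_γ = J_α - J_β`, it is
`(1 - A_α B_α) J_α = (1 + A_β B_β) J_β`. -/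
def sig (J : Fin 3 → ℂ) (γ : Fin 3) : ℂ := J (γ + 1) + J (γ + 2) - J γ

/-- The quartic form in `J` whose non-vanishing allows the normal ordering of cubic words. -/
def quartic (J : Fin 3 → ℂ) : ℂ :=
  sig J 0 ^ 2 * sig J 2 ^ 2 - sig J 0 ^ 2 * sig J 1 ^ 2 + sig J 1 ^ 2 * sig J 2 ^ 2

variable {Q : Type*} [AddCommGroup Q] [Module ℂ Q]
variable {A B J : Fin 3 → ℂ} {T : Fin 4 → Fin 4 → Fin 4 → Q}

theorem eq_zero_of_smul {c : ℂ} (hc : c ≠ 0) {q : Q} (h : c • q = 0) : q = 0 :=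
  (smul_eq_zero.1 h).resolve_left hc

/-- The equations of the sector of `S_γ`, with the symmetrised words solved in terms of a single
vector `ε`. -/
theorem IsCubicModel.sector_param (h : IsCubicModel A B T)
    (hJ : ∀ γ, A γ * B γ * J γ = J (γ + 1) - J (γ + 2)) (hσ : ∀ γ, sig J γ ≠ 0) (γ : Fin 3) :
    ∃ ε : Q, sym T (γ + 1).succ 0 (γ + 2).succ = (sig J (γ + 1) * sig J (γ + 2)) • ε ∧
      sym T 0 (γ + 1).succ (γ + 2).succ = (sig J (γ + 1) * sig J γ) • ε ∧
      sym T 0 (γ + 2).succ (γ + 1).succ = (sig J (γ + 2) * sig J γ) • ε ∧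
      sig J (γ + 2) • skew T 0 (γ + 2).succ (γ + 1).succ
        = sig J (γ + 1) • skew T 0 (γ + 1).succ (γ + 2).succ + (4 * J γ * A γ) • T 0 0 γ.succ
          - ((sig J (γ + 2) ^ 2 - sig J (γ + 1) ^ 2) * sig J γ) • ε ∧
      sig J γ • skew T 0 (γ + 2).succ (γ + 1).succ
        = -sig J (γ + 1) • skew T (γ + 1).succ 0 (γ + 2).succ
          + (2 * J (γ + 2) * B (γ + 2)) • sym T (γ + 1).succ (γ + 1).succ γ.succ ∧
      (2 * J (γ + 2) * B (γ + 2)) • skew T (γ + 1).succ (γ + 1).succ γ.succ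
        = ((sig J (γ + 1) ^ 2 - sig J γ ^ 2) * sig J (γ + 2)) • ε ∧
      sig J γ • skew T 0 (γ + 1).succ (γ + 2).succ
        = sig J (γ + 2) • skew T (γ + 1).succ 0 (γ + 2).succ
          + (2 * J (γ + 1) * B (γ + 1)) • sym T (γ + 2).succ (γ + 2).succ γ.succ ∧
      (2 * J (γ + 1) * B (γ + 1)) • skew T (γ + 2).succ (γ + 2).succ γ.succ
        = ((sig J (γ + 2) ^ 2 - sig J γ ^ 2) * sig J (γ + 1)) • ε := by
  obtain ⟨e1, e2, d0, d1, d2, -, -, -, qA, qB, qC⟩ := h.sector γ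
  have j0 := hJ γ
  have j1 := hJ (γ + 1)
  have j2 := hJ (γ + 2)
  have hα := hσ (γ + 1)
  have hβ := hσ (γ + 2)
  have sα : sig J (γ + 1) = J (γ + 2) + J γ - J (γ + 1) := by
    simp only [sig, add_one_one, add_one_two]
  have sβ : sig J (γ + 2) = J γ + J (γ + 1) - J (γ + 2) := by
    simp only [sig, add_two_one, add_two_two]
  have sγ : sig J γ = J (γ + 1) + J (γ + 2) - J γ := rfl
  simp only [add_one_one, add_one_two, add_two_one, add_two_two] at j1 j2
  obtain ⟨ε, hε⟩ : ∃ ε : Q, sym T (γ + 1).succ 0 (γ + 2).succ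
      = (sig J (γ + 1) * sig J (γ + 2)) • ε :=
    ⟨(sig J (γ + 1) * sig J (γ + 2))⁻¹ • sym T (γ + 1).succ 0 (γ + 2).succ, by
      rw [smul_smul, mul_inv_cancel₀ (mul_ne_zero hα hβ), one_smul]⟩
  have hEβ : sym T 0 (γ + 2).succ (γ + 1).succ = (sig J (γ + 2) * sig J γ) • ε := by
    refine sub_eq_zero.1 (eq_zero_of_smul hα ?_)
    rw [hε] at e2
    generalize sym T 0 (γ + 2).succ (γ + 1).succ = X at *
    have c1 : sig J (γ + 1) = (1 + A (γ + 2) * B (γ + 2)) * J (γ + 2) := by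
      rw [sα]; linear_combination -j2
    have c2 : sig J γ = (1 - A (γ + 2) * B (γ + 2)) * J (γ + 2) := by
      rw [sγ]; linear_combination j2
    linear_combination (norm := module) J (γ + 2) • e2 + c1 • X
      - (sig J (γ + 1) * sig J (γ + 2) * c2) • ε
  have hEα : sym T 0 (γ + 1).succ (γ + 2).succ = (sig J (γ + 1) * sig J γ) • ε := by
    refine sub_eq_zero.1 (eq_zero_of_smul hβ ?_)
    rw [hEβ] at e1
    generalize sym T 0 (γ + 1).succ (γ + 2).succ = X at *
    have c1 : sig J (γ + 2) = (1 + A γ * B γ) * J γ := by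
      rw [sβ]; linear_combination -j0
    have c2 : sig J (γ + 1) = (1 - A γ * B γ) * J γ := by
      rw [sα]; linear_combination j0
    linear_combination (norm := module) J γ • e1 + c1 • X
      - (sig J γ * sig J (γ + 2) * c2) • ε
  rw [hEα, hEβ] at d0
  rw [hε, hEβ] at d1
  rw [hε, hEα] at d2
  refine ⟨ε, hε, hEα, hEβ, ?_, ?_, ?_, ?_, ?_⟩
  · have c1 : sig J (γ + 2) = (1 + A γ * B γ) * J γ := by
      rw [sβ]; linear_combination -j0
    have c2 : sig J (γ + 1) = (1 - A γ * B γ) * J γ := by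
      rw [sα]; linear_combination j0
    have c3 : 2 * J γ * A γ * B γ * (sig J (γ + 1) * sig J γ + sig J (γ + 2) * sig J γ)
        = (sig J (γ + 2) ^ 2 - sig J (γ + 1) ^ 2) * sig J γ := by
      rw [sα, sβ]; linear_combination 4 * J γ * sig J γ * j0
    have hs : sym T 0 0 γ.succ = (2 : ℂ) • T 0 0 γ.succ - skew T 0 0 γ.succ := by
      simp only [sym, skew]; module
    rw [hs, d0] at qA
    linear_combination (norm := module) J γ • qA + c1 • skew T 0 (γ + 2).succ (γ + 1).succ
      - c2 • skew T 0 (γ + 1).succ (γ + 2).succ - c3 • ε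
  · have c1 : sig J (γ + 1) = (1 + A (γ + 2) * B (γ + 2)) * J (γ + 2) := by
      rw [sα]; linear_combination -j2
    have c2 : sig J γ = (1 - A (γ + 2) * B (γ + 2)) * J (γ + 2) := by
      rw [sγ]; linear_combination j2
    linear_combination (norm := module) J (γ + 2) • qB
      + c2 • skew T 0 (γ + 2).succ (γ + 1).succ + c1 • skew T (γ + 1).succ 0 (γ + 2).succ
  · have c3 : 2 * J (γ + 2) * B (γ + 2) * A (γ + 2) *
        (sig J (γ + 1) * sig J (γ + 2) + sig J (γ + 2) * sig J γ)
        = (sig J (γ + 1) ^ 2 - sig J γ ^ 2) * sig J (γ + 2) := by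
      rw [sα, sγ]; linear_combination 4 * J (γ + 2) * sig J (γ + 2) * j2
    rw [d1]
    linear_combination (norm := module) c3 • ε
  · have c1 : sig J γ = (1 + A (γ + 1) * B (γ + 1)) * J (γ + 1) := by
      rw [sγ]; linear_combination -j1
    have c2 : sig J (γ + 2) = (1 - A (γ + 1) * B (γ + 1)) * J (γ + 1) := by
      rw [sβ]; linear_combination j1
    linear_combination (norm := module) J (γ + 1) • qC
      + c1 • skew T 0 (γ + 1).succ (γ + 2).succ - c2 • skew T (γ + 1).succ 0 (γ + 2).succ
  · have c3 : -(2 * J (γ + 1) * B (γ + 1) * A (γ + 1) *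
        (sig J (γ + 1) * sig J (γ + 2) + sig J (γ + 1) * sig J γ))
        = (sig J (γ + 2) ^ 2 - sig J γ ^ 2) * sig J (γ + 1) := by
      rw [sβ, sγ]; linear_combination -4 * J (γ + 1) * sig J (γ + 1) * j1
    rw [d2]
    linear_combination (norm := module) c3 • ε

/-- In the sector of `S₀`, the relations leave one linear relation between
the normally ordered words and the vector `ε` that parametrises the symmetrised words. -/
theorem IsCubicModel.sector_zero_param (h : IsCubicModel A B T)
    (hJ : ∀ γ, A γ * B γ * J γ = J (γ + 1) - J (γ + 2)) (hσ : ∀ γ, sig J γ ≠ 0) :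
    ∃ ε : Q, sym T 2 1 3 = (sig J 1 * sig J 2) • ε ∧ sym T 1 2 3 = (sig J 0 * sig J 2) • ε ∧
      sym T 1 3 2 = (sig J 0 * sig J 1) • ε ∧
      sig J 1 • skew T 1 3 2 = sig J 2 • skew T 1 2 3 + (4 * J 0 * A 0) • T 0 1 1
        - ((sig J 2 ^ 2 - sig J 1 ^ 2) * sig J 0) • ε ∧
      sig J 1 • skew T 2 1 3 = sig J 0 • skew T 1 2 3 + (4 * J 2 * A 2) • T 0 3 3
        - ((sig J 1 ^ 2 - sig J 0 ^ 2) * sig J 2) • ε ∧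
      (4 * sig J 0 * sig J 2) • T 1 2 3 + (4 * sig J 0 * J 0 * A 0) • T 0 1 1
        - (4 * sig J 1 * J 1 * A 1) • T 0 2 2 + (4 * sig J 2 * J 2 * A 2) • T 0 3 3
        = (2 * quartic J) • ε := by
  have sc : ∀ x y z, sym T x y z = sym T z y x := fun x y z => add_comm _ _
  have kc : ∀ x y z, skew T x y z = -skew T z y x := fun x y z => (neg_sub _ _).symm
  have h0 := h.sector_zero 0
  have h1 := h.sector_zero 1
  have h2 := h.sector_zero 2
  have j0 := hJ 0
  have j1 := hJ 1
  have j2 := hJ 2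
  simp only [show (0 : Fin 3) + 1 = 1 from rfl, show (0 : Fin 3) + 2 = 2 from rfl,
    show (1 : Fin 3) + 1 = 2 from rfl, show (1 : Fin 3) + 2 = 0 from rfl,
    show (2 : Fin 3) + 1 = 0 from rfl, show (2 : Fin 3) + 2 = 1 from rfl,
    show (0 : Fin 3).succ = 1 from rfl, show (1 : Fin 3).succ = 2 from rfl,
    show (2 : Fin 3).succ = 3 from rfl] at h0 h1 h2 j0 j1 j2
  rw [sc 3 2 1, sc 2 3 1, kc 3 2 1, kc 2 3 1] at h0
  rw [sc 3 1 2, kc 3 1 2] at h1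
  obtain ⟨e0, d0, -, q0⟩ := h0
  obtain ⟨e1, d1, -, q1⟩ := h1
  obtain ⟨e2, d2, -, q2⟩ := h2
  have s0 : sig J 0 = J 1 + J 2 - J 0 := rfl
  have s1 : sig J 1 = J 2 + J 0 - J 1 := rfl
  have s2 : sig J 2 = J 0 + J 1 - J 2 := rfl
  have hs : ∀ x, sym T 0 x x = (2 : ℂ) • T 0 x x - skew T 0 x x := by
    intro x; simp only [sym, skew]; module
  obtain ⟨ε, hε⟩ : ∃ ε : Q, sym T 1 2 3 = (sig J 0 * sig J 2) • ε :=
    ⟨(sig J 0 * sig J 2)⁻¹ • sym T 1 2 3, by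
      rw [smul_smul, mul_inv_cancel₀ (mul_ne_zero (hσ 0) (hσ 2)), one_smul]⟩
  have p0 : sig J 2 = (1 + A 0 * B 0) * J 0 := by rw [s2]; linear_combination -j0
  have m0 : sig J 1 = (1 - A 0 * B 0) * J 0 := by rw [s1]; linear_combination j0
  have p1 : sig J 0 = (1 + A 1 * B 1) * J 1 := by rw [s0]; linear_combination -j1
  have m1 : sig J 2 = (1 - A 1 * B 1) * J 1 := by rw [s2]; linear_combination j1
  have p2 : sig J 1 = (1 + A 2 * B 2) * J 2 := by rw [s1]; linear_combination -j2
  have m2 : sig J 0 = (1 - A 2 * B 2) * J 2 := by rw [s0]; linear_combination j2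
  have u3 : sym T 1 3 2 = (sig J 0 * sig J 1) • ε := by
    refine sub_eq_zero.1 (eq_zero_of_smul (hσ 2) ?_)
    rw [hε] at e0
    linear_combination (norm := module) -J 0 • e0 + p0 • sym T 1 3 2
      - (sig J 0 * sig J 2 * m0) • ε
  have u1 : sym T 2 1 3 = (sig J 1 * sig J 2) • ε := by
    refine sub_eq_zero.1 (eq_zero_of_smul (hσ 0) ?_)
    rw [hε] at e2
    linear_combination (norm := module) J 2 • e2 + m2 • sym T 2 1 3
      - (sig J 0 * sig J 2 * p2) • ε
  rw [hε, u3] at d0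
  rw [u3, u1] at d1
  rw [u1, hε] at d2
  rw [hs, d0] at q0
  rw [hs, d1] at q1
  rw [hs, d2] at q2
  have q0' : sig J 1 • skew T 1 3 2 = sig J 2 • skew T 1 2 3 + (4 * J 0 * A 0) • T 0 1 1
        - ((sig J 2 ^ 2 - sig J 1 ^ 2) * sig J 0) • ε := by
    have c3 : 2 * J 0 * A 0 * B 0 * (sig J 0 * sig J 2 + sig J 0 * sig J 1)
        = (sig J 2 ^ 2 - sig J 1 ^ 2) * sig J 0 := by
      rw [s1, s2]; linear_combination 4 * J 0 * sig J 0 * j0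
    linear_combination (norm := module) J 0 • q0 + m0 • skew T 1 3 2 - p0 • skew T 1 2 3
      - c3 • ε
  have q2' : sig J 1 • skew T 2 1 3 = sig J 0 • skew T 1 2 3 + (4 * J 2 * A 2) • T 0 3 3
        - ((sig J 1 ^ 2 - sig J 0 ^ 2) * sig J 2) • ε := by
    have c3 : 2 * J 2 * A 2 * B 2 * (sig J 1 * sig J 2 + sig J 0 * sig J 2)
        = (sig J 1 ^ 2 - sig J 0 ^ 2) * sig J 2 := by
      rw [s1, s0]; linear_combination 4 * J 2 * sig J 2 * j2
    linear_combination (norm := module) J 2 • q2 + p2 • skew T 2 1 3 - m2 • skew T 1 2 3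
      - c3 • ε
  have q1' : sig J 0 • skew T 1 3 2 = -sig J 2 • skew T 2 1 3 + (4 * J 1 * A 1) • T 0 2 2
        - ((sig J 0 ^ 2 - sig J 2 ^ 2) * sig J 1) • ε := by
    have c3 : 2 * J 1 * A 1 * B 1 * (sig J 0 * sig J 1 + sig J 1 * sig J 2)
        = (sig J 0 ^ 2 - sig J 2 ^ 2) * sig J 1 := by
      rw [s0, s2]; linear_combination 4 * J 1 * sig J 1 * j1
    linear_combination (norm := module) J 1 • q1 + p1 • skew T 1 3 2 + m1 • skew T 2 1 3
      - c3 • ε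
  refine ⟨ε, u1, hε, u3, q0', q2', ?_⟩
  have hw : T 1 2 3 = (1 / 2 : ℂ) • skew T 1 2 3 + ((1 / 2) * (sig J 0 * sig J 2)) • ε := by
    rw [mul_smul, ← hε]; simp only [sym, skew]; module
  rw [hw, quartic]
  linear_combination (norm := module) sig J 1 • q1' - sig J 0 • q0' - sig J 2 • q2'

/-- In the sector of `S₀`, if the normally ordered words other than `S₀³` vanish, then so do all
other words except `S₀³`. -/
theorem IsCubicModel.sector_zero_eq_zero (h : IsCubicModel A B T)
    (hJ : ∀ γ, A γ * B γ * J γ = J (γ + 1) - J (γ + 2)) (hσ : ∀ γ, sig J γ ≠ 0)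
    (hQ : quartic J ≠ 0) (w0 : T 1 2 3 = 0) (w1 : T 0 1 1 = 0) (w2 : T 0 2 2 = 0)
    (w3 : T 0 3 3 = 0) :
    (T 1 2 3 = 0 ∧ T 3 2 1 = 0) ∧ (T 1 3 2 = 0 ∧ T 2 3 1 = 0) ∧ (T 2 1 3 = 0 ∧ T 3 1 2 = 0) ∧
      (T 1 1 0 = 0 ∧ T 1 0 1 = 0) ∧ (T 2 2 0 = 0 ∧ T 2 0 2 = 0) ∧
      (T 3 3 0 = 0 ∧ T 3 0 3 = 0) := by
  obtain ⟨ε, u1, u2, u3, q3, q1, q⟩ := h.sector_zero_param hJ hσ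
  have hε : ε = 0 := by
    simp only [w0, w1, w2, w3, smul_zero, add_zero, sub_zero] at q
    exact eq_zero_of_smul (mul_ne_zero two_ne_zero hQ) q.symm
  have two : ∀ q : Q, (2 : ℂ) • q = 0 → q = 0 := fun q => eq_zero_of_smul two_ne_zero
  simp only [hε, smul_zero] at u1 u2 u3
  have v2 : skew T 1 2 3 = 0 := by
    simp only [sym, skew, w0] at u2 ⊢
    linear_combination (norm := module) -u2
  simp only [v2, w1, w3, hε, smul_zero, add_zero, sub_zero] at q3 q1
  have v3 := eq_zero_of_smul (hσ 1) q3
  have v1 := eq_zero_of_smul (hσ 1) q1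
  obtain ⟨x1, x2⟩ := eq_zero_of_sym_skew u1 v1
  obtain ⟨y1, y2⟩ := eq_zero_of_sym_skew u2 v2
  obtain ⟨z1, z2⟩ := eq_zero_of_sym_skew u3 v3
  have key : ∀ γ : Fin 3, T 0 γ.succ γ.succ = 0 →
      sym T (γ + 2).succ (γ + 1).succ γ.succ = 0 → sym T (γ + 1).succ (γ + 2).succ γ.succ = 0 →
      skew T (γ + 2).succ (γ + 1).succ γ.succ = 0 → skew T (γ + 1).succ (γ + 2).succ γ.succ = 0 →
      T γ.succ γ.succ 0 = 0 ∧ T γ.succ 0 γ.succ = 0 := by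
    intro γ g0 g1 g2 g3 g4
    obtain ⟨-, d, m, -⟩ := h.sector_zero γ
    rw [g1, g2, add_zero, smul_zero] at d
    rw [g3, g4, add_zero, smul_zero, sub_zero] at m
    have g5 : T γ.succ γ.succ 0 = 0 := by
      simp only [skew, g0] at d
      linear_combination (norm := module) -d
    refine ⟨g5, two _ ?_⟩
    rw [m, sym, g0, g5, add_zero]
  have k0 := key 0 w1 (by simp [sym, *]) (by simp [sym, *]) (by simp [skew, *])
    (by simp [skew, *])
  have k1 := key 1 w2 (by simp [sym, *]) (by simp [sym, *]) (by simp [skew, *])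
    (by simp [skew, *])
  have k2 := key 2 w3 (by simp [sym, *]) (by simp [sym, *]) (by simp [skew, *])
    (by simp [skew, *])
  exact ⟨⟨y1, y2⟩, ⟨z1, z2⟩, ⟨x1, x2⟩, k0, k1, k2⟩

theorem sq_ne_one_of_sig (hJ : ∀ γ, A γ * B γ * J γ = J (γ + 1) - J (γ + 2))
    (hσ : ∀ γ, sig J γ ≠ 0) (γ : Fin 3) : (A γ * B γ) ^ 2 ≠ 1 := by
  intro h
  have j0 := hJ γ
  have sα : sig J (γ + 1) = J (γ + 2) + J γ - J (γ + 1) := by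
    simp only [sig, add_one_one, add_one_two]
  have sβ : sig J (γ + 2) = J γ + J (γ + 1) - J (γ + 2) := by
    simp only [sig, add_two_one, add_two_two]
  refine mul_ne_zero (hσ (γ + 1)) (hσ (γ + 2)) ?_
  rw [sα, sβ]
  linear_combination -J γ ^ 2 * h + (A γ * B γ * J γ + (J (γ + 1) - J (γ + 2))) * j0

/-- In the sector of `S_γ`, if the normally ordered words other than `S_γ³` vanish, then so do all
other words except `S_γ³`. Which words are normally ordered depends on the position of `γ`,
whence the three cases of the hypothesis `ho`. -/
theorem IsCubicModel.sector_eq_zero_of_ordered (h : IsCubicModel A B T)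
    (hJ : ∀ γ, A γ * B γ * J γ = J (γ + 1) - J (γ + 2)) (hσ : ∀ γ, sig J γ ≠ 0)
    (hQ : quartic J ≠ 0) (γ : Fin 3) (h0 : T 0 0 γ.succ = 0)
    (ho : (γ = 2 ∧ T 0 (γ + 1).succ (γ + 2).succ = 0 ∧ T (γ + 1).succ (γ + 1).succ γ.succ = 0 ∧
        T (γ + 2).succ (γ + 2).succ γ.succ = 0) ∨
      (γ = 0 ∧ T 0 (γ + 1).succ (γ + 2).succ = 0 ∧ T γ.succ (γ + 1).succ (γ + 1).succ = 0 ∧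
        T γ.succ (γ + 2).succ (γ + 2).succ = 0) ∨
      (γ = 1 ∧ T 0 (γ + 2).succ (γ + 1).succ = 0 ∧ T γ.succ (γ + 1).succ (γ + 1).succ = 0 ∧
        T (γ + 2).succ (γ + 2).succ γ.succ = 0)) :
    (T 0 0 γ.succ = 0 ∧ T γ.succ 0 0 = 0 ∧ T 0 γ.succ 0 = 0) ∧
    (T (γ + 1).succ (γ + 1).succ γ.succ = 0 ∧ T γ.succ (γ + 1).succ (γ + 1).succ = 0 ∧
      T (γ + 1).succ γ.succ (γ + 1).succ = 0) ∧
    (T (γ + 2).succ (γ + 2).succ γ.succ = 0 ∧ T γ.succ (γ + 2).succ (γ + 2).succ = 0 ∧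
      T (γ + 2).succ γ.succ (γ + 2).succ = 0) ∧
    (T (γ + 1).succ 0 (γ + 2).succ = 0 ∧ T (γ + 2).succ 0 (γ + 1).succ = 0) ∧
    (T 0 (γ + 1).succ (γ + 2).succ = 0 ∧ T (γ + 2).succ (γ + 1).succ 0 = 0) ∧
    (T 0 (γ + 2).succ (γ + 1).succ = 0 ∧ T (γ + 1).succ (γ + 2).succ 0 = 0) := by
  obtain ⟨ε, e0, eα, eβ, qA, qB, dB, qC, dC⟩ := h.sector_param hJ hσ γ
  rw [h0, smul_zero, add_zero] at qA
  have hα := hσ (γ + 1)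
  have hβ := hσ (γ + 2)
  have hγ := hσ γ
  have opp : ∀ {x y z : Fin 4}, T x y z = 0 → skew T x y z = -sym T x y z := by
    intro x y z hx; simp only [sym, skew, hx]; module
  have opp' : ∀ {x y z : Fin 4}, T x y z = 0 → sym T x y z = -skew T x y z := by
    intro x y z hx; simp only [sym, skew, hx]; module
  have opp'' : ∀ {x y z : Fin 4}, T z y x = 0 → sym T x y z = skew T x y z := by
    intro x y z hx; simp only [sym, skew, hx]; module
  -- the ordered words of the sector of `S₃` lead to the quartic form, while in the two other
  -- sectors the coefficient of `ε` is a product of the `sig J i`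
  have hε : ε = 0 := by
    rcases ho with ⟨rfl, g0, g1, g2⟩ | ⟨rfl, g0, g1, g2⟩ | ⟨rfl, g0, g1, g2⟩
    · rw [opp g0, eα] at qA qC
      simp only [opp' g1, smul_neg, dB] at qB
      simp only [opp' g2, smul_neg, dC] at qC
      refine eq_zero_of_smul (mul_ne_zero two_ne_zero hQ) ?_
      simp only [quartic]
      simp only [show (2 : Fin 3) + 1 = 0 from rfl, show (2 : Fin 3) + 2 = 1 from rfl] at *
      linear_combination (norm := module) -sig J 1 • qB - sig J 0 • qC + sig J 2 • qA
    · rw [opp g0, eα] at qA qC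
      rw [opp'' g1, dB] at qB
      rw [opp'' g2, dC] at qC
      refine eq_zero_of_smul (mul_ne_zero two_ne_zero (mul_ne_zero hα (pow_ne_zero 2 hβ))) ?_
      refine eq_zero_of_smul hα ?_
      linear_combination (norm := module) sig J (0 + 1) • (-qC)
        - sig J (0 + 2) • qB + sig J 0 • qA
    · rw [opp g0, eβ] at qA qB
      rw [opp'' g1, dB] at qB
      simp only [opp' g2, smul_neg, dC] at qC
      refine eq_zero_of_smul (mul_ne_zero two_ne_zero (mul_ne_zero hα (pow_ne_zero 2 hγ))) ?_
      refine eq_zero_of_smul hα ?_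
      linear_combination (norm := module) -sig J (1 + 1) • qC
        - sig J (1 + 2) • qB - sig J 1 • qA
  subst hε
  simp only [smul_zero, sub_zero] at e0 eα eβ qA dB dC
  have hDα : skew T 0 (γ + 1).succ (γ + 2).succ = 0 := by
    rcases ho with ⟨-, g0, -, -⟩ | ⟨-, g0, -, -⟩ | ⟨-, g0, -, -⟩
    · rw [opp g0, eα, neg_zero]
    · rw [opp g0, eα, neg_zero]
    · rw [opp g0, eβ, neg_zero, smul_zero] at qA
      exact eq_zero_of_smul hα qA.symm
  rw [hDα, smul_zero] at qA
  have hDβ := eq_zero_of_smul hβ qA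
  have hsα : (2 * J (γ + 2) * B (γ + 2)) • sym T (γ + 1).succ (γ + 1).succ γ.succ = 0 := by
    rcases ho with ⟨-, -, g0, -⟩ | ⟨-, -, g0, -⟩ | ⟨-, -, g0, -⟩
    · rw [opp' g0, smul_neg, dB, neg_zero]
    · rw [opp'' g0, dB]
    · rw [opp'' g0, dB]
  rw [hDβ, hsα, add_zero, smul_zero] at qB
  have hD := eq_zero_of_smul (neg_ne_zero.2 hα) qB.symm
  refine h.sector_eq_zero (sq_ne_one_of_sig hJ hσ) γ e0 hD hDα hDβ (Or.inr h0) ?_ ?_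
  · rcases ho with ⟨-, -, g0, -⟩ | ⟨-, -, g0, -⟩ | ⟨-, -, g0, -⟩ <;> simp [g0]
  · rcases ho with ⟨-, -, -, g0⟩ | ⟨-, -, -, g0⟩ | ⟨-, -, -, g0⟩ <;> simp [g0]

/-- If the normally ordered words of length three vanish, then all words do. -/
theorem IsCubicModel.eq_zero_of_ordered (h : IsCubicModel A B T)
    (hJ : ∀ γ, A γ * B γ * J γ = J (γ + 1) - J (γ + 2)) (hσ : ∀ γ, sig J γ ≠ 0)
    (hQ : quartic J ≠ 0) (ho : ∀ x y z, x ≤ y → y ≤ z → T x y z = 0) (x y z : Fin 4) :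
    T x y z = 0 := by
  have o : ∀ x y z, x ≤ y ∧ y ≤ z → T x y z = 0 := fun x y z h => ho x y z h.1 h.2
  have z0 := h.sector_zero_eq_zero hJ hσ hQ (o _ _ _ (by decide)) (o _ _ _ (by decide))
    (o _ _ _ (by decide)) (o _ _ _ (by decide))
  have z1 := h.sector_eq_zero_of_ordered hJ hσ hQ 0 (o _ _ _ (by decide))
    (.inr (.inl ⟨rfl, o _ _ _ (by decide), o _ _ _ (by decide), o _ _ _ (by decide)⟩))
  have z2 := h.sector_eq_zero_of_ordered hJ hσ hQ 1 (o _ _ _ (by decide))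
    (.inr (.inr ⟨rfl, o _ _ _ (by decide), o _ _ _ (by decide), o _ _ _ (by decide)⟩))
  have z3 := h.sector_eq_zero_of_ordered hJ hσ hQ 2 (o _ _ _ (by decide))
    (.inl ⟨rfl, o _ _ _ (by decide), o _ _ _ (by decide), o _ _ _ (by decide)⟩)
  simp only [show (0 : Fin 3) + 1 = 1 from rfl, show (0 : Fin 3) + 2 = 2 from rfl,
    show (1 : Fin 3) + 1 = 2 from rfl, show (1 : Fin 3) + 2 = 0 from rfl,
    show (2 : Fin 3) + 1 = 0 from rfl, show (2 : Fin 3) + 2 = 1 from rfl,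
    show (0 : Fin 3).succ = 1 from rfl, show (1 : Fin 3).succ = 2 from rfl,
    show (2 : Fin 3).succ = 3 from rfl] at z1 z2 z3
  by_cases hx : x ≤ y ∧ y ≤ z
  · exact o x y z hx
  fin_cases x <;> fin_cases y <;> fin_cases z <;>
    first
    | exact absurd (by decide) hx
    | simp [z0, z1, z2, z3]

end Spanning

/-! ### Words, degrees, and consequences of the relations -/

theorem S_eq (γ : Fin 3) : S γ = FreeAlgebra.ι ℂ γ.succ := rfl

theorem S0_eq : S0 = FreeAlgebra.ι ℂ 0 := rfl

theorem word_append (u v : List (Fin 4)) : word (u ++ v) = word u * word v := by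
  simp [word]

theorem word_mem_polyLE {w : List (Fin 4)} {N : ℕ} (h : w.length ≤ N) : word w ∈ polyLE N :=
  Submodule.subset_span ⟨w, h, rfl⟩

theorem polyLE_mono {m n : ℕ} (h : m ≤ n) : polyLE m ≤ polyLE n :=
  Submodule.span_mono fun _ ⟨w, hw, hx⟩ => ⟨w, hw.trans h, hx⟩

theorem mul_mem_polyLE {m n N : ℕ} {x y : FA} (hx : x ∈ polyLE m) (hy : y ∈ polyLE n)
    (hN : m + n ≤ N := by omega) : x * y ∈ polyLE N := by
  have h := Submodule.mul_mem_mul hx hy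
  rw [polyLE, polyLE, Submodule.span_mul_span] at h
  refine Submodule.span_mono ?_ h
  rintro _ ⟨_, ⟨u, hu, rfl⟩, _, ⟨v, hv, rfl⟩, rfl⟩
  exact ⟨u ++ v, by simp; omega, (word_append u v).symm⟩

theorem ι_mem_polyLE (i : Fin 4) : FreeAlgebra.ι ℂ i ∈ polyLE 1 := by
  have h : word [i] ∈ polyLE 1 := word_mem_polyLE le_rfl
  simpa [word] using h

theorem S_mem_polyLE (γ : Fin 3) : S γ ∈ polyLE 1 := ι_mem_polyLE _

theorem S0_mem_polyLE : S0 ∈ polyLE 1 := ι_mem_polyLE _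

theorem algebraMap_mem_polyLE (c : ℂ) (N : ℕ) : algebraMap ℂ FA c ∈ polyLE N := by
  rw [Algebra.algebraMap_eq_smul_one]
  have h : word [] ∈ polyLE N := word_mem_polyLE (Nat.zero_le _)
  exact Submodule.smul_mem _ _ (by simpa [word] using h)

theorem ι_mul_ι_mem_polyLE (x y : Fin 4) :
    FreeAlgebra.ι ℂ x * FreeAlgebra.ι ℂ y ∈ polyLE 2 :=
  mul_mem_polyLE (ι_mem_polyLE x) (ι_mem_polyLE y)

theorem polyLE_induction {N : ℕ} {M : Submodule ℂ FA}
    (h : ∀ w : List (Fin 4), w.length ≤ N → word w ∈ M) : polyLE N ≤ M :=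
  Submodule.span_le.2 (by rintro _ ⟨w, hw, rfl⟩; exact h w hw)

/-- To bound the polynomials of degree at most two it suffices to treat `1`, the letters and the
words of length two. -/
theorem polyLE_two_le {M : Submodule ℂ FA} (h0 : (1 : FA) ∈ M)
    (h1 : ∀ x, FreeAlgebra.ι ℂ x ∈ M) (h2 : ∀ x y, FreeAlgebra.ι ℂ x * FreeAlgebra.ι ℂ y ∈ M) :
    polyLE 2 ≤ M := by
  refine polyLE_induction fun w hw => ?_
  match w, hw with
  | [], _ => simpa [word] using h0
  | [x], _ => simpa [word] using h1 x
  | [x, y], _ => simpa [word] using h2 x y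
  | _ :: _ :: _ :: _, h => simp at h

theorem consequencesLE_mono (r : Relations) {m n : ℕ} (h : m ≤ n) :
    consequencesLE r m ≤ consequencesLE r n :=
  Submodule.span_mono fun _ ⟨u, v, i, hw, hx⟩ => ⟨u, v, i, hw.trans h, hx⟩

theorem rel_mem_consequencesLE (r : Relations) (i : Fin 3 ⊕ Fin 3) :
    r i ∈ consequencesLE r 2 :=
  Submodule.subset_span ⟨[], [], i, by simp, by simp [word]⟩

theorem mul_mem_consequencesLE {r : Relations} {m n N : ℕ} {x y : FA} (hx : x ∈ polyLE m)
    (hy : y ∈ consequencesLE r n) (hN : m + n ≤ N := by omega) :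
    x * y ∈ consequencesLE r N := by
  have h := Submodule.mul_mem_mul hx hy
  rw [polyLE, consequencesLE, Submodule.span_mul_span] at h
  refine Submodule.span_mono ?_ h
  rintro _ ⟨_, ⟨w, hw, rfl⟩, _, ⟨u, v, i, hi, rfl⟩, rfl⟩
  exact ⟨w ++ u, v, i, by simp; omega, by simp only [word_append, mul_assoc]⟩

theorem consequencesLE_mul_mem {r : Relations} {m n N : ℕ} {x y : FA} (hx : x ∈ polyLE m)
    (hy : y ∈ consequencesLE r n) (hN : n + m ≤ N := by omega) :
    y * x ∈ consequencesLE r N := by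
  have h := Submodule.mul_mem_mul hy hx
  rw [polyLE, consequencesLE, Submodule.span_mul_span] at h
  refine Submodule.span_mono ?_ h
  rintro _ ⟨_, ⟨u, v, i, hi, rfl⟩, _, ⟨w, hw, rfl⟩, rfl⟩
  exact ⟨u, v ++ w, i, by simp; omega, by simp only [word_append, mul_assoc]⟩

theorem ι_mul_rel_mem (r : Relations) (x : Fin 4) (i : Fin 3 ⊕ Fin 3) :
    FreeAlgebra.ι ℂ x * r i ∈ consequencesLE r 3 :=
  mul_mem_consequencesLE (ι_mem_polyLE x) (rel_mem_consequencesLE r i)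

theorem rel_mul_ι_mem (r : Relations) (x : Fin 4) (i : Fin 3 ⊕ Fin 3) :
    r i * FreeAlgebra.ι ℂ x ∈ consequencesLE r 3 :=
  consequencesLE_mul_mem (ι_mem_polyLE x) (rel_mem_consequencesLE r i)

theorem consequencesLE_le_idealOf (r : Relations) (N : ℕ) {x : FA}
    (hx : x ∈ consequencesLE r N) : x ∈ idealOf r := by
  have hr : ∀ i, r i ∈ idealOf r := fun i => TwoSidedIdeal.subset_span ⟨i, rfl⟩
  induction hx using Submodule.span_induction with
  | mem x hx =>
    obtain ⟨u, v, i, -, rfl⟩ := hx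
    exact (idealOf r).mul_mem_right _ _ ((idealOf r).mul_mem_left _ _ (hr i))
  | zero => exact (idealOf r).zero_mem
  | add x y _ _ hx hy => exact (idealOf r).add_mem hx hy
  | smul c x _ hx => rw [Algebra.smul_def]; exact (idealOf r).mul_mem_left _ _ hx

theorem Coeffs.rel_inl (P : Coeffs) (γ : Fin 3) : P.rel (Sum.inl γ)
    = S (γ + 1) * S (γ + 2) - S (γ + 2) * S (γ + 1)
      + P.A γ • (S0 * S γ + S γ * S0) + P.K γ • S0 + P.M γ • S γ + algebraMap ℂ FA (P.N γ) := rfl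

theorem Coeffs.rel_inr (P : Coeffs) (γ : Fin 3) : P.rel (Sum.inr γ)
    = S γ * S0 - S0 * S γ
      + P.B γ • (S (γ + 1) * S (γ + 2) + S (γ + 2) * S (γ + 1))
      + (P.l (γ + 1) • S (γ + 2) - P.l (γ + 2) • S (γ + 1)) := rfl

theorem Coeffs.low_inl (P : Coeffs) (γ : Fin 3) :
    P.K γ • S0 + P.M γ • S γ + algebraMap ℂ FA (P.N γ) ∈ polyLE 1 :=
  add_mem (add_mem (Submodule.smul_mem _ _ S0_mem_polyLE)
    (Submodule.smul_mem _ _ (S_mem_polyLE γ))) (algebraMap_mem_polyLE _ _)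

theorem Coeffs.low_inr (P : Coeffs) (γ : Fin 3) :
    P.l (γ + 1) • S (γ + 2) - P.l (γ + 2) • S (γ + 1) ∈ polyLE 1 :=
  sub_mem (Submodule.smul_mem _ _ (S_mem_polyLE _)) (Submodule.smul_mem _ _ (S_mem_polyLE _))

theorem Coeffs.rel_mem_polyLE (P : Coeffs) (i : Fin 3 ⊕ Fin 3) : P.rel i ∈ polyLE 2 := by
  rcases i with γ | γ
  · rw [P.rel_inl, add_assoc, add_assoc, ← add_assoc (P.K γ • S0)]
    refine add_mem (add_mem (sub_mem ?_ ?_) (Submodule.smul_mem _ _ (add_mem ?_ ?_)))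
      (polyLE_mono one_le_two (P.low_inl γ)) <;> exact ι_mul_ι_mem_polyLE _ _
  · rw [P.rel_inr]
    refine add_mem (add_mem (sub_mem ?_ ?_) (Submodule.smul_mem _ _ (add_mem ?_ ?_)))
      (polyLE_mono one_le_two (P.low_inr γ)) <;> exact ι_mul_ι_mem_polyLE _ _

/-- Modulo the consequences of the relations and the polynomials of degree at most two, the
words of length three satisfy the leading parts of the relations. -/
theorem Coeffs.isCubicModel (P : Coeffs) {W : Submodule ℂ FA} (h3 : consequencesLE P.rel 3 ≤ W)
    (h2 : polyLE 2 ≤ W) : IsCubicModel P.A P.B fun x y z =>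
      W.mkQ (FreeAlgebra.ι ℂ x * FreeAlgebra.ι ℂ y * FreeAlgebra.ι ℂ z) := by
  constructor
  · intro γ x
    have h := W.sub_mem (h3 (ι_mul_rel_mem P.rel x (Sum.inl γ)))
      (h2 (mul_mem_polyLE (ι_mem_polyLE x) (P.low_inl γ) : _ ∈ polyLE 2))
    rw [← Submodule.Quotient.mk_eq_zero, ← Submodule.mkQ_apply] at h
    rw [← h, P.rel_inl]
    simp only [← map_smul, ← map_add, ← map_sub, S_eq, S0_eq]
    congr 1
    simp only [mul_add, mul_sub, mul_smul_comm, mul_assoc]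
    abel
  · intro γ x
    have h := W.sub_mem (h3 (rel_mul_ι_mem P.rel x (Sum.inl γ)))
      (h2 (mul_mem_polyLE (P.low_inl γ) (ι_mem_polyLE x)))
    rw [← Submodule.Quotient.mk_eq_zero, ← Submodule.mkQ_apply] at h
    rw [← h, P.rel_inl]
    simp only [← map_smul, ← map_add, ← map_sub, S_eq, S0_eq]
    congr 1
    simp only [add_mul, sub_mul, smul_mul_assoc, mul_assoc]
    abel
  · intro γ x
    have h := W.sub_mem (h3 (ι_mul_rel_mem P.rel x (Sum.inr γ)))
      (h2 (mul_mem_polyLE (ι_mem_polyLE x) (P.low_inr γ)))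
    rw [← Submodule.Quotient.mk_eq_zero, ← Submodule.mkQ_apply] at h
    rw [← h, P.rel_inr]
    simp only [← map_smul, ← map_add, ← map_sub, S_eq, S0_eq]
    congr 1
    simp only [mul_add, mul_sub, mul_smul_comm, mul_assoc]
    abel
  · intro γ x
    have h := W.sub_mem (h3 (rel_mul_ι_mem P.rel x (Sum.inr γ)))
      (h2 (mul_mem_polyLE (P.low_inr γ) (ι_mem_polyLE x)))
    rw [← Submodule.Quotient.mk_eq_zero, ← Submodule.mkQ_apply] at h
    rw [← h, P.rel_inr]
    simp only [← map_smul, ← map_add, ← map_sub, S_eq, S0_eq]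
    congr 1
    simp only [add_mul, sub_mul, smul_mul_assoc, mul_assoc]
    abel

/-! ### Normally ordered monomials -/

theorem orderedMonomial_mem_orderedLE {n : Fin 4 → ℕ} {N : ℕ} (h : ∑ i, n i ≤ N) :
    orderedMonomial n ∈ orderedLE N :=
  Submodule.subset_span ⟨n, h, rfl⟩

theorem orderedLE_mono {m n : ℕ} (h : m ≤ n) : orderedLE m ≤ orderedLE n :=
  Submodule.span_mono fun _ ⟨w, hw, hx⟩ => ⟨w, hw.trans h, hx⟩

theorem orderedMonomial_mem_polyLE (n : Fin 4 → ℕ) : orderedMonomial n ∈ polyLE (∑ i, n i) := by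
  have h : ∀ (i : Fin 4) (m : ℕ), FreeAlgebra.ι ℂ i ^ m ∈ polyLE m := by
    intro i m
    induction m with
    | zero => simpa using algebraMap_mem_polyLE 1 0
    | succ m ih => rw [pow_succ]; exact mul_mem_polyLE ih (ι_mem_polyLE i)
  rw [Fin.sum_univ_four]
  have h01 : S0 ^ n 0 * S 0 ^ n 1 ∈ polyLE (n 0 + n 1) := mul_mem_polyLE (h _ _) (h _ _)
  have h02 : S0 ^ n 0 * S 0 ^ n 1 * S 1 ^ n 2 ∈ polyLE (n 0 + n 1 + n 2) :=
    mul_mem_polyLE h01 (h _ _)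
  exact mul_mem_polyLE h02 (h _ _)

theorem orderedLE_le_polyLE (N : ℕ) : orderedLE N ≤ polyLE N :=
  Submodule.span_le.2 (by
    rintro _ ⟨n, hn, rfl⟩
    exact polyLE_mono hn (orderedMonomial_mem_polyLE n))

theorem abel_orderedMonomial (n : Fin 4 → ℕ) : abel (orderedMonomial n)
    = MvPolynomial.monomial (Finsupp.equivFunOnFinite.symm n) 1 := by
  rw [MvPolynomial.monomial_eq, Finsupp.prod_fintype _ _ (by simp), Fin.prod_univ_four]
  simp [abel, orderedMonomial, S0, S]

theorem linearIndependent_orderedMonomial : LinearIndependent ℂ orderedMonomial := by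
  refine LinearIndependent.of_comp abel.toLinearMap ?_
  have h := (MvPolynomial.basisMonomials (Fin 4) ℂ).linearIndependent.comp
    (Finsupp.equivFunOnFinite.symm : (Fin 4 → ℕ) → _) (Equiv.injective _)
  have e : abel.toLinearMap ∘ orderedMonomial
      = MvPolynomial.basisMonomials (Fin 4) ℂ ∘ Finsupp.equivFunOnFinite.symm := by
    funext n
    simp [abel_orderedMonomial]
  rw [e]
  exact h

theorem orderedMonomial_zero : orderedMonomial 0 = 1 := by simp [orderedMonomial]

theorem orderedMonomial_single (x : Fin 4) :
    orderedMonomial (Pi.single x 1) = FreeAlgebra.ι ℂ x := by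
  fin_cases x <;> simp [orderedMonomial, S0, S]

theorem orderedMonomial_pair {x y : Fin 4} (h : x ≤ y) :
    orderedMonomial (Pi.single x 1 + Pi.single y 1) = FreeAlgebra.ι ℂ x * FreeAlgebra.ι ℂ y := by
  fin_cases x <;> fin_cases y <;>
    first
    | exact absurd h (by decide)
    | simp [orderedMonomial, S0, S, pow_two]

theorem orderedMonomial_triple {x y z : Fin 4} (h : x ≤ y) (h' : y ≤ z) :
    orderedMonomial (Pi.single x 1 + Pi.single y 1 + Pi.single z 1)
      = FreeAlgebra.ι ℂ x * FreeAlgebra.ι ℂ y * FreeAlgebra.ι ℂ z := by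
  fin_cases x <;> fin_cases y <;>
    first
    | exact absurd h (by decide)
    | fin_cases z <;>
      first
      | exact absurd h' (by decide)
      | simp [orderedMonomial, S0, S, pow_succ, mul_assoc]

theorem one_mem_orderedLE (N : ℕ) : (1 : FA) ∈ orderedLE N := by
  rw [← orderedMonomial_zero]; exact orderedMonomial_mem_orderedLE (by simp)

theorem ι_mem_orderedLE (x : Fin 4) : FreeAlgebra.ι ℂ x ∈ orderedLE 1 := by
  rw [← orderedMonomial_single]; exact orderedMonomial_mem_orderedLE (by simp)

theorem pair_mem_orderedLE {x y : Fin 4} (h : x ≤ y) :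
    FreeAlgebra.ι ℂ x * FreeAlgebra.ι ℂ y ∈ orderedLE 2 := by
  rw [← orderedMonomial_pair h]
  exact orderedMonomial_mem_orderedLE (by simp [Finset.sum_add_distrib])

theorem triple_mem_orderedLE {x y z : Fin 4} (h : x ≤ y) (h' : y ≤ z) :
    FreeAlgebra.ι ℂ x * FreeAlgebra.ι ℂ y * FreeAlgebra.ι ℂ z ∈ orderedLE 3 := by
  rw [← orderedMonomial_triple h h']
  exact orderedMonomial_mem_orderedLE (by simp [Finset.sum_add_distrib])

/-! ### Existence and uniqueness of normal orderings -/

theorem hasNormalOrdering_of_isCompl {r : Relations} {N : ℕ}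
    (hsup : polyLE N ≤ consequencesLE r N ⊔ orderedLE N)
    (hdis : Disjoint (consequencesLE r N) (orderedLE N)) : HasNormalOrdering r N := by
  intro p hp
  obtain ⟨v, hv, q, hq, rfl⟩ := Submodule.mem_sup.1 (hsup hp)
  refine ⟨q, ⟨hq, by simpa using hv⟩, ?_⟩
  rintro q' ⟨hq', h'⟩
  have h1 : q' - q ∈ consequencesLE r N := by
    have h2 := sub_mem hv h'
    rwa [show v - (v + q - q') = q' - q by abel] at h2
  exact sub_eq_zero.1 ((Submodule.disjoint_def.1 hdis) _ h1 (sub_mem hq' hq))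

theorem HasNormalOrdering.disjoint {r : Relations} {N : ℕ} (h : HasNormalOrdering r N) :
    Disjoint (consequencesLE r N) (orderedLE N) := by
  refine Submodule.disjoint_def.2 fun x hx hx' => ?_
  obtain ⟨q, -, hq⟩ := h x (orderedLE_le_polyLE N hx')
  rw [hq x ⟨hx', by simp⟩, ← hq 0 ⟨zero_mem _, by simpa using hx⟩]

/-- Quadratic polynomials can be normally ordered when `(A_γ B_γ)² ≠ 1`. -/
theorem Coeffs.polyLE_two_le_sup (P : Coeffs) (ht : ∀ γ, (P.A γ * P.B γ) ^ 2 ≠ 1) :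
    polyLE 2 ≤ consequencesLE P.rel 2 ⊔ orderedLE 2 := by
  set W := consequencesLE P.rel 2 ⊔ orderedLE 2 with hW
  have hV : consequencesLE P.rel 2 ≤ W := le_sup_left
  have hO : orderedLE 2 ≤ W := le_sup_right
  have h1 : ∀ x, FreeAlgebra.ι ℂ x ∈ W := fun x =>
    hO (orderedLE_mono one_le_two (ι_mem_orderedLE x))
  have h0 : (1 : FA) ∈ W := hO (one_mem_orderedLE 2)
  have hord : ∀ x y : Fin 4, x ≤ y → FreeAlgebra.ι ℂ x * FreeAlgebra.ι ℂ y ∈ W :=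
    fun x y h => hO (pair_mem_orderedLE h)
  have hlow : polyLE 1 ≤ W := polyLE_induction fun w hw => by
    match w, hw with
    | [], _ => simpa [word] using h0
    | [x], _ => simpa [word] using h1 x
    | _ :: _ :: _, h => simp at h
  -- both products of a pair and the product `S_γ S₀` are normally ordered together
  have key : ∀ γ : Fin 3, (S (γ + 1) * S (γ + 2) ∈ W ∨ S (γ + 2) * S (γ + 1) ∈ W) →
      S (γ + 1) * S (γ + 2) ∈ W ∧ S (γ + 2) * S (γ + 1) ∈ W ∧ S γ * S0 ∈ W := by
    intro γ hγ
    have hF := sub_mem (hV (rel_mem_consequencesLE P.rel (Sum.inl γ))) (hlow (P.low_inl γ))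
    have hG := sub_mem (hV (rel_mem_consequencesLE P.rel (Sum.inr γ))) (hlow (P.low_inr γ))
    have hv : S0 * S γ ∈ W := hord 0 γ.succ (Fin.zero_le _)
    rw [P.rel_inl] at hF
    rw [P.rel_inr] at hG
    simp only [← Submodule.Quotient.mk_eq_zero, Submodule.Quotient.mk_add,
      Submodule.Quotient.mk_sub, Submodule.Quotient.mk_smul] at hF hG hγ hv ⊢
    rw [hv] at hF hG
    generalize (Submodule.Quotient.mk (S (γ + 1) * S (γ + 2)) : FA ⧸ W) = p at *
    generalize (Submodule.Quotient.mk (S (γ + 2) * S (γ + 1)) : FA ⧸ W) = q at *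
    generalize (Submodule.Quotient.mk (S γ * S0) : FA ⧸ W) = u at *
    have h2 : (1 - P.A γ * P.B γ) • p = (1 + P.A γ * P.B γ) • q := by
      linear_combination (norm := module) hF - P.A γ • hG
    have hp : 1 + P.A γ * P.B γ ≠ 0 := fun h0 =>
      ht γ (by linear_combination (P.A γ * P.B γ - 1) * h0)
    have hm : 1 - P.A γ * P.B γ ≠ 0 := fun h0 =>
      ht γ (by linear_combination (-P.A γ * P.B γ - 1) * h0)
    have hpq : p = 0 ∧ q = 0 := by
      rcases hγ with rfl | rfl
      · exact ⟨rfl, eq_zero_of_smul hp (by rw [← h2, smul_zero])⟩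
      · exact ⟨eq_zero_of_smul hm (by rw [h2, smul_zero]), rfl⟩
    obtain ⟨rfl, rfl⟩ := hpq
    refine ⟨rfl, rfl, ?_⟩
    linear_combination (norm := module) hG
  have k0 := key 0 (.inl (hord 2 3 (by decide)))
  have k1 := key 1 (.inr (hord 1 3 (by decide)))
  have k2 := key 2 (.inl (hord 1 2 (by decide)))
  refine polyLE_two_le h0 h1 fun x y => ?_
  by_cases hxy : x ≤ y
  · exact hord x y hxy
  fin_cases x <;> fin_cases y <;>
    first
    | exact absurd (by decide) hxy
    | exact k0.1 | exact k0.2.1 | exact k0.2.2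
    | exact k1.1 | exact k1.2.1 | exact k1.2.2
    | exact k2.1 | exact k2.2.1 | exact k2.2.2

/-- Cubic polynomials can be normally ordered when the quartic form does not vanish. -/
theorem Coeffs.polyLE_three_le_sup (P : Coeffs) {J : Fin 3 → ℂ}
    (hJ : ∀ γ, P.A γ * P.B γ * J γ = J (γ + 1) - J (γ + 2)) (hσ : ∀ γ, sig J γ ≠ 0)
    (hQ : quartic J ≠ 0) : polyLE 3 ≤ consequencesLE P.rel 3 ⊔ orderedLE 3 := by
  set W := consequencesLE P.rel 3 ⊔ orderedLE 3 with hW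
  have h2 : polyLE 2 ≤ W :=
    (P.polyLE_two_le_sup (sq_ne_one_of_sig hJ hσ)).trans
      (sup_le_sup (consequencesLE_mono _ (by norm_num)) (orderedLE_mono (by norm_num)))
  have hT := P.isCubicModel (W := W) le_sup_left h2
  have h3 := hT.eq_zero_of_ordered hJ hσ hQ (fun x y z h h' => by
    rw [Submodule.mkQ_apply, Submodule.Quotient.mk_eq_zero]
    exact (le_sup_right : orderedLE 3 ≤ W) (triple_mem_orderedLE h h'))
  refine polyLE_induction fun w hw => ?_
  match w, hw with
  | [], _ => exact h2 (word_mem_polyLE (by simp))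
  | [x], _ => exact h2 (word_mem_polyLE (by simp))
  | [x, y], _ => exact h2 (word_mem_polyLE (by simp))
  | [x, y, z], _ =>
    have h := h3 x y z
    rw [Submodule.mkQ_apply, Submodule.Quotient.mk_eq_zero] at h
    simpa [word, mul_assoc] using h
  | _ :: _ :: _ :: _ :: _, h => exact absurd h (by simp)

/-! ### The four cubic syzygies -/

/-- The combination of cubic consequences, of the form `∑ J_γ [S_γ, F_γ] + ⋯`, whose leading
part cancels when `A_γ B_γ J_γ = J_α - J_β`. -/
theorem Coeffs.syzygy_zero (P : Coeffs) (J : Fin 3 → ℂ) :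
    ∑ γ, J γ • (S γ * P.rel (.inl γ) - P.rel (.inl γ) * S γ
        - P.A γ • (S γ * P.rel (.inr γ) + P.rel (.inr γ) * S γ) - P.K γ • P.rel (.inr γ))
      = ∑ γ, (J (γ + 1) - J (γ + 2) - P.A γ * P.B γ * J γ) •
          (S γ * (S (γ + 1) * S (γ + 2) + S (γ + 2) * S (γ + 1))
            + (S (γ + 1) * S (γ + 2) + S (γ + 2) * S (γ + 1)) * S γ)
        + ∑ γ, (P.l γ * (J (γ + 1) * P.A (γ + 1) - J (γ + 2) * P.A (γ + 2))
            - P.K γ * P.B γ * J γ) • (S (γ + 1) * S (γ + 2) + S (γ + 2) * S (γ + 1))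
        - ∑ γ, (J (γ + 1) * P.K (γ + 1) * P.l (γ + 2)
            - J (γ + 2) * P.K (γ + 2) * P.l (γ + 1)) • S γ := by
  simp only [Fin.sum_univ_three, P.rel_inl, P.rel_inr]
  simp only [show (0 : Fin 3) + 1 = 1 from rfl, show (0 : Fin 3) + 2 = 2 from rfl,
    show (1 : Fin 3) + 1 = 2 from rfl, show (1 : Fin 3) + 2 = 0 from rfl,
    show (2 : Fin 3) + 1 = 0 from rfl, show (2 : Fin 3) + 2 = 1 from rfl]
  generalize S 0 = x
  generalize S 1 = y
  generalize S 2 = z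
  generalize S0 = w
  simp only [Algebra.algebraMap_eq_smul_one, mul_add, mul_sub, add_mul, sub_mul, mul_smul_comm,
    smul_mul_assoc, mul_one, one_mul, mul_assoc]
  module

/-- The combination of cubic consequences that belongs to `S_γ`; its leading part cancels when
`A_γ B_γ J_γ = J_α - J_β` for all `γ`. -/
theorem Coeffs.syzygy (P : Coeffs) (J : Fin 3 → ℂ) (γ : Fin 3) :
    J γ • (S0 * P.rel (.inl γ) - P.rel (.inl γ) * S0
        + P.A γ • (S0 * P.rel (.inr γ) + P.rel (.inr γ) * S0) + P.M γ • P.rel (.inr γ))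
      + J (γ + 2) • (S (γ + 1) * P.rel (.inr (γ + 2)) - P.rel (.inr (γ + 2)) * S (γ + 1)
        + P.B (γ + 2) • (S (γ + 1) * P.rel (.inl (γ + 2)) + P.rel (.inl (γ + 2)) * S (γ + 1))
        - P.l (γ + 1) • P.rel (.inl (γ + 2)))
      - J (γ + 1) • (S (γ + 2) * P.rel (.inr (γ + 1)) - P.rel (.inr (γ + 1)) * S (γ + 2)
        - P.B (γ + 1) • (S (γ + 2) * P.rel (.inl (γ + 1)) + P.rel (.inl (γ + 1)) * S (γ + 2))
        - P.l (γ + 2) • P.rel (.inl (γ + 1)))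
      = (P.A γ * P.B γ * J γ - (J (γ + 1) - J (γ + 2))) •
          (S0 * (S (γ + 1) * S (γ + 2) + S (γ + 2) * S (γ + 1))
            + (S (γ + 1) * S (γ + 2) + S (γ + 2) * S (γ + 1)) * S0)
        + (P.A (γ + 1) * P.B (γ + 1) * J (γ + 1) - (J (γ + 2) - J γ)) •
          (S (γ + 2) * (S0 * S (γ + 1) + S (γ + 1) * S0)
            + (S0 * S (γ + 1) + S (γ + 1) * S0) * S (γ + 2))
        + (P.A (γ + 2) * P.B (γ + 2) * J (γ + 2) - (J γ - J (γ + 1))) •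
          (S (γ + 1) * (S0 * S (γ + 2) + S (γ + 2) * S0)
            + (S0 * S (γ + 2) + S (γ + 2) * S0) * S (γ + 1))
        + (J γ * P.M γ * P.B γ + J (γ + 1) * P.M (γ + 1) * P.B (γ + 1)
            + J (γ + 2) * P.M (γ + 2) * P.B (γ + 2)) •
          (S (γ + 1) * S (γ + 2) + S (γ + 2) * S (γ + 1))
        + (P.K (γ + 1) * P.B (γ + 1) * J (γ + 1)
            - P.l (γ + 1) * (J (γ + 2) * P.A (γ + 2) - J γ * P.A γ)) •
          (S0 * S (γ + 2) + S (γ + 2) * S0)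
        + (P.K (γ + 2) * P.B (γ + 2) * J (γ + 2)
            - P.l (γ + 2) * (J γ * P.A γ - J (γ + 1) * P.A (γ + 1))) •
          (S0 * S (γ + 1) + S (γ + 1) * S0)
        + (2 * J (γ + 1) * P.B (γ + 1) * P.N (γ + 1)
            - P.l (γ + 1) * (J (γ + 2) * P.M (γ + 2) - J γ * P.M γ)) • S (γ + 2)
        + (2 * J (γ + 2) * P.B (γ + 2) * P.N (γ + 2)
            - P.l (γ + 2) * (J γ * P.M γ - J (γ + 1) * P.M (γ + 1))) • S (γ + 1)
        + (J (γ + 1) * P.K (γ + 1) * P.l (γ + 2)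
            - J (γ + 2) * P.K (γ + 2) * P.l (γ + 1)) • S0
        + (J (γ + 1) * P.N (γ + 1) * P.l (γ + 2)
            - J (γ + 2) * P.N (γ + 2) * P.l (γ + 1)) • (1 : FA) := by
  simp only [P.rel_inl, P.rel_inr, add_one_one, add_one_two, add_two_one, add_two_two]
  generalize S γ = x
  generalize S (γ + 1) = y
  generalize S (γ + 2) = z
  generalize S0 = w
  simp only [Algebra.algebraMap_eq_smul_one, mul_add, mul_sub, add_mul, sub_mul, mul_smul_comm,
    smul_mul_assoc, mul_one, one_mul, mul_assoc]
  module

/-- The conditions on the coefficients under which the syzygies of the leading parts of the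
relations extend to syzygies of the relations themselves. -/
structure Coeffs.IsCompatible (P : Coeffs) (J : Fin 3 → ℂ) : Prop where
  hJ : ∀ γ, P.A γ * P.B γ * J γ = J (γ + 1) - J (γ + 2)
  hK : ∀ γ, P.K γ * P.B γ * J γ
    = P.l γ * (J (γ + 1) * P.A (γ + 1) - J (γ + 2) * P.A (γ + 2))
  hKl : ∀ γ, J (γ + 1) * P.K (γ + 1) * P.l (γ + 2) = J (γ + 2) * P.K (γ + 2) * P.l (γ + 1)
  hM : ∑ γ, J γ * P.M γ * P.B γ = 0
  hN : ∀ γ, 2 * J γ * P.B γ * P.N γ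
    = P.l γ * (J (γ + 1) * P.M (γ + 1) - J (γ + 2) * P.M (γ + 2))
  hNl : ∀ γ, J (γ + 1) * P.N (γ + 1) * P.l (γ + 2) = J (γ + 2) * P.N (γ + 2) * P.l (γ + 1)

theorem sum_cyclic (f : Fin 3 → ℂ) (γ : Fin 3) : f γ + f (γ + 1) + f (γ + 2) = ∑ i, f i := by
  rw [Fin.sum_univ_three]
  fin_cases γ
  · rfl
  · exact (add_rotate (f 0) (f 1) (f 2)).symm
  · exact (add_rotate (f 2) (f 0) (f 1))

theorem Coeffs.IsCompatible.syzygy_zero {P : Coeffs} {J : Fin 3 → ℂ} (h : P.IsCompatible J) :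
    ∑ γ, J γ • (S γ * P.rel (.inl γ) - P.rel (.inl γ) * S γ
        - P.A γ • (S γ * P.rel (.inr γ) + P.rel (.inr γ) * S γ) - P.K γ • P.rel (.inr γ))
      = 0 := by
  rw [P.syzygy_zero]
  simp only [h.hJ, h.hK, h.hKl, sub_self, zero_smul, Finset.sum_const_zero, add_zero]

theorem Coeffs.IsCompatible.syzygy {P : Coeffs} {J : Fin 3 → ℂ} (h : P.IsCompatible J)
    (γ : Fin 3) :
    J γ • (S0 * P.rel (.inl γ) - P.rel (.inl γ) * S0
        + P.A γ • (S0 * P.rel (.inr γ) + P.rel (.inr γ) * S0) + P.M γ • P.rel (.inr γ))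
      + J (γ + 2) • (S (γ + 1) * P.rel (.inr (γ + 2)) - P.rel (.inr (γ + 2)) * S (γ + 1)
        + P.B (γ + 2) • (S (γ + 1) * P.rel (.inl (γ + 2)) + P.rel (.inl (γ + 2)) * S (γ + 1))
        - P.l (γ + 1) • P.rel (.inl (γ + 2)))
      - J (γ + 1) • (S (γ + 2) * P.rel (.inr (γ + 1)) - P.rel (.inr (γ + 1)) * S (γ + 2)
        - P.B (γ + 1) • (S (γ + 2) * P.rel (.inl (γ + 1)) + P.rel (.inl (γ + 1)) * S (γ + 2))
        - P.l (γ + 2) • P.rel (.inl (γ + 1))) = 0 := by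
  rw [P.syzygy, sum_cyclic (fun γ => J γ * P.M γ * P.B γ) γ, h.hM]
  have k1 := h.hK (γ + 1)
  have k2 := h.hK (γ + 2)
  have n1 := h.hN (γ + 1)
  have n2 := h.hN (γ + 2)
  have j1 := h.hJ (γ + 1)
  have j2 := h.hJ (γ + 2)
  simp only [add_one_one, add_one_two, add_two_one, add_two_two] at k1 k2 n1 n2 j1 j2
  rw [k1, k2, n1, n2, j1, j2, h.hJ, h.hKl, h.hNl]
  simp only [sub_self, zero_smul, add_zero]

/-! ### The count of dimensions -/

/-- The relations and their products with one letter on the left or on the right. -/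
def cubicGen (r : Relations) : (Fin 3 ⊕ Fin 3) × Option (Fin 4 ⊕ Fin 4) → FA
  | (i, none) => r i
  | (i, some (.inl x)) => FreeAlgebra.ι ℂ x * r i
  | (i, some (.inr x)) => r i * FreeAlgebra.ι ℂ x

theorem consequencesLE_three_le (r : Relations) :
    consequencesLE r 3 ≤ Submodule.span ℂ (Set.range (cubicGen r)) := by
  refine Submodule.span_le.2 ?_
  rintro _ ⟨u, v, i, h, rfl⟩
  match u, v, h with
  | [], [], _ => exact Submodule.subset_span ⟨(i, none), by simp [cubicGen, word]⟩
  | [x], [], _ => exact Submodule.subset_span ⟨(i, some (.inl x)), by simp [cubicGen, word]⟩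
  | [], [x], _ => exact Submodule.subset_span ⟨(i, some (.inr x)), by simp [cubicGen, word]⟩
  | _ :: _ :: _, _, h => simp at h; omega
  | _ :: _, _ :: _, h => simp at h; omega
  | [], _ :: _ :: _, h => simp at h; omega

/-- The four generators of the cubic consequences that the syzygies make redundant:
`S₁ F₁` and `S₀ F_γ`. -/
def redundant : Finset ((Fin 3 ⊕ Fin 3) × Option (Fin 4 ⊕ Fin 4)) :=
  {(.inl 0, some (.inl 1)), (.inl 0, some (.inl 0)), (.inl 1, some (.inl 0)),
    (.inl 2, some (.inl 0))}

theorem Coeffs.IsCompatible.consequencesLE_three_le {P : Coeffs} {J : Fin 3 → ℂ}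
    (h : P.IsCompatible J) (hJ0 : ∀ γ, J γ ≠ 0) : consequencesLE P.rel 3 ≤
      Submodule.span ℂ (Set.range fun i : {i // i ∉ redundant} => cubicGen P.rel i) := by
  set U := Submodule.span ℂ (Set.range fun i : {i // i ∉ redundant} => cubicGen P.rel i)
  have hU : ∀ i, i ∉ redundant → cubicGen P.rel i ∈ U := fun i hi =>
    Submodule.subset_span ⟨⟨i, hi⟩, rfl⟩
  have hrel : ∀ i, P.rel i ∈ U := fun i => hU (i, none) (by decide +revert)
  have hr : ∀ i x, P.rel i * FreeAlgebra.ι ℂ x ∈ U := fun i x =>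
    hU (i, some (.inr x)) (by decide +revert)
  have hl : ∀ (i : Fin 3) x, FreeAlgebra.ι ℂ x * P.rel (.inr i) ∈ U := fun i x =>
    hU (.inr i, some (.inl x)) (by decide +revert)
  have hl' : ∀ i γ : Fin 3, (i = 0 → γ ≠ 0) → S γ * P.rel (.inl i) ∈ U := fun i γ hi =>
    hU (.inl i, some (.inl γ.succ)) (by decide +revert)
  have d1 : ∀ γ : Fin 3, γ + 2 = 0 → γ + 1 ≠ 0 := by decide
  have d2 : ∀ γ : Fin 3, γ + 1 = 0 → γ + 2 ≠ 0 := by decide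
  have h0 : ∀ γ, S0 * P.rel (.inl γ) ∈ U := by
    intro γ
    rw [← Submodule.smul_mem_iff U (hJ0 γ)]
    have hs := h.syzygy γ
    rw [show J γ • (S0 * P.rel (.inl γ)) = J γ • (P.rel (.inl γ) * S0
        - P.A γ • (S0 * P.rel (.inr γ) + P.rel (.inr γ) * S0) - P.M γ • P.rel (.inr γ))
      - J (γ + 2) • (S (γ + 1) * P.rel (.inr (γ + 2)) - P.rel (.inr (γ + 2)) * S (γ + 1)
        + P.B (γ + 2) • (S (γ + 1) * P.rel (.inl (γ + 2)) + P.rel (.inl (γ + 2)) * S (γ + 1))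
        - P.l (γ + 1) • P.rel (.inl (γ + 2)))
      + J (γ + 1) • (S (γ + 2) * P.rel (.inr (γ + 1)) - P.rel (.inr (γ + 1)) * S (γ + 2)
        - P.B (γ + 1) • (S (γ + 2) * P.rel (.inl (γ + 1)) + P.rel (.inl (γ + 1)) * S (γ + 2))
        - P.l (γ + 2) • P.rel (.inl (γ + 1))) by
        linear_combination (norm := module) hs]
    refine add_mem (sub_mem (U.smul_mem _ (sub_mem (sub_mem (hr _ _) (U.smul_mem _
      (add_mem (hl _ _) (hr _ _)))) (U.smul_mem _ (hrel _)))) (U.smul_mem _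
      (sub_mem (add_mem (sub_mem (hl _ _) (hr _ _)) (U.smul_mem _
      (add_mem (hl' _ _ (d1 γ)) (hr _ _)))) (U.smul_mem _ (hrel _))))) (U.smul_mem _
      (sub_mem (sub_mem (sub_mem (hl _ _) (hr _ _)) (U.smul_mem _
      (add_mem (hl' _ _ (d2 γ)) (hr _ _)))) (U.smul_mem _ (hrel _))))
  have h1 : S 0 * P.rel (.inl 0) ∈ U := by
    rw [← Submodule.smul_mem_iff U (hJ0 0)]
    have hs := h.syzygy_zero
    rw [Fin.sum_univ_three] at hs
    have ht : ∀ γ : Fin 3, γ ≠ 0 → J γ • (S γ * P.rel (.inl γ) - P.rel (.inl γ) * S γ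
        - P.A γ • (S γ * P.rel (.inr γ) + P.rel (.inr γ) * S γ) - P.K γ • P.rel (.inr γ)) ∈ U :=
      fun γ hγ => U.smul_mem _ (sub_mem (sub_mem (sub_mem (hl' _ _ fun _ => hγ) (hr _ _))
        (U.smul_mem _ (add_mem (hl _ _) (hr _ _)))) (U.smul_mem _ (hrel _)))
    have ht0 : J 0 • (P.rel (.inl 0) * S 0 + P.A 0 • (S 0 * P.rel (.inr 0)
        + P.rel (.inr 0) * S 0) + P.K 0 • P.rel (.inr 0)) ∈ U :=
      U.smul_mem _ (add_mem (add_mem (hr _ _) (U.smul_mem _ (add_mem (hl _ _) (hr _ _))))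
        (U.smul_mem _ (hrel _)))
    convert sub_mem (sub_mem ht0 (ht 1 (by decide))) (ht 2 (by decide)) using 1
    linear_combination (norm := module) hs
  refine (ZhukovskyVolterra.consequencesLE_three_le P.rel).trans (Submodule.span_le.2 ?_)
  rintro _ ⟨i, rfl⟩
  by_cases hi : i ∈ redundant
  · simp only [redundant, Finset.mem_insert, Finset.mem_singleton] at hi
    rcases hi with rfl | rfl | rfl | rfl
    · exact h1
    · exact h0 0
    · exact h0 1
    · exact h0 2
  · exact hU i hi

theorem orderedLE_three_le : orderedLE 3 ≤ Submodule.span ℂ (Set.range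
    fun n : {n : Fin 4 → Fin 4 // ∑ i, (n i : ℕ) ≤ 3} => orderedMonomial fun i => n.1 i) := by
  refine Submodule.span_le.2 ?_
  rintro _ ⟨n, hn, rfl⟩
  have hb : ∀ i, n i < 4 := fun i =>
    lt_of_le_of_lt ((Finset.single_le_sum (fun _ _ => Nat.zero_le _) (Finset.mem_univ i)).trans hn)
      (by norm_num)
  exact Submodule.subset_span ⟨⟨fun i => ⟨n i, hb i⟩, hn⟩, rfl⟩

theorem linearIndependent_word : LinearIndependent ℂ word := by
  have h := (FreeAlgebra.basisFreeMonoid ℂ (Fin 4)).linearIndependent.comp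
    (FreeMonoid.ofList : List (Fin 4) → _) FreeMonoid.ofList.injective
  have e : word = FreeAlgebra.basisFreeMonoid ℂ (Fin 4) ∘ FreeMonoid.ofList := by
    funext w
    simp [FreeAlgebra.basisFreeMonoid, word, FreeAlgebra.equivMonoidAlgebraFreeMonoid,
      FreeMonoid.lift_apply]
  rw [e]
  exact h

theorem le_finrank_polyLE_three : 85 ≤ Module.finrank ℂ (polyLE 3) := by
  have hli : LinearIndependent ℂ fun s : (Σ n : Fin 4, Fin n → Fin 4) => word (List.ofFn s.2) := by
    refine linearIndependent_word.comp (fun s : (Σ n : Fin 4, Fin n → Fin 4) => List.ofFn s.2) ?_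
    rintro ⟨m, f⟩ ⟨n, g⟩ h
    have hl := congrArg List.length h
    simp only [List.length_ofFn] at hl
    obtain rfl := Fin.ext hl
    exact congrArg (Sigma.mk m) (List.ofFn_injective h)
  have hspan : Submodule.span ℂ (Set.range
      fun s : (Σ n : Fin 4, Fin n → Fin 4) => word (List.ofFn s.2)) = polyLE 3 := by
    refine le_antisymm (Submodule.span_le.2 ?_) (polyLE_induction fun w hw => ?_)
    · rintro _ ⟨s, rfl⟩
      exact word_mem_polyLE (by simp; omega)
    · exact Submodule.subset_span ⟨⟨⟨w.length, by omega⟩, w.get⟩, by simp⟩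
  -- `85 = 1 + 4 + 16 + 64`
  rw [← hspan, finrank_span_eq_card hli]
  simp [Fin.sum_univ_four]

/-- If normal orderings exist for cubic polynomials, then they are unique, because the dimensions
of the spaces involved leave no room for an intersection. -/
theorem Coeffs.IsCompatible.disjoint {P : Coeffs} {J : Fin 3 → ℂ} (h : P.IsCompatible J)
    (hJ0 : ∀ γ, J γ ≠ 0) (hsup : polyLE 3 ≤ consequencesLE P.rel 3 ⊔ orderedLE 3) :
    Disjoint (consequencesLE P.rel 3) (orderedLE 3) := by
  have hV := h.consequencesLE_three_le hJ0
  have hO := orderedLE_three_le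
  have fV : Module.Finite ℂ (Submodule.span ℂ
    (Set.range fun i : {i // i ∉ redundant} => cubicGen P.rel i)) :=
    FiniteDimensional.span_of_finite ℂ (Set.finite_range _)
  have fO : Module.Finite ℂ (Submodule.span ℂ (Set.range
    fun n : {n : Fin 4 → Fin 4 // ∑ i, (n i : ℕ) ≤ 3} => orderedMonomial fun i => n.1 i)) :=
    FiniteDimensional.span_of_finite ℂ (Set.finite_range _)
  have fV' : Module.Finite ℂ (consequencesLE P.rel 3) := Submodule.finiteDimensional_of_le hV
  have fO' : Module.Finite ℂ (orderedLE 3) := Submodule.finiteDimensional_of_le hO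
  -- `6 * (1 + 4 + 4)` generators, of which four are redundant
  have dV : Module.finrank ℂ (consequencesLE P.rel 3) ≤ 50 :=
    (Submodule.finrank_mono hV).trans ((finrank_range_le_card _).trans (by decide))
  have dO : Module.finrank ℂ (orderedLE 3) ≤ 35 :=
    (Submodule.finrank_mono hO).trans ((finrank_range_le_card _).trans (by
      decide +kernel))
  have dP := le_finrank_polyLE_three.trans (Submodule.finrank_mono hsup)
  have hd := Submodule.finrank_sup_add_finrank_inf_eq (consequencesLE P.rel 3) (orderedLE 3)
  rw [disjoint_iff, ← Submodule.finrank_eq_zero (R := ℂ)]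
  omega

/-! ### Stability of the quantum algebra under the dynamics -/

theorem ddt_S (j k : Fin 3 → ℂ) (γ : Fin 3) : ddt j k (S γ)
    = (j (γ + 1) - j (γ + 2)) • (S (γ + 1) * S (γ + 2) + S (γ + 2) * S (γ + 1))
      + (2 : ℂ) • (k (γ + 1) • S (γ + 2) - k (γ + 2) • S (γ + 1)) := by
  rw [S_eq, ddt_ι]; rfl

theorem ddt_S0 (j k : Fin 3 → ℂ) : ddt j k S0 = 0 := by
  rw [S0_eq, ddt_ι]; rfl

theorem ddt_one (j k : Fin 3 → ℂ) : ddt j k 1 = 0 := by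
  have h := ddt_mul j k 1 1
  rw [one_mul, one_mul, mul_one] at h
  exact left_eq_add.1 h

/-- The derivation `h d/dt - [S₀, ·]`. It measures how far the dynamics is from being generated
by `S₀` as Hamiltonian. -/
def defect (j k : Fin 3 → ℂ) (h : ℂ) : FA →ₗ[ℂ] FA :=
  h • ddt j k - (LinearMap.mulLeft ℂ S0 - LinearMap.mulRight ℂ S0)

theorem defect_apply (j k : Fin 3 → ℂ) (h : ℂ) (x : FA) :
    defect j k h x = h • ddt j k x - (S0 * x - x * S0) := rfl

theorem defect_mul (j k : Fin 3 → ℂ) (h : ℂ) (x y : FA) :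
    defect j k h (x * y) = x * defect j k h y + defect j k h x * y := by
  simp only [defect_apply, ddt_mul, smul_add, mul_sub, sub_mul, mul_smul_comm, smul_mul_assoc,
    mul_assoc]
  abel

theorem defect_one (j k : Fin 3 → ℂ) (h : ℂ) : defect j k h 1 = 0 := by
  simp [defect_apply, ddt_one]

theorem defect_S0 (j k : Fin 3 → ℂ) (h : ℂ) : defect j k h S0 = 0 := by
  simp [defect_apply, ddt_S0]

/-- When `B_γ = h (j_α - j_β)`, the quadratic part of the defect of `S_γ` is a relation. -/
theorem Coeffs.defect_S (P : Coeffs) {j k : Fin 3 → ℂ} {h : ℂ} {γ : Fin 3}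
    (hB : P.B γ = h * (j (γ + 1) - j (γ + 2))) :
    defect j k h (S γ) = P.rel (.inr γ) + ((2 * h * k (γ + 1) - P.l (γ + 1)) • S (γ + 2)
      - (2 * h * k (γ + 2) - P.l (γ + 2)) • S (γ + 1)) := by
  rw [defect_apply, ddt_S, P.rel_inr, hB]
  module

/-- If `[S₀, ·]` is `h d/dt` modulo the relations, then the relations are stable. -/
theorem Coeffs.ddt_rel_mem (P : Coeffs) {j k : Fin 3 → ℂ} {h : ℂ} (hh : h ≠ 0)
    (hB : ∀ γ, P.B γ = h * (j (γ + 1) - j (γ + 2))) (hl : ∀ γ, P.l γ = 2 * h * k γ)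
    (i : Fin 3 ⊕ Fin 3) : ddt j k (P.rel i) ∈ consequencesLE P.rel 3 := by
  have hι : ∀ x, defect j k h (FreeAlgebra.ι ℂ x) ∈ consequencesLE P.rel 2 := by
    intro x
    refine Fin.cases ?_ (fun γ => ?_) x
    · rw [← S0_eq, defect_S0]; exact zero_mem _
    · rw [← S_eq, P.defect_S (hB γ), hl, hl]
      simpa using rel_mem_consequencesLE P.rel (.inr γ)
  have h2 : polyLE 2 ≤ (consequencesLE P.rel 3).comap (defect j k h) := by
    refine polyLE_two_le ?_ (fun x => ?_) (fun x y => ?_)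
    · rw [Submodule.mem_comap, defect_one]; exact zero_mem _
    · exact consequencesLE_mono _ (by norm_num) (hι x)
    · rw [Submodule.mem_comap, defect_mul]
      exact add_mem (mul_mem_consequencesLE (ι_mem_polyLE x) (hι y))
        (consequencesLE_mul_mem (ι_mem_polyLE y) (hι x))
  have h3 := h2 (P.rel_mem_polyLE i)
  rw [Submodule.mem_comap, defect_apply] at h3
  have h4 := add_mem h3 (sub_mem (ι_mul_rel_mem P.rel 0 i) (rel_mul_ι_mem P.rel 0 i))
  rw [← S0_eq, sub_add_cancel] at h4
  exact (Submodule.smul_mem_iff _ hh).1 h4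

/-- The derivation preserves the relations of the commutative polynomials. -/
theorem ddt_rel_mem_of_commutators {r : Relations} (j k : Fin 3 → ℂ)
    (hF : ∀ γ, r (.inl γ) = S (γ + 1) * S (γ + 2) - S (γ + 2) * S (γ + 1))
    (hG : ∀ γ, r (.inr γ) = S γ * S0 - S0 * S γ) (i : Fin 3 ⊕ Fin 3) :
    ddt j k (r i) ∈ consequencesLE r 3 := by
  have hSS : ∀ γ δ : Fin 3, S γ * S δ - S δ * S γ ∈ consequencesLE r 2 := by
    intro γ δ
    have h1 := rel_mem_consequencesLE r (.inl (γ + 1))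
    have h2 := rel_mem_consequencesLE r (.inl (γ + 2))
    rw [hF] at h1 h2
    simp only [add_one_one, add_one_two, add_two_one, add_two_two] at h1 h2
    rcases (by decide : ∀ γ δ : Fin 3, δ = γ ∨ δ = γ + 1 ∨ δ = γ + 2) γ δ with rfl | rfl | rfl
    · simp
    · exact h2
    · simpa using neg_mem h1
  have hS0 : ∀ γ : Fin 3, S γ * S0 - S0 * S γ ∈ consequencesLE r 2 := fun γ => by
    rw [← hG]; exact rel_mem_consequencesLE r _
  have hc : ∀ x y : Fin 4, FreeAlgebra.ι ℂ x * FreeAlgebra.ι ℂ y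
      - FreeAlgebra.ι ℂ y * FreeAlgebra.ι ℂ x ∈ consequencesLE r 2 := by
    intro x y
    refine Fin.cases (Fin.cases ?_ (fun δ => ?_) y) (fun γ => Fin.cases ?_ (fun δ => ?_) y) x
    · simp
    · rw [← neg_sub]; exact neg_mem (hS0 δ)
    · exact hS0 γ
    · exact hSS γ δ
  -- commutators of quadratic polynomials with letters
  have hd : ∀ (y : Fin 4) (d : FA), d ∈ polyLE 2 →
      d * FreeAlgebra.ι ℂ y - FreeAlgebra.ι ℂ y * d ∈ consequencesLE r 3 := by
    intro y
    change polyLE 2 ≤ (consequencesLE r 3).comap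
      (LinearMap.mulRight ℂ (FreeAlgebra.ι ℂ y) - LinearMap.mulLeft ℂ (FreeAlgebra.ι ℂ y))
    refine polyLE_two_le ?_ (fun x => ?_) (fun x z => ?_)
    · simp
    · exact consequencesLE_mono r (by norm_num) (hc x y)
    · have h1 := mul_mem_consequencesLE (N := 3) (ι_mem_polyLE x) (hc z y)
      have h2 := consequencesLE_mul_mem (N := 3) (ι_mem_polyLE z) (hc x y)
      have h3 := add_mem h1 h2
      simp only [mul_sub, sub_mul, ← mul_assoc] at h3
      simp only [Submodule.mem_comap, LinearMap.sub_apply, LinearMap.mulRight_apply,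
        LinearMap.mulLeft_apply, ← mul_assoc]
      rwa [sub_add_sub_cancel] at h3
  have hv : ∀ x, ddt j k (FreeAlgebra.ι ℂ x) ∈ polyLE 2 := by
    intro x
    refine Fin.cases ?_ (fun γ => ?_) x
    · rw [← S0_eq, ddt_S0]; exact zero_mem _
    · rw [← S_eq, ddt_S]
      exact add_mem (Submodule.smul_mem _ _ (add_mem (ι_mul_ι_mem_polyLE _ _)
        (ι_mul_ι_mem_polyLE _ _))) (polyLE_mono one_le_two (Submodule.smul_mem _ _
        (sub_mem (Submodule.smul_mem _ _ (S_mem_polyLE _))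
          (Submodule.smul_mem _ _ (S_mem_polyLE _)))))
  have hcomm : ∀ x y : Fin 4, ddt j k (FreeAlgebra.ι ℂ x * FreeAlgebra.ι ℂ y
      - FreeAlgebra.ι ℂ y * FreeAlgebra.ι ℂ x) ∈ consequencesLE r 3 := by
    intro x y
    have h1 := sub_mem (hd y _ (hv x)) (hd x _ (hv y))
    rw [map_sub, ddt_mul, ddt_mul]
    convert h1 using 1
    abel
  rcases i with γ | γ
  · rw [hF]; exact hcomm _ _
  · rw [hG]; exact hcomm _ _

theorem isStable_of_ddt_mem {r : Relations} {j k : Fin 3 → ℂ}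
    (h : ∀ i, ddt j k (r i) ∈ idealOf r) : IsStable j k (idealOf r) := by
  intro x hx
  induction hx using TwoSidedIdeal.span_induction with
  | mem x hx => obtain ⟨i, rfl⟩ := hx; exact h i
  | zero => rw [map_zero]; exact (idealOf r).zero_mem
  | add x y _ _ hx hy => rw [map_add]; exact (idealOf r).add_mem hx hy
  | neg x _ hx => rw [map_neg]; exact (idealOf r).neg_mem hx
  | left_absorb a x hx' hx =>
    rw [ddt_mul]
    exact (idealOf r).add_mem ((idealOf r).mul_mem_left _ _ hx)
      ((idealOf r).mul_mem_left _ _ hx')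
  | right_absorb b x hx' hx =>
    rw [ddt_mul]
    exact (idealOf r).add_mem ((idealOf r).mul_mem_right _ _ hx')
      ((idealOf r).mul_mem_right _ _ hx)

/-! ### The five-parameter family -/

/-- The denominators in the relations of the quantum algebra. -/
def den (j : Fin 3 → ℂ) (h C D : ℂ) (γ : Fin 3) : ℂ :=
  1 + h ^ 2 * j γ * (C + (j (γ + 2) + j (γ + 1)) * D)

/-- The coefficients of the relations of the quantum algebra. -/
def quantumCoeffs (j k : Fin 3 → ℂ) (h A B C D : ℂ) : Coeffs where
  A γ := h * (C + D * j γ) / den j h C D γ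
  B γ := h * (j (γ + 1) - j (γ + 2))
  K γ := 2 * h * (D * k γ) / den j h C D γ
  M γ := 2 * h * (A + B * j γ) / den j h C D γ
  N γ := 2 * h * (B * k γ) / den j h C D γ
  l γ := 2 * h * k γ

theorem quantumCoeffs_rel (j k : Fin 3 → ℂ) (h A B C D : ℂ) :
    (quantumCoeffs j k h A B C D).rel = quantumRel j k h A B C D := by
  funext i
  rcases i with γ | γ
  · change _ = S (γ + 1) * S (γ + 2) - S (γ + 2) * S (γ + 1) - commRhs j k h A B C D γ
    rw [Coeffs.rel_inl, commRhs, ← den]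
    simp only [quantumCoeffs, Algebra.algebraMap_eq_smul_one, div_eq_mul_inv]
    module
  · change _ = S γ * S0 - S0 * S γ - commRhs₀ j k h γ
    rw [Coeffs.rel_inr, commRhs₀]
    simp only [quantumCoeffs]
    module

theorem Inequalities.den_ne_zero {j : Fin 3 → ℂ} {h C D : ℂ} (hI : Inequalities j h C D)
    (γ : Fin 3) : den j h C D γ ≠ 0 := by
  have h1 := hI.2.2 γ
  rwa [show 1 + h ^ 2 * j γ * (C + D * (j (γ + 1) + j (γ + 2))) = den j h C D γ by
    rw [den]; ring] at h1

/-- For the quantum algebra, the conditions `sig J γ ≠ 0` are the second family of inequalities. -/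
theorem sig_den (j : Fin 3 → ℂ) (h C D : ℂ) (γ : Fin 3) : sig (den j h C D) γ
    = 1 + h ^ 2 * (C * (j (γ + 1) + j (γ + 2) - j γ) + 2 * D * j (γ + 1) * j (γ + 2)) := by
  simp only [sig, den, add_one_one, add_one_two, add_two_one, add_two_two]
  ring

theorem quartic_den (j : Fin 3 → ℂ) (h C D : ℂ) : quartic (den j h C D)
    = (h ^ 2 * (C * (j 0 + j 1 - j 2) + 2 * D * j 0 * j 1) + 1) ^ 4
      - 16 * h ^ 4 * (j 0 - j 2) * (j 1 - j 2) * (C + D * j 0) * (C + D * j 1)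
        * (h ^ 2 * j 1 * (C + D * (j 0 + j 2)) + 1)
        * (h ^ 2 * j 0 * (C + D * (j 1 + j 2)) + 1) := by
  simp only [quartic, sig_den, show (0 : Fin 3) + 1 = 1 from rfl,
    show (0 : Fin 3) + 2 = 2 from rfl, show (1 : Fin 3) + 1 = 2 from rfl,
    show (1 : Fin 3) + 2 = 0 from rfl, show (2 : Fin 3) + 1 = 0 from rfl,
    show (2 : Fin 3) + 2 = 1 from rfl]
  ring

/-- The inequalities say that the normal ordering of cubic words is possible, and that no
denominator vanishes. -/
theorem inequalities_iff (j : Fin 3 → ℂ) (h C D : ℂ) : Inequalities j h C D ↔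
    quartic (den j h C D) ≠ 0 ∧ (∀ γ, sig (den j h C D) γ ≠ 0) ∧ ∀ γ, den j h C D γ ≠ 0 := by
  refine ⟨fun hI => ⟨?_, fun γ => ?_, hI.den_ne_zero⟩, fun ⟨h1, h2, h3⟩ => ⟨?_, fun γ => ?_,
    fun γ => ?_⟩⟩
  · rw [quartic_den]; exact hI.1
  · rw [sig_den]; exact hI.2.1 γ
  · rw [← quartic_den]; exact h1
  · rw [← sig_den]; exact h2 γ
  · have h4 := h3 γ
    rwa [show den j h C D γ = 1 + h ^ 2 * j γ * (C + D * (j (γ + 1) + j (γ + 2))) by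
      rw [den]; ring] at h4

theorem isCompatible_quantumCoeffs (j k : Fin 3 → ℂ) (h A B C D : ℂ)
    (hd : ∀ γ, den j h C D γ ≠ 0) :
    (quantumCoeffs j k h A B C D).IsCompatible (den j h C D) := by
  constructor
  · intro γ
    simp only [quantumCoeffs]
    field_simp [hd γ]
    simp only [den, add_one_one, add_one_two, add_two_one, add_two_two]
    ring
  · intro γ
    simp only [quantumCoeffs]
    field_simp [hd γ, hd (γ + 1), hd (γ + 2)]
    ring
  · intro γ
    simp only [quantumCoeffs]
    field_simp [hd γ, hd (γ + 1), hd (γ + 2)]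
  · rw [← sum_cyclic _ 0]
    simp only [quantumCoeffs, show (0 : Fin 3) + 1 = 1 from rfl,
      show (0 : Fin 3) + 2 = 2 from rfl, show (1 : Fin 3) + 1 = 2 from rfl,
      show (1 : Fin 3) + 2 = 0 from rfl, show (2 : Fin 3) + 1 = 0 from rfl,
      show (2 : Fin 3) + 2 = 1 from rfl]
    field_simp [hd 0, hd 1, hd 2]
    ring
  · intro γ
    simp only [quantumCoeffs]
    field_simp [hd γ, hd (γ + 1), hd (γ + 2)]
    ring
  · intro γ
    simp only [quantumCoeffs]
    field_simp [hd γ, hd (γ + 1), hd (γ + 2)]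

/-- The relations of the quantum algebra define a quantisation ideal up to cubic polynomials. -/
theorem isCubicQuantisation_quantumRel (j k : Fin 3 → ℂ) (h A B C D : ℂ)
    (hI : Inequalities j h C D) : IsCubicQuantisation j k (quantumRel j k h A B C D) := by
  obtain ⟨hQ, hσ, hd⟩ := (inequalities_iff j h C D).1 hI
  have hc := isCompatible_quantumCoeffs j k h A B C D hd
  rw [← quantumCoeffs_rel]
  have h3 := (quantumCoeffs j k h A B C D).polyLE_three_le_sup hc.hJ hσ hQ
  have hd3 := hc.disjoint hd h3
  refine ⟨?_, hasNormalOrdering_of_isCompl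
    (Coeffs.polyLE_two_le_sup _ (sq_ne_one_of_sig hc.hJ hσ))
    (hd3.mono (consequencesLE_mono _ (by norm_num)) (orderedLE_mono (by norm_num))),
    hasNormalOrdering_of_isCompl h3 hd3⟩
  -- for `h = 0` the derivation is not determined by the commutators with `S₀`, but then all
  -- variables commute
  by_cases hh : h = 0
  · subst hh
    refine ddt_rel_mem_of_commutators j k (fun γ => ?_) (fun γ => ?_)
    · simp [Coeffs.rel_inl, quantumCoeffs]
    · simp [Coeffs.rel_inr, quantumCoeffs]
  · exact Coeffs.ddt_rel_mem _ hh (fun γ => rfl) (fun γ => rfl)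

/-! ### The Poisson brackets -/

/-- The derivation `{f, ·}`. -/
def hamiltonian (j k : Fin 3 → ℂ) (e a b c d : ℂ) (f : CP) : Derivation ℂ CP CP :=
  ∑ γ : Fin 3,
    (bracketSS j k a b c d γ •
        (MvPolynomial.pderiv (γ + 1).succ f • MvPolynomial.pderiv (γ + 2).succ
          - MvPolynomial.pderiv (γ + 2).succ f • MvPolynomial.pderiv (γ + 1).succ)
      + bracketS0S j k e γ •
        (MvPolynomial.pderiv 0 f • MvPolynomial.pderiv γ.succ
          - MvPolynomial.pderiv γ.succ f • MvPolynomial.pderiv 0))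

theorem hamiltonian_apply (j k : Fin 3 → ℂ) (e a b c d : ℂ) (f g : CP) :
    hamiltonian j k e a b c d f g = bracket j k e a b c d f g := by
  simp only [hamiltonian, bracket, Fin.sum_univ_three, Derivation.add_apply,
    Derivation.sub_apply, Derivation.smul_apply, smul_eq_mul]

theorem bracket_antisymm (j k : Fin 3 → ℂ) (e a b c d : ℂ) (f g : CP) :
    bracket j k e a b c d f g = -bracket j k e a b c d g f := by
  simp only [bracket, Fin.sum_univ_three]
  ring

theorem bracket_mul (j k : Fin 3 → ℂ) (e a b c d : ℂ) (f g u : CP) :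
    bracket j k e a b c d f (g * u)
      = bracket j k e a b c d f g * u + g * bracket j k e a b c d f u := by
  simp only [← hamiltonian_apply, Derivation.leibniz, smul_eq_mul]
  ring

theorem bracket_neg_right (j k : Fin 3 → ℂ) (e a b c d : ℂ) (f g : CP) :
    bracket j k e a b c d f (-g) = -bracket j k e a b c d f g := by
  simp only [← hamiltonian_apply, map_neg]

theorem bracket_s_s (j k : Fin 3 → ℂ) (e a b c d : ℂ) (γ : Fin 3) :
    bracket j k e a b c d (s (γ + 1)) (s (γ + 2)) = bracketSS j k a b c d γ := by
  fin_cases γ <;>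
    simp [bracket, Fin.sum_univ_three, s, MvPolynomial.pderiv_X, Pi.single_apply]

theorem bracket_s_s0 (j k : Fin 3 → ℂ) (e a b c d : ℂ) (γ : Fin 3) :
    bracket j k e a b c d (s γ) s0 = -bracketS0S j k e γ := by
  fin_cases γ <;>
    simp [bracket, Fin.sum_univ_three, s, s0, MvPolynomial.pderiv_X, Pi.single_apply]

/-- The cyclic sum of iterated brackets. -/
def jacobiator (j k : Fin 3 → ℂ) (e a b c d : ℂ) (f g u : CP) : CP :=
  bracket j k e a b c d f (bracket j k e a b c d g u)
    + bracket j k e a b c d g (bracket j k e a b c d u f)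
    + bracket j k e a b c d u (bracket j k e a b c d f g)

theorem jacobiator_rotate (j k : Fin 3 → ℂ) (e a b c d : ℂ) (f g u : CP) :
    jacobiator j k e a b c d f g u = jacobiator j k e a b c d g u f := by
  simp only [jacobiator]; ring

theorem jacobiator_swap (j k : Fin 3 → ℂ) (e a b c d : ℂ) (f g u : CP) :
    jacobiator j k e a b c d f g u = -jacobiator j k e a b c d g f u := by
  simp only [jacobiator]
  rw [bracket_antisymm j k e a b c d g u, bracket_antisymm j k e a b c d u f,
    bracket_antisymm j k e a b c d f g]
  simp only [bracket_neg_right]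
  ring

theorem jacobiator_self (j k : Fin 3 → ℂ) (e a b c d : ℂ) (f u : CP) :
    jacobiator j k e a b c d f f u = 0 := by
  have h := jacobiator_swap j k e a b c d f f u
  exact self_eq_neg.1 h

/-- The jacobiator is a derivation in its last argument, hence vanishes if it vanishes on the
coordinates. -/
theorem jacobiator_eq_zero_of_X {j k : Fin 3 → ℂ} {e a b c d : ℂ} {f g : CP}
    (h : ∀ i, jacobiator j k e a b c d f g (MvPolynomial.X i) = 0) (u : CP) :
    jacobiator j k e a b c d f g u = 0 := by
  have hD : ∀ v, jacobiator j k e a b c d f g v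
      = (⁅hamiltonian j k e a b c d f, hamiltonian j k e a b c d g⁆
        - hamiltonian j k e a b c d (bracket j k e a b c d f g)) v := by
    intro v
    rw [jacobiator, bracket_antisymm j k e a b c d v f, bracket_neg_right,
      bracket_antisymm j k e a b c d v]
    simp only [Derivation.sub_apply, Derivation.commutator_apply, hamiltonian_apply]
    ring
  have h0 : ⁅hamiltonian j k e a b c d f, hamiltonian j k e a b c d g⁆
      - hamiltonian j k e a b c d (bracket j k e a b c d f g) = 0 :=
    MvPolynomial.derivation_ext fun i => by rw [← hD, h]; rfl
  rw [hD, h0]; rfl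

set_option maxHeartbeats 1000000 in
theorem jacobiator_X_zero (j k : Fin 3 → ℂ) (e a b c d : ℂ) (γ : Fin 3) :
    jacobiator j k e a b c d (MvPolynomial.X 0) (MvPolynomial.X (γ + 1).succ)
      (MvPolynomial.X (γ + 2).succ) = 0 := by
  have h1 := bracket_s_s j k e a b c d γ
  have h2 := bracket_s_s0 j k e a b c d (γ + 2)
  have h3 := bracket_antisymm j k e a b c d s0 (s (γ + 1))
  rw [bracket_s_s0, neg_neg] at h3
  simp only [s, s0] at h1 h2 h3
  rw [jacobiator, h1, h2, h3]
  fin_cases γ <;>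
    simp [bracket, bracketSS, bracketS0S, Fin.sum_univ_three, s, s0, MvPolynomial.pderiv_X,
      Pi.single_apply, MvPolynomial.smul_eq_C_mul] <;> ring

set_option maxHeartbeats 1000000 in
theorem jacobiator_X (j k : Fin 3 → ℂ) (e a b c d : ℂ) :
    jacobiator j k e a b c d (MvPolynomial.X 1) (MvPolynomial.X 2) (MvPolynomial.X 3) = 0 := by
  have h1 := bracket_s_s j k e a b c d 0
  have h2 := bracket_s_s j k e a b c d 1
  have h3 := bracket_s_s j k e a b c d 2
  simp only [s, show (0 : Fin 3) + 1 = 1 from rfl, show (0 : Fin 3) + 2 = 2 from rfl,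
    show (1 : Fin 3) + 1 = 2 from rfl, show (1 : Fin 3) + 2 = 0 from rfl,
    show (2 : Fin 3) + 1 = 0 from rfl, show (2 : Fin 3) + 2 = 1 from rfl,
    show (0 : Fin 3).succ = 1 from rfl, show (1 : Fin 3).succ = 2 from rfl,
    show (2 : Fin 3).succ = 3 from rfl] at h1 h2 h3
  rw [jacobiator, h1, h2, h3]
  simp [bracket, bracketSS, bracketS0S, Fin.sum_univ_three, s, s0, MvPolynomial.pderiv_X,
      Pi.single_apply, MvPolynomial.smul_eq_C_mul]
  ring

/-- A cyclic and alternating function of three coordinates is determined by the four triples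
without repetition. -/
theorem eq_zero_of_alternating {M : Type*} [Zero M] {F : Fin 4 → Fin 4 → Fin 4 → M}
    (hs : ∀ i m, F i i m = 0) (hr : ∀ i l m, F i l m = F l m i)
    (hw : ∀ i l m, F l i m = 0 → F i l m = 0) (h0 : F 0 2 3 = 0) (h1 : F 0 3 1 = 0)
    (h2 : F 0 1 2 = 0) (h3 : F 1 2 3 = 0) (i l m : Fin 4) : F i l m = 0 := by
  have hs' : ∀ i m, F i m i = 0 := fun i m => by rw [← hr, hs]
  have hs'' : ∀ i m, F m i i = 0 := fun i m => by rw [hr, hs]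
  have key : ∀ i l m, F i l m = 0 → F i l m = 0 ∧ F l m i = 0 ∧ F m i l = 0 ∧ F l i m = 0 ∧
      F i m l = 0 ∧ F m l i = 0 := fun i l m h =>
    have h' := (hr i l m).symm.trans h
    have h'' := (hr m i l).trans h
    ⟨h, h', h'', hw _ _ _ h, hw _ _ _ h'', hw _ _ _ h'⟩
  have k0 := key _ _ _ h0
  have k1 := key _ _ _ h1
  have k2 := key _ _ _ h2
  have k3 := key _ _ _ h3
  fin_cases i <;> fin_cases l <;> fin_cases m <;> simp [hs, hs', hs'', k0, k1, k2, k3]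

theorem jacobi (j k : Fin 3 → ℂ) (e a b c d : ℂ) (f g u : CP) :
    jacobiator j k e a b c d f g u = 0 := by
  refine jacobiator_eq_zero_of_X (fun m => ?_) u
  rw [← jacobiator_rotate]
  refine jacobiator_eq_zero_of_X (fun l => ?_) g
  rw [← jacobiator_rotate]
  refine jacobiator_eq_zero_of_X (fun i => ?_) f
  exact eq_zero_of_alternating
    (F := fun i l m => jacobiator j k e a b c d (MvPolynomial.X i) (MvPolynomial.X l)
      (MvPolynomial.X m))
    (fun _ _ => jacobiator_self _ _ _ _ _ _ _ _ _) (fun _ _ _ => jacobiator_rotate ..)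
    (fun _ _ _ h => by rw [jacobiator_swap, h, neg_zero])
    (jacobiator_X_zero j k e a b c d 0) (jacobiator_X_zero j k e a b c d 1)
    (jacobiator_X_zero j k e a b c d 2) (jacobiator_X j k e a b c d) _ _ _

/-! ### The classical limit -/

section ClassicalLimit

theorem ClassicalLimit.add {p p' : ℂ → CP} {q q' : CP} (h : ClassicalLimit p q)
    (h' : ClassicalLimit p' q') : ClassicalLimit (fun x => p x + p' x) (q + q') := fun m => by
  simpa only [MvPolynomial.coeff_add] using (h m).add (h' m)

theorem ClassicalLimit.neg {p : ℂ → CP} {q : CP} (h : ClassicalLimit p q) :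
    ClassicalLimit (fun x => -p x) (-q) := fun m => by
  simpa only [MvPolynomial.coeff_neg] using (h m).neg

theorem ClassicalLimit.congr {p p' : ℂ → CP} {q : CP} (h : ClassicalLimit p q)
    (e : ∀ x ≠ 0, p' x = p x) : ClassicalLimit p' q := fun m =>
  (h m).congr' (eventually_nhdsWithin_of_forall fun x hx => congrArg _ (e x hx).symm)

theorem ClassicalLimit.inv {p : ℂ → CP} {q : CP}
    (h : ClassicalLimit (fun t => (-t)⁻¹ • p t) q) :
    ClassicalLimit (fun t => t⁻¹ • p t) (-q) :=
  h.neg.congr (fun t _ => by rw [inv_neg, neg_smul, neg_neg])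

theorem classicalLimit_smul {f : ℂ → ℂ} {c : ℂ} (hf : Tendsto f (𝓝 0) (𝓝 c)) (q : CP) :
    ClassicalLimit (fun x => f x • q) (c • q) := fun m => by
  simp only [MvPolynomial.coeff_smul, smul_eq_mul]
  exact (hf.mono_left nhdsWithin_le_nhds).mul_const _

theorem classicalLimit_const (q : CP) : ClassicalLimit (fun _ => q) q := fun _ =>
  tendsto_const_nhds

theorem abel_S (γ : Fin 3) : abel (S γ) = s γ := by simp [abel, S, s]

theorem abel_S0 : abel S0 = s0 := by simp [abel, S0, s0]

variable {A B C D : ℂ → ℂ}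

theorem tendsto_den (j : Fin 3 → ℂ) (hC : ContinuousAt C 0) (hD : ContinuousAt D 0)
    (γ : Fin 3) : Tendsto (fun h => den j h (C h) (D h) γ) (𝓝 0) (𝓝 1) := by
  have h : ContinuousAt (fun h => den j h (C h) (D h) γ) 0 := by
    unfold den; fun_prop
  simpa [ContinuousAt, den] using h

theorem eventually_inequalities (j : Fin 3 → ℂ) (hC : ContinuousAt C 0) (hD : ContinuousAt D 0) :
    ∀ᶠ h in 𝓝 (0 : ℂ), Inequalities j h (C h) (D h) := by
  have hd := tendsto_den j hC hD
  have hs : ∀ γ, Tendsto (fun h => sig (den j h (C h) (D h)) γ) (𝓝 0) (𝓝 1) := fun γ => by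
    simpa [sig] using ((hd (γ + 1)).add (hd (γ + 2))).sub (hd γ)
  have hq : Tendsto (fun h => quartic (den j h (C h) (D h))) (𝓝 0) (𝓝 1) := by
    simpa [quartic] using ((((hs 0).pow 2).mul ((hs 2).pow 2)).sub
      (((hs 0).pow 2).mul ((hs 1).pow 2))).add (((hs 1).pow 2).mul ((hs 2).pow 2))
  filter_upwards [hq.eventually_ne one_ne_zero,
    eventually_all.2 fun γ => (hs γ).eventually_ne one_ne_zero,
    eventually_all.2 fun γ => (hd γ).eventually_ne one_ne_zero] with h h1 h2 h3
  exact (inequalities_iff j h _ _).2 ⟨h1, h2, h3⟩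

theorem classicalLimit_commRhs (j k : Fin 3 → ℂ) (hA : ContinuousAt A 0) (hB : ContinuousAt B 0)
    (hC : ContinuousAt C 0) (hD : ContinuousAt D 0) (γ : Fin 3) :
    ClassicalLimit (fun h => (-h)⁻¹ • abel (commRhs j k h (A h) (B h) (C h) (D h) γ))
      (bracketSS j k (A 0) (B 0) (C 0) (D 0) γ) := by
  have hd := (tendsto_den j hC hD γ).inv₀ one_ne_zero
  rw [inv_one] at hd
  have hlim : ∀ f : ℂ → ℂ, ContinuousAt f 0 →
      Tendsto (fun h => 2 * (den j h (C h) (D h) γ)⁻¹ * f h) (𝓝 0) (𝓝 (2 * f 0)) := by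
    intro f hf
    simpa using (hd.const_mul 2).mul hf.tendsto
  have h1 := classicalLimit_smul (hlim (fun h => C h + D h * j γ) (by fun_prop)) (s0 * s γ)
  have h2 := classicalLimit_smul (hlim (fun h => A h + B h * j γ) (by fun_prop)) (s γ)
  have h3 := classicalLimit_smul (hlim (fun h => D h * k γ) (by fun_prop)) s0
  have h4 := classicalLimit_smul (hlim (fun h => B h * k γ) (by fun_prop)) 1
  have h5 := ((h1.add h2).add h3).add h4
  rw [show bracketSS j k (A 0) (B 0) (C 0) (D 0) γ = (2 * (C 0 + D 0 * j γ)) • (s0 * s γ)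
      + (2 * (A 0 + B 0 * j γ)) • s γ + (2 * (D 0 * k γ)) • s0 + (2 * (B 0 * k γ)) • (1 : CP) by
    rw [bracketSS, ← MvPolynomial.algebraMap_eq, Algebra.algebraMap_eq_smul_one]; module]
  refine h5.congr fun h hh => ?_
  rw [commRhs, ← den]
  simp only [Algebra.algebraMap_eq_smul_one]
  simp only [map_smul, map_add, map_mul, abel_S, abel_S0, map_one, mul_comm (s γ) s0]
  rw [smul_smul, show (-h)⁻¹ * -(2 * h / den j h (C h) (D h) γ)
    = 2 * (den j h (C h) (D h) γ)⁻¹ by field_simp]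
  module

theorem classicalLimit_commRhs₀ (j k : Fin 3 → ℂ) (γ : Fin 3) :
    ClassicalLimit (fun h => (-h)⁻¹ • abel (commRhs₀ j k h γ)) (bracketS0S j k 1 γ) := by
  refine (classicalLimit_const _).congr fun h hh => ?_
  rw [commRhs₀, bracketS0S]
  simp only [map_smul, map_add, map_sub, map_mul, abel_S, mul_comm (s (γ + 2)) (s (γ + 1))]
  rw [smul_smul, inv_mul_cancel₀ (neg_ne_zero.2 hh)]
  module

theorem bracketSS_neg (j k : Fin 3 → ℂ) (a b c d : ℂ) (γ : Fin 3) :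
    bracketSS j k (-a) (-b) (-c) (-d) γ = -bracketSS j k a b c d γ := by
  simp only [bracketSS, ← MvPolynomial.algebraMap_eq, Algebra.algebraMap_eq_smul_one]
  module

theorem bracketS0S_neg (j k : Fin 3 → ℂ) (γ : Fin 3) :
    bracketS0S j k (-1) γ = -bracketS0S j k 1 γ := by
  simp only [bracketS0S]
  module

end ClassicalLimit

/-! ### Consequences of a quantisation ideal in degree three -/

/-- The properties that determine the coefficients of the relations. They hold for `I` a
quantisation ideal, and for `I` the span of the cubic consequences of relations that define a
quantisation ideal up to cubic polynomials; the latter is not an ideal. -/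
structure Coeffs.Admits (P : Coeffs) (j k : Fin 3 → ℂ) (I : Submodule ℂ FA) : Prop where
  cons : consequencesLE P.rel 3 ≤ I
  stable : ∀ i, ddt j k (P.rel i) ∈ I
  disj : Disjoint I (orderedLE 3)

theorem IsCubicQuantisation.admits {P : Coeffs} {j k : Fin 3 → ℂ}
    (h : IsCubicQuantisation j k P.rel) : P.Admits j k (consequencesLE P.rel 3) :=
  ⟨le_rfl, h.1, h.2.2.disjoint⟩

/-- The projection to the quotient by a two-sided ideal, as a linear map. -/
def quotientMap (I : TwoSidedIdeal FA) : FA →ₗ[ℂ] I.ringCon.Quotient where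
  toFun := I.ringCon.mk'
  map_add' := map_add _
  map_smul' _ _ := rfl

theorem mem_ker_quotientMap {I : TwoSidedIdeal FA} {x : FA} :
    x ∈ LinearMap.ker (quotientMap I) ↔ x ∈ I := by
  rw [LinearMap.mem_ker, TwoSidedIdeal.mem_iff]
  exact RingCon.eq I.ringCon

theorem IsQuantisationIdeal.admits {P : Coeffs} {j k : Fin 3 → ℂ}
    (h : IsQuantisationIdeal j k (idealOf P.rel)) :
    P.Admits j k (LinearMap.ker (quotientMap (idealOf P.rel))) := by
  refine ⟨fun x hx => mem_ker_quotientMap.2 (consequencesLE_le_idealOf _ _ hx), fun i =>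
    mem_ker_quotientMap.2 (h.1 _ (TwoSidedIdeal.subset_span ⟨i, rfl⟩)), ?_⟩
  have h1 : Disjoint (Submodule.span ℂ (Set.range orderedMonomial))
      (LinearMap.ker (quotientMap (idealOf P.rel))) := Submodule.range_ker_disjoint h.2.1
  refine h1.symm.mono_right (Submodule.span_mono ?_)
  rintro _ ⟨n, -, rfl⟩
  exact ⟨n, rfl⟩

namespace Coeffs.Admits

variable {P : Coeffs} {j k : Fin 3 → ℂ} {I : Submodule ℂ FA}

theorem rel_mem (h : P.Admits j k I) (i : Fin 3 ⊕ Fin 3) : P.rel i ∈ I :=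
  h.cons (consequencesLE_mono _ (by norm_num) (rel_mem_consequencesLE P.rel i))

theorem ι_mul_mem (h : P.Admits j k I) (x : Fin 4) (i : Fin 3 ⊕ Fin 3) :
    FreeAlgebra.ι ℂ x * P.rel i ∈ I := h.cons (ι_mul_rel_mem _ _ _)

theorem mul_ι_mem (h : P.Admits j k I) (x : Fin 4) (i : Fin 3 ⊕ Fin 3) :
    P.rel i * FreeAlgebra.ι ℂ x ∈ I := h.cons (rel_mul_ι_mem _ _ _)

/-- The normally ordered words of length three stay independent modulo the ideal and the
polynomials of lower degree. -/
theorem linearIndependent (h : P.Admits j k I) (ht : ∀ γ, (P.A γ * P.B γ) ^ 2 ≠ 1)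
    {κ : Type*} (w : κ → Fin 4 × Fin 4 × Fin 4)
    (ho : ∀ i, (w i).1 ≤ (w i).2.1 ∧ (w i).2.1 ≤ (w i).2.2)
    (hw : Function.Injective fun i => (Pi.single (w i).1 1 + Pi.single (w i).2.1 1
      + Pi.single (w i).2.2 1 : Fin 4 → ℕ)) :
    LinearIndependent ℂ fun i => (I ⊔ polyLE 2).mkQ (FreeAlgebra.ι ℂ (w i).1
      * FreeAlgebra.ι ℂ (w i).2.1 * FreeAlgebra.ι ℂ (w i).2.2) := by
  have e : (fun i => FreeAlgebra.ι ℂ (w i).1 * FreeAlgebra.ι ℂ (w i).2.1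
      * FreeAlgebra.ι ℂ (w i).2.2) = orderedMonomial ∘ fun i => (Pi.single (w i).1 1
        + Pi.single (w i).2.1 1 + Pi.single (w i).2.2 1 : Fin 4 → ℕ) := by
    funext i
    exact (orderedMonomial_triple (ho i).1 (ho i).2).symm
  have h1 : LinearIndependent ℂ fun i => FreeAlgebra.ι ℂ (w i).1 * FreeAlgebra.ι ℂ (w i).2.1
      * FreeAlgebra.ι ℂ (w i).2.2 := by
    rw [e]
    exact linearIndependent_orderedMonomial.comp _ hw
  refine h1.map (f := (I ⊔ polyLE 2).mkQ) ?_
  rw [Submodule.ker_mkQ]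
  have h2 : I ⊔ polyLE 2 ≤ I ⊔ orderedLE 2 := sup_le le_sup_left
    ((P.polyLE_two_le_sup ht).trans
      (sup_le_sup ((consequencesLE_mono _ (by norm_num)).trans h.cons) le_rfl))
  have h3 : Submodule.span ℂ (Set.range fun i => FreeAlgebra.ι ℂ (w i).1
      * FreeAlgebra.ι ℂ (w i).2.1 * FreeAlgebra.ι ℂ (w i).2.2)
      ≤ Submodule.span ℂ (orderedMonomial '' {n | ∑ i, n i = 3}) := by
    rw [e]
    refine Submodule.span_mono ?_
    rintro _ ⟨i, rfl⟩
    exact ⟨_, by simp [Finset.sum_add_distrib], rfl⟩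
  have h4 : orderedLE 2 ≤ Submodule.span ℂ (orderedMonomial '' {n | ∑ i, n i ≤ 2}) :=
    Submodule.span_mono fun _ ⟨n, hn, hx⟩ => ⟨n, hn, hx.symm⟩
  have h5 : Submodule.span ℂ (orderedMonomial '' {n | ∑ i, n i = 3}) ≤ orderedLE 3 :=
    Submodule.span_mono fun _ ⟨n, hn, hx⟩ => ⟨n, le_of_eq hn, hx.symm⟩
  have h6 := linearIndependent_orderedMonomial.disjoint_span_image
    (s := {n | ∑ i, n i = 3}) (t := {n | ∑ i, n i ≤ 2})
    (Set.disjoint_left.2 fun n hn hn' => by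
      rw [Set.mem_ofPred_eq] at hn hn'; omega)
  refine Submodule.disjoint_def.2 fun x hx hx' => ?_
  obtain ⟨y, hy, q, hq, hyq⟩ := Submodule.mem_sup.1 (h2 hx')
  have h7 : y ∈ orderedLE 3 := by
    rw [show y = x - q by rw [← hyq]; abel]
    exact sub_mem (h5 (h3 hx)) (orderedLE_mono (by norm_num) hq)
  have h8 : y = 0 := Submodule.disjoint_def.1 h.disj y hy h7
  rw [h8, zero_add] at hyq
  exact Submodule.disjoint_def.1 h6 x (h3 hx) (h4 (hyq ▸ hq))

theorem isCubicModel (h : P.Admits j k I) : IsCubicModel P.A P.B fun x y z =>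
    (I ⊔ polyLE 2).mkQ (FreeAlgebra.ι ℂ x * FreeAlgebra.ι ℂ y * FreeAlgebra.ι ℂ z) :=
  P.isCubicModel (h.cons.trans le_sup_left) le_sup_right

/-- The normally ordered words in the sector of `S₀` are independent. -/
theorem sector_zero_independent (h : P.Admits j k I) (ht : ∀ γ, (P.A γ * P.B γ) ^ 2 ≠ 1)
    {T : Fin 4 → Fin 4 → Fin 4 → FA ⧸ (I ⊔ polyLE 2)}
    (hT : T = fun x y z => (I ⊔ polyLE 2).mkQ (FreeAlgebra.ι ℂ x * FreeAlgebra.ι ℂ y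
      * FreeAlgebra.ι ℂ z)) {a b c d : ℂ}
    (he : a • T 1 2 3 + b • T 0 1 1 + c • T 0 2 2 + d • T 0 3 3 = 0) :
    a = 0 ∧ b = 0 ∧ c = 0 ∧ d = 0 := by
  have h1 := h.linearIndependent ht ![(1, 2, 3), (0, 1, 1), (0, 2, 2), (0, 3, 3)]
    (by decide) (by decide)
  have h2 := Fintype.linearIndependent_iff.1 h1 ![a, b, c, d]
    (by rw [Fin.sum_univ_four]; subst hT; exact he)
  exact ⟨h2 0, h2 1, h2 2, h2 3⟩

/-- The three products `A_γ B_γ` satisfy the relation under which the linear system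
`A_γ B_γ J_γ = J_α - J_β` has a nonzero solution; its components are then all nonzero. Otherwise
the symmetrised words of the sector of `S₀` would vanish, and the normally ordered words of that
sector would be dependent. -/
theorem exists_param (h : P.Admits j k I) (ht : ∀ γ, (P.A γ * P.B γ) ^ 2 ≠ 1) :
    ∃ J : Fin 3 → ℂ, (∀ γ, P.A γ * P.B γ * J γ = J (γ + 1) - J (γ + 2)) ∧ ∀ γ, J γ ≠ 0 := by
  have hp : ∀ γ, 1 + P.A γ * P.B γ ≠ 0 := fun γ h0 =>
    ht γ (by linear_combination (P.A γ * P.B γ - 1) * h0)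
  have hm : ∀ γ, 1 - P.A γ * P.B γ ≠ 0 := fun γ h0 =>
    ht γ (by linear_combination (-P.A γ * P.B γ - 1) * h0)
  -- the determinant of the linear system, and a vector in its kernel
  suffices hc : P.A 0 * P.B 0 + P.A 1 * P.B 1 + P.A 2 * P.B 2
      + P.A 0 * P.B 0 * (P.A 1 * P.B 1) * (P.A 2 * P.B 2) = 0 by
    refine ⟨![(1 + P.A 2 * P.B 2) * (1 + P.A 1 * P.B 1),
      (1 - P.A 0 * P.B 0) * (1 - P.A 2 * P.B 2),
      (1 - P.A 0 * P.B 0) * (1 + P.A 1 * P.B 1)], fun γ => ?_, fun γ => ?_⟩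
    · fin_cases γ
      · change P.A 0 * P.B 0 * ((1 + P.A 2 * P.B 2) * (1 + P.A 1 * P.B 1))
          = (1 - P.A 0 * P.B 0) * (1 - P.A 2 * P.B 2) - (1 - P.A 0 * P.B 0) * (1 + P.A 1 * P.B 1)
        linear_combination hc
      · change P.A 1 * P.B 1 * ((1 - P.A 0 * P.B 0) * (1 - P.A 2 * P.B 2))
          = (1 - P.A 0 * P.B 0) * (1 + P.A 1 * P.B 1)
            - (1 + P.A 2 * P.B 2) * (1 + P.A 1 * P.B 1)
        linear_combination hc
      · change P.A 2 * P.B 2 * ((1 - P.A 0 * P.B 0) * (1 + P.A 1 * P.B 1))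
          = (1 + P.A 2 * P.B 2) * (1 + P.A 1 * P.B 1) - (1 - P.A 0 * P.B 0) * (1 - P.A 2 * P.B 2)
        linear_combination -hc
    · fin_cases γ
      · exact mul_ne_zero (hp 2) (hp 1)
      · exact mul_ne_zero (hm 0) (hm 2)
      · exact mul_ne_zero (hm 0) (hp 1)
  by_contra hc
  have hT := h.isCubicModel
  obtain ⟨T, hTe⟩ : ∃ T : Fin 4 → Fin 4 → Fin 4 → FA ⧸ (I ⊔ polyLE 2),
    T = fun x y z => (I ⊔ polyLE 2).mkQ (FreeAlgebra.ι ℂ x * FreeAlgebra.ι ℂ y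
      * FreeAlgebra.ι ℂ z) := ⟨_, rfl⟩
  rw [← hTe] at hT
  have sc : ∀ x y z, sym T x y z = sym T z y x := fun x y z => add_comm _ _
  have kc : ∀ x y z, skew T x y z = -skew T z y x := fun x y z => (neg_sub _ _).symm
  have hs : ∀ x, sym T 0 x x = (2 : ℂ) • T 0 x x - skew T 0 x x := by
    intro x; simp only [sym, skew]; module
  have h0 := hT.sector_zero 0
  have h1 := hT.sector_zero 1
  have h2 := hT.sector_zero 2
  simp only [show (0 : Fin 3) + 1 = 1 from rfl, show (0 : Fin 3) + 2 = 2 from rfl,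
    show (1 : Fin 3) + 1 = 2 from rfl, show (1 : Fin 3) + 2 = 0 from rfl,
    show (2 : Fin 3) + 1 = 0 from rfl, show (2 : Fin 3) + 2 = 1 from rfl,
    show (0 : Fin 3).succ = 1 from rfl, show (1 : Fin 3).succ = 2 from rfl,
    show (2 : Fin 3).succ = 3 from rfl] at h0 h1 h2
  rw [sc 3 2 1, sc 2 3 1, kc 3 2 1, kc 2 3 1, hs] at h0
  rw [sc 3 1 2, kc 3 1 2, hs] at h1
  rw [hs] at h2
  obtain ⟨e0, d0, -, q0⟩ := h0
  obtain ⟨e1, d1, -, q1⟩ := h1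
  obtain ⟨e2, d2, -, q2⟩ := h2
  have u2 : sym T 1 2 3 = 0 := by
    refine eq_zero_of_smul (mul_ne_zero (neg_ne_zero.2 (two_ne_zero (α := ℂ))) hc) ?_
    linear_combination (norm := module)
      ((1 - P.A 1 * P.B 1) * (1 - P.A 2 * P.B 2)) • e0
        + ((1 + P.A 0 * P.B 0) * (1 - P.A 2 * P.B 2)) • e1
        + ((1 + P.A 0 * P.B 0) * (1 + P.A 1 * P.B 1)) • e2
  rw [u2, smul_zero] at e0
  have u3 := eq_zero_of_smul (hp 0) e0.symm
  rw [u3, smul_zero] at e1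
  have u1 := eq_zero_of_smul (hp 1) e1.symm
  rw [u2, u3, add_zero, smul_zero] at d0
  rw [u3, u1, add_zero, smul_zero] at d1
  rw [u1, u2, add_zero, smul_zero] at d2
  rw [d0, sub_zero] at q0
  rw [d1, sub_zero] at q1
  rw [d2, sub_zero] at q2
  have hv : skew T 1 2 3 = (2 : ℂ) • T 1 2 3 := by
    simp only [sym, skew] at u2 ⊢
    linear_combination (norm := module) -u2
  rw [hv] at q0 q2
  -- eliminating the antisymmetrised words leaves a relation between normally ordered words
  obtain ⟨-, c1, c2, c3⟩ := h.sector_zero_independent ht hTe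
    (a := 2 * ((1 + P.A 0 * P.B 0) * (1 + P.A 1 * P.B 1) * (1 + P.A 2 * P.B 2)
      + (1 - P.A 0 * P.B 0) * (1 - P.A 1 * P.B 1) * (1 - P.A 2 * P.B 2)))
    (b := 4 * ((1 + P.A 1 * P.B 1) * (1 + P.A 2 * P.B 2)) * P.A 0)
    (c := -4 * ((1 - P.A 0 * P.B 0) * (1 + P.A 2 * P.B 2)) * P.A 1)
    (d := 4 * ((1 - P.A 1 * P.B 1) * (1 - P.A 0 * P.B 0)) * P.A 2) (by
      linear_combination (norm := module)
        -((1 + P.A 1 * P.B 1) * (1 + P.A 2 * P.B 2)) • q0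
        + ((1 - P.A 0 * P.B 0) * (1 + P.A 2 * P.B 2)) • q1
        - ((1 - P.A 1 * P.B 1) * (1 - P.A 0 * P.B 0)) • q2)
  have a0 : P.A 0 = 0 := (mul_eq_zero.1 c1).resolve_left
    (mul_ne_zero (by norm_num) (mul_ne_zero (hp 1) (hp 2)))
  have a1 : P.A 1 = 0 := (mul_eq_zero.1 c2).resolve_left
    (mul_ne_zero (by norm_num) (mul_ne_zero (hm 0) (hp 2)))
  have a2 : P.A 2 = 0 := (mul_eq_zero.1 c3).resolve_left
    (mul_ne_zero (by norm_num) (mul_ne_zero (hm 1) (hm 0)))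
  exact hc (by rw [a0, a1, a2]; ring)

theorem sig_ne_zero (ht : ∀ γ, (P.A γ * P.B γ) ^ 2 ≠ 1) {J : Fin 3 → ℂ}
    (hJ : ∀ γ, P.A γ * P.B γ * J γ = J (γ + 1) - J (γ + 2)) (hJ0 : ∀ γ, J γ ≠ 0) (γ : Fin 3) :
    sig J γ ≠ 0 := by
  intro h0
  have h1 := hJ (γ + 1)
  simp only [add_one_one, add_one_two] at h1
  have h2 : (1 + P.A (γ + 1) * P.B (γ + 1)) * J (γ + 1) = 0 := by
    rw [← h0, sig]; linear_combination h1
  have h3 := (mul_eq_zero.1 h2).resolve_right (hJ0 _)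
  exact ht (γ + 1) (by linear_combination (P.A (γ + 1) * P.B (γ + 1) - 1) * h3)

/-- If the quartic form vanished at `J`, then the normally ordered words in the sector of `S₀` would
be dependent. -/
theorem quartic_ne_zero (h : P.Admits j k I) (ht : ∀ γ, (P.A γ * P.B γ) ^ 2 ≠ 1)
    {J : Fin 3 → ℂ} (hJ : ∀ γ, P.A γ * P.B γ * J γ = J (γ + 1) - J (γ + 2))
    (hσ : ∀ γ, sig J γ ≠ 0) : quartic J ≠ 0 := by
  intro hQ
  obtain ⟨ε, -, -, -, -, -, hε⟩ := h.isCubicModel.sector_zero_param hJ hσ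
  rw [hQ, mul_zero, zero_smul] at hε
  obtain ⟨h0, -⟩ := h.sector_zero_independent ht rfl (a := 4 * sig J 0 * sig J 2)
    (b := 4 * sig J 0 * J 0 * P.A 0) (c := -(4 * sig J 1 * J 1 * P.A 1))
    (d := 4 * sig J 2 * J 2 * P.A 2) (by rw [neg_smul, ← sub_eq_add_neg]; exact hε)
  exact mul_ne_zero (mul_ne_zero (by norm_num) (hσ 0)) (hσ 2) h0

end Coeffs.Admits

/-! ### Stability determines the coefficients `B_γ` -/

section Sector

variable {Q Q' : Type*} [AddCommGroup Q] [Module ℂ Q] [AddCommGroup Q'] [Module ℂ Q']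
variable {A B : Fin 3 → ℂ} {T : Fin 4 → Fin 4 → Fin 4 → Q}

theorem IsCubicModel.map (h : IsCubicModel A B T) (f : Q →ₗ[ℂ] Q') :
    IsCubicModel A B fun x y z => f (T x y z) := by
  constructor
  · intro γ x; rw [← map_zero f, ← h.Fl γ x]; simp only [map_add, map_sub, map_smul]
  · intro γ x; rw [← map_zero f, ← h.Fr γ x]; simp only [map_add, map_sub, map_smul]
  · intro γ x; rw [← map_zero f, ← h.Gl γ x]; simp only [map_add, map_sub, map_smul]
  · intro γ x; rw [← map_zero f, ← h.Gr γ x]; simp only [map_add, map_sub, map_smul]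

/-- If, besides the relations, a nontrivial combination of the antisymmetrised words of the
sector of `S_γ` vanishes, then four vectors span the words of the sector. -/
theorem IsCubicModel.exists_four_spanning (h : IsCubicModel A B T)
    (ht : ∀ γ, (A γ * B γ) ^ 2 ≠ 1) (hB : ∀ γ, B γ ≠ 0) (γ : Fin 3) {c₁ c₂ : ℂ}
    (hc : c₁ ≠ 0 ∨ c₂ ≠ 0)
    (he : c₁ • (skew T 0 (γ + 1).succ (γ + 2).succ - skew T (γ + 1).succ 0 (γ + 2).succ)
      + c₂ • (skew T 0 (γ + 2).succ (γ + 1).succ + skew T (γ + 1).succ 0 (γ + 2).succ) = 0) :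
    ∃ w : Fin 4 → Q, ∀ U : Submodule ℂ Q, U = Submodule.span ℂ (Set.range w) →
      T γ.succ γ.succ γ.succ ∈ U ∧ T 0 0 γ.succ ∈ U ∧
      (T (γ + 1).succ (γ + 1).succ γ.succ ∈ U ∧ T γ.succ (γ + 1).succ (γ + 1).succ ∈ U) ∧
      (T (γ + 2).succ (γ + 2).succ γ.succ ∈ U ∧ T γ.succ (γ + 2).succ (γ + 2).succ ∈ U) ∧
      (T 0 (γ + 1).succ (γ + 2).succ ∈ U ∧ T 0 (γ + 2).succ (γ + 1).succ ∈ U) := by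
  refine ⟨![T γ.succ γ.succ γ.succ, sym T (γ + 1).succ 0 (γ + 2).succ, sym T 0 0 γ.succ,
    if c₁ = c₂ then skew T (γ + 1).succ 0 (γ + 2).succ else
      skew T 0 (γ + 1).succ (γ + 2).succ], fun U hU => ?_⟩
  have hw : ∀ i, (![T γ.succ γ.succ γ.succ, sym T (γ + 1).succ 0 (γ + 2).succ,
      sym T 0 0 γ.succ, if c₁ = c₂ then skew T (γ + 1).succ 0 (γ + 2).succ else
      skew T 0 (γ + 1).succ (γ + 2).succ]) i ∈ U := fun i => by
    rw [hU]; exact Submodule.subset_span ⟨i, rfl⟩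
  have w0 := hw 0
  have w1 := hw 1
  have w2 := hw 2
  have w3 := hw 3
  simp only [Matrix.cons_val] at w0 w1 w2 w3
  -- pass to the quotient by the four vectors, where the whole sector vanishes
  have hm : ∀ q, U.mkQ q = 0 ↔ q ∈ U := fun q => by simp
  have h' := h.map U.mkQ
  set T' : Fin 4 → Fin 4 → Fin 4 → Q ⧸ U := fun x y z => U.mkQ (T x y z) with hT'
  have hsym : ∀ x y z, sym T' x y z = U.mkQ (sym T x y z) := fun x y z => by
    simp only [sym, hT', map_add]
  have hskew : ∀ x y z, skew T' x y z = U.mkQ (skew T x y z) := fun x y z => by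
    simp only [skew, hT', map_sub]
  have he' := congrArg U.mkQ he
  simp only [map_add, map_sub, map_smul, map_zero, ← hskew] at he'
  rw [← hm, ← hsym] at w1 w2
  have hp : ∀ γ, 1 + A γ * B γ ≠ 0 := fun γ h0 =>
    ht γ (by linear_combination (A γ * B γ - 1) * h0)
  obtain ⟨-, -, -, -, -, -, -, -, qA, qB, qC⟩ := h'.sector γ
  rw [w2, smul_zero, add_zero] at qA
  have hD : skew T' (γ + 1).succ 0 (γ + 2).succ = 0 ∧ skew T' 0 (γ + 1).succ (γ + 2).succ = 0 ∧
      skew T' 0 (γ + 2).succ (γ + 1).succ = 0 := by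
    by_cases h12 : c₁ = c₂
    · rw [if_pos h12, ← hm, ← hskew] at w3
      subst h12
      rw [w3, sub_zero, add_zero, ← smul_add] at he'
      have h2 := eq_zero_of_smul (by simpa using hc) he'
      have h3 : skew T' 0 (γ + 1).succ (γ + 2).succ = 0 := by
        refine eq_zero_of_smul (two_ne_zero (α := ℂ)) ?_
        linear_combination (norm := module) -qA + (1 + A γ * B γ) • h2
      rw [h3, zero_add] at h2
      exact ⟨w3, h3, h2⟩
    · rw [if_neg h12, ← hm, ← hskew] at w3
      rw [w3, smul_zero] at qA
      have h2 := eq_zero_of_smul (hp γ) qA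
      rw [w3, h2, zero_sub, zero_add] at he'
      refine ⟨eq_zero_of_smul (sub_ne_zero.2 (Ne.symm h12)) ?_, w3, h2⟩
      linear_combination (norm := module) he'
  obtain ⟨hD0, hDα, hDβ⟩ := hD
  rw [hD0, hDβ, smul_zero, smul_zero, zero_add] at qB
  rw [hD0, hDα, smul_zero, smul_zero, zero_add] at qC
  have sα := eq_zero_of_smul (mul_ne_zero two_ne_zero (hB _)) qB.symm
  have sβ := eq_zero_of_smul (mul_ne_zero two_ne_zero (hB _)) qC.symm
  obtain ⟨⟨x1, -, -⟩, ⟨x2, x3, -⟩, ⟨x4, x5, -⟩, -, ⟨x6, -⟩, ⟨x7, -⟩⟩ :=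
    h'.sector_eq_zero ht γ w1 hD0 hDα hDβ (.inl w2) (.inl sα) (.inl sβ)
  exact ⟨w0, (hm _).1 x1, ⟨(hm _).1 x2, (hm _).1 x3⟩, ⟨(hm _).1 x4, (hm _).1 x5⟩,
    (hm _).1 x6, (hm _).1 x7⟩

end Sector

theorem ddt_mem_polyLE (j k : Fin 3 → ℂ) (γ : Fin 3) : ddt j k (S γ) ∈ polyLE 2 := by
  rw [ddt_S]
  exact add_mem (Submodule.smul_mem _ _ (add_mem (ι_mul_ι_mem_polyLE _ _)
    (ι_mul_ι_mem_polyLE _ _))) (polyLE_mono one_le_two (Submodule.smul_mem _ _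
    (sub_mem (Submodule.smul_mem _ _ (S_mem_polyLE _)) (Submodule.smul_mem _ _ (S_mem_polyLE _)))))

/-- The time derivative of `G_γ` has the cubic part
`(j_α - j_β) [{S_α, S_β}, S₀] + B_γ ((j_β - j_γ) {{S_β, S_γ}, S_β} + (j_γ - j_α) {{S_γ, S_α}, S_α})`,
with `{x, y} = x y + y x`. -/
theorem Coeffs.ddt_rel_inr_sub_mem (P : Coeffs) (j k : Fin 3 → ℂ) (γ : Fin 3) :
    ddt j k (P.rel (.inr γ)) - ((j (γ + 1) - j (γ + 2)) •
        ((S (γ + 1) * S (γ + 2) + S (γ + 2) * S (γ + 1)) * S0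
          - S0 * (S (γ + 1) * S (γ + 2) + S (γ + 2) * S (γ + 1)))
      + P.B γ • ((j (γ + 2) - j γ) • ((S (γ + 2) * S γ + S γ * S (γ + 2)) * S (γ + 2)
            + S (γ + 2) * (S (γ + 2) * S γ + S γ * S (γ + 2)))
          + (j γ - j (γ + 1)) • ((S γ * S (γ + 1) + S (γ + 1) * S γ) * S (γ + 1)
            + S (γ + 1) * (S γ * S (γ + 1) + S (γ + 1) * S γ)))) ∈ polyLE 2 := by
  set low : Fin 3 → FA := fun γ => (2 : ℂ) • (k (γ + 1) • S (γ + 2) - k (γ + 2) • S (γ + 1))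
    with hlow
  have h1 : ∀ γ, low γ ∈ polyLE 1 := fun γ => Submodule.smul_mem _ _
    (sub_mem (Submodule.smul_mem _ _ (S_mem_polyLE _)) (Submodule.smul_mem _ _ (S_mem_polyLE _)))
  have hm : ∀ {x y : FA}, x ∈ polyLE 1 → y ∈ polyLE 1 → x * y ∈ polyLE 2 :=
    fun hx hy => mul_mem_polyLE hx hy
  have h2 : low γ * S0 - S0 * low γ + P.B γ • (low (γ + 1) * S (γ + 2)
      + S (γ + 1) * low (γ + 2) + low (γ + 2) * S (γ + 1) + S (γ + 2) * low (γ + 1))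
      + (P.l (γ + 1) • ddt j k (S (γ + 2)) - P.l (γ + 2) • ddt j k (S (γ + 1))) ∈ polyLE 2 :=
    add_mem (add_mem (sub_mem (hm (h1 _) S0_mem_polyLE) (hm S0_mem_polyLE (h1 _)))
      (Submodule.smul_mem _ _ (add_mem (add_mem (add_mem (hm (h1 _) (S_mem_polyLE _))
        (hm (S_mem_polyLE _) (h1 _))) (hm (h1 _) (S_mem_polyLE _)))
        (hm (S_mem_polyLE _) (h1 _)))))
      (sub_mem (Submodule.smul_mem _ _ (ddt_mem_polyLE j k _))
        (Submodule.smul_mem _ _ (ddt_mem_polyLE j k _)))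
  convert h2 using 1
  have hd : ∀ γ, ddt j k (S γ) = (j (γ + 1) - j (γ + 2)) •
      (S (γ + 1) * S (γ + 2) + S (γ + 2) * S (γ + 1)) + low γ := fun γ => ddt_S j k γ
  clear_value low
  rw [P.rel_inr]
  simp only [map_add, map_sub, map_smul, ddt_mul, ddt_S0]
  simp only [hd, add_one_one, add_one_two, add_two_one, add_two_two]
  simp only [mul_add, add_mul, mul_smul_comm, smul_mul_assoc, mul_assoc, mul_zero, zero_mul]
  module

namespace Coeffs.Admits

variable {P : Coeffs} {j k : Fin 3 → ℂ} {I : Submodule ℂ FA}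

/-- Stability of the ideal makes the coefficients `B_γ` proportional to `j_α - j_β`: otherwise
the time derivative of `G_γ` is a new cubic relation, and the sector of `S_γ` is too small to
hold its five normally ordered words. -/
theorem B_proportional (h : P.Admits j k I) (ht : ∀ γ, (P.A γ * P.B γ) ^ 2 ≠ 1)
    (hB : ∀ γ, P.B γ ≠ 0) (γ : Fin 3) :
    (j (γ + 2) - j γ) * P.B γ = (j (γ + 1) - j (γ + 2)) * P.B (γ + 1) := by
  by_contra hne
  have hT := h.isCubicModel
  obtain ⟨T, hTe⟩ : ∃ T : Fin 4 → Fin 4 → Fin 4 → FA ⧸ (I ⊔ polyLE 2),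
    T = fun x y z => (I ⊔ polyLE 2).mkQ (FreeAlgebra.ι ℂ x * FreeAlgebra.ι ℂ y
      * FreeAlgebra.ι ℂ z) := ⟨_, rfl⟩
  rw [← hTe] at hT
  have hmem := sub_mem ((le_sup_left : I ≤ I ⊔ polyLE 2) (h.stable (.inr γ)))
    ((le_sup_right : polyLE 2 ≤ I ⊔ polyLE 2) (P.ddt_rel_inr_sub_mem j k γ))
  rw [sub_sub_cancel, ← Submodule.Quotient.mk_eq_zero, ← Submodule.mkQ_apply] at hmem
  simp only [S_eq, S0_eq, mul_add, add_mul, ← mul_assoc, map_add, map_sub, map_smul] at hmem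
  have hTa : ∀ x y z, (I ⊔ polyLE 2).mkQ (FreeAlgebra.ι ℂ x * FreeAlgebra.ι ℂ y * FreeAlgebra.ι ℂ z)
    = T x y z := fun x y z => by rw [hTe]
  simp only [hTa] at hmem
  obtain ⟨-, -, -, -, -, -, m1, m2, -, qB, qC⟩ := hT.sector γ
  -- modulo the relations, the anticommutators of the derivative are antisymmetrised words
  have hX : P.B (γ + 1) • ((2 : ℂ) • T (γ + 2).succ γ.succ (γ + 2).succ
      + sym T (γ + 2).succ (γ + 2).succ γ.succ) = skew T 0 (γ + 1).succ (γ + 2).succ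
        - skew T (γ + 1).succ 0 (γ + 2).succ := by
    rw [m2]
    linear_combination (norm := module) -qC
  have hY : P.B (γ + 2) • ((2 : ℂ) • T (γ + 1).succ γ.succ (γ + 1).succ
      + sym T (γ + 1).succ (γ + 1).succ γ.succ) = skew T 0 (γ + 2).succ (γ + 1).succ
        + skew T (γ + 1).succ 0 (γ + 2).succ := by
    rw [m1]
    linear_combination (norm := module) -qB
  have hrel : (P.B (γ + 2) * ((j (γ + 2) - j γ) * P.B γ - (j (γ + 1) - j (γ + 2)) * P.B (γ + 1))) •
        (skew T 0 (γ + 1).succ (γ + 2).succ - skew T (γ + 1).succ 0 (γ + 2).succ)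
      + (P.B (γ + 1) * ((j γ - j (γ + 1)) * P.B γ - (j (γ + 1) - j (γ + 2)) * P.B (γ + 2))) •
        (skew T 0 (γ + 2).succ (γ + 1).succ + skew T (γ + 1).succ 0 (γ + 2).succ) = 0 := by
    have hX' := hX
    have hY' := hY
    simp only [sym, skew] at hX hY hX' hY' ⊢
    linear_combination (norm := module) (P.B (γ + 1) * P.B (γ + 2)) • hmem
      - (P.B (γ + 2) * P.B γ * (j (γ + 2) - j γ)) • hX
      - (P.B (γ + 1) * P.B γ * (j γ - j (γ + 1))) • hY
  obtain ⟨w, hw⟩ := hT.exists_four_spanning ht hB γ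
    (.inl (mul_ne_zero (hB (γ + 2)) (sub_ne_zero.2 hne))) hrel
  obtain ⟨o1, o2, ⟨o3, o4⟩, ⟨o5, o6⟩, o7, o8⟩ := hw _ rfl
  -- the five normally ordered words of the sector
  have hfive : ∃ v : Fin 5 → FA ⧸ (I ⊔ polyLE 2), LinearIndependent ℂ v ∧
      ∀ i, v i ∈ Submodule.span ℂ (Set.range w) := by
    subst hTe
    have hγ : γ = 0 ∨ γ = 1 ∨ γ = 2 := by
      clear * -
      decide +revert
    rcases hγ with rfl | rfl | rfl
    · refine ⟨_, h.linearIndependent ht ![(1, 1, 1), (0, 0, 1), (1, 2, 2), (1, 3, 3), (0, 2, 3)]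
        (by decide) (by decide), fun i => ?_⟩
      fin_cases i
      exacts [o1, o2, o4, o6, o7]
    · refine ⟨_, h.linearIndependent ht ![(2, 2, 2), (0, 0, 2), (2, 3, 3), (1, 1, 2), (0, 1, 3)]
        (by decide) (by decide), fun i => ?_⟩
      fin_cases i
      exacts [o1, o2, o4, o5, o8]
    · refine ⟨_, h.linearIndependent ht ![(3, 3, 3), (0, 0, 3), (1, 1, 3), (2, 2, 3), (0, 1, 2)]
        (by decide) (by decide), fun i => ?_⟩
      fin_cases i
      exacts [o1, o2, o3, o5, o7]
  obtain ⟨v, hv, hvU⟩ := hfive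
  have h1 : LinearIndependent ℂ fun i => (⟨v i, hvU i⟩ : Submodule.span ℂ (Set.range w)) :=
    LinearIndependent.of_comp (Submodule.subtype _) hv
  have fU : Module.Finite ℂ (Submodule.span ℂ (Set.range w)) :=
    FiniteDimensional.span_of_finite ℂ (Set.finite_range _)
  have h2 := h1.fintype_card_le_finrank
  have h3 : Module.finrank ℂ (Submodule.span ℂ (Set.range w)) ≤ Fintype.card (Fin 4) :=
    finrank_range_le_card w
  simp only [Fintype.card_fin] at h2 h3
  omega

theorem exists_B_eq (h : P.Admits j k I) (hj : Function.Injective j)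
    (ht : ∀ γ, (P.A γ * P.B γ) ^ 2 ≠ 1) (hB : ∀ γ, P.B γ ≠ 0) :
    ∃ c : ℂ, c ≠ 0 ∧ ∀ γ, P.B γ = c * (j (γ + 1) - j (γ + 2)) := by
  have h0 := h.B_proportional ht hB 0
  have h2 := h.B_proportional ht hB 2
  have d : j 1 - j 2 ≠ 0 := sub_ne_zero.2 (hj.ne (by decide))
  have d' : j 0 - j 1 ≠ 0 := sub_ne_zero.2 (hj.ne (by decide))
  simp only [show (0 : Fin 3) + 1 = 1 from rfl, show (0 : Fin 3) + 2 = 2 from rfl,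
    show (2 : Fin 3) + 1 = 0 from rfl, show (2 : Fin 3) + 2 = 1 from rfl] at h0 h2
  refine ⟨P.B 0 / (j 1 - j 2), div_ne_zero (hB 0) d, fun γ => ?_⟩
  rw [div_mul_eq_mul_div, eq_div_iff d]
  fin_cases γ
  · rfl
  · change P.B 1 * (j 1 - j 2) = P.B 0 * (j 2 - j 0)
    linear_combination -h0
  · change P.B 2 * (j 1 - j 2) = P.B 0 * (j 0 - j 1)
    linear_combination h2

end Coeffs.Admits

/-! ### Lower order terms of the relations -/

/-- The fifteen symmetric polynomials of degree at most two: the anticommutators `{S_α, S_β}` and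
`{S₀, S_γ}`, the squares of the generators, the generators and the constant `1`. -/
def symmetricQuadratic : Fin 3 ⊕ Fin 3 ⊕ Fin 4 ⊕ Fin 4 ⊕ Unit → FA :=
  Sum.elim (fun γ => S (γ + 1) * S (γ + 2) + S (γ + 2) * S (γ + 1))
    (Sum.elim (fun γ => S0 * S γ + S γ * S0)
      (Sum.elim (fun x => FreeAlgebra.ι ℂ x * FreeAlgebra.ι ℂ x)
        (Sum.elim (fun x => FreeAlgebra.ι ℂ x) fun _ => 1)))

namespace Coeffs

/-- Modulo the relations every polynomial of degree at most two is symmetric. -/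
theorem polyLE_two_le_sup_span (P : Coeffs) : polyLE 2 ≤
    consequencesLE P.rel 2 ⊔ Submodule.span ℂ (Set.range symmetricQuadratic) := by
  set M := consequencesLE P.rel 2 ⊔ Submodule.span ℂ (Set.range symmetricQuadratic)
  have hr : ∀ i, P.rel i ∈ M := fun i =>
    (le_sup_left : _ ≤ M) (rel_mem_consequencesLE P.rel i)
  have hs : ∀ i, symmetricQuadratic i ∈ M := fun i =>
    (le_sup_right : _ ≤ M) (Submodule.subset_span ⟨i, rfl⟩)
  have hX : ∀ γ, S (γ + 1) * S (γ + 2) + S (γ + 2) * S (γ + 1) ∈ M := fun γ => hs (.inl γ)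
  have hY : ∀ γ, S0 * S γ + S γ * S0 ∈ M := fun γ => hs (.inr (.inl γ))
  have h1 : ∀ x, FreeAlgebra.ι ℂ x ∈ M := fun x => hs (.inr (.inr (.inr (.inl x))))
  have h0 : (1 : FA) ∈ M := hs (.inr (.inr (.inr (.inr ()))))
  have hq : ∀ x, FreeAlgebra.ι ℂ x * FreeAlgebra.ι ℂ x ∈ M :=
    fun x => hs (.inr (.inr (.inl x)))
  have hS : ∀ γ, S γ ∈ M := fun γ => h1 _
  have hS0 : S0 ∈ M := h1 _
  have hF : ∀ γ, S (γ + 1) * S (γ + 2) - S (γ + 2) * S (γ + 1) ∈ M := fun γ => by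
    have h2 := sub_mem (hr (.inl γ)) (add_mem (add_mem (add_mem
      (M.smul_mem (P.A γ) (hY γ)) (M.smul_mem (P.K γ) hS0)) (M.smul_mem (P.M γ) (hS γ)))
      (M.smul_mem (P.N γ) h0))
    convert h2 using 1
    rw [rel_inl, Algebra.algebraMap_eq_smul_one]
    abel
  have hG : ∀ γ, S γ * S0 - S0 * S γ ∈ M := fun γ => by
    have h2 := sub_mem (hr (.inr γ)) (add_mem (M.smul_mem (P.B γ) (hX γ))
      (sub_mem (M.smul_mem (P.l (γ + 1)) (hS (γ + 2))) (M.smul_mem (P.l (γ + 2)) (hS (γ + 1)))))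
    convert h2 using 1
    rw [rel_inr]
    abel
  have hsplit : ∀ x y : FA, x * y + y * x ∈ M → x * y - y * x ∈ M → x * y ∈ M ∧ y * x ∈ M := by
    intro x y ha hd
    constructor
    · convert M.smul_mem (1 / 2 : ℂ) (add_mem ha hd) using 1; module
    · convert M.smul_mem (1 / 2 : ℂ) (sub_mem ha hd) using 1; module
  have hSS : ∀ γ δ : Fin 3, S γ * S δ ∈ M := by
    intro γ δ
    have h1 := hsplit _ _ (hX (γ + 1)) (hF (γ + 1))
    have h2 := hsplit _ _ (hX (γ + 2)) (hF (γ + 2))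
    simp only [add_one_one, add_one_two, add_two_one, add_two_two] at h1 h2
    rcases (by decide : ∀ γ δ : Fin 3, δ = γ ∨ δ = γ + 1 ∨ δ = γ + 2) γ δ with rfl | rfl | rfl
    · exact hq _
    · exact h2.1
    · exact h1.2
  refine polyLE_two_le h0 h1 fun x y => ?_
  refine Fin.cases (Fin.cases ?_ (fun δ => ?_) y) (fun γ => Fin.cases ?_ (fun δ => ?_) y) x
  · exact hq 0
  · exact (hsplit _ _ (add_comm (S0 * S δ) _ ▸ hY δ) (hG δ)).2
  · exact (hsplit _ _ (add_comm (S0 * S γ) _ ▸ hY γ) (hG γ)).1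
  · exact hSS γ δ

namespace Admits

variable {P : Coeffs} {j k : Fin 3 → ℂ} {I : Submodule ℂ FA}

/-- The symmetric polynomials of degree at most two stay independent modulo the ideal: they span
a space that contains the fifteen independent normally ordered monomials. -/
theorem linearIndependent_symmetricQuadratic (h : P.Admits j k I) :
    LinearIndependent ℂ fun i => I.mkQ (symmetricQuadratic i) := by
  rw [linearIndependent_iff_card_le_finrank_span]
  obtain ⟨e, he, he2⟩ : ∃ e : Fin 3 ⊕ Fin 3 ⊕ Fin 4 ⊕ Fin 4 ⊕ Unit → Fin 4 → ℕ,
      Function.Injective e ∧ ∀ i, ∑ x, e i x ≤ 2 :=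
    ⟨Sum.elim (fun γ => Pi.single (γ + 1).succ 1 + Pi.single (γ + 2).succ 1)
      (Sum.elim (fun γ => Pi.single 0 1 + Pi.single γ.succ 1)
        (Sum.elim (fun x => Pi.single x 2) (Sum.elim (fun x => Pi.single x 1) fun _ => 0))),
      by decide, by decide⟩
  have h1 : LinearIndependent ℂ fun i => I.mkQ (orderedMonomial (e i)) := by
    refine (linearIndependent_orderedMonomial.comp e he).map (f := I.mkQ) ?_
    rw [Submodule.ker_mkQ]
    refine (h.disj.mono_right (Submodule.span_le.2 ?_)).symm
    rintro _ ⟨i, rfl⟩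
    exact orderedMonomial_mem_orderedLE ((he2 i).trans (by norm_num))
  have h2 : ∀ i, I.mkQ (orderedMonomial (e i))
      ∈ Submodule.span ℂ (Set.range fun i => I.mkQ (symmetricQuadratic i)) := by
    intro i
    have h3 := P.polyLE_two_le_sup_span
      (orderedLE_le_polyLE 2 (orderedMonomial_mem_orderedLE (he2 i)))
    obtain ⟨y, hy, z, hz, hyz⟩ := Submodule.mem_sup.1 h3
    have h4 : I.mkQ y = 0 := by
      rw [Submodule.mkQ_apply, Submodule.Quotient.mk_eq_zero]
      exact h.cons (consequencesLE_mono _ (by norm_num) hy)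
    rw [← hyz, map_add, h4, zero_add]
    have h5 := Submodule.mem_map_of_mem (f := I.mkQ) hz
    rwa [Submodule.map_span, ← Set.range_comp] at h5
  have h6 : LinearIndependent ℂ fun i => (⟨I.mkQ (orderedMonomial (e i)), h2 i⟩ :
      Submodule.span ℂ (Set.range fun i => I.mkQ (symmetricQuadratic i))) :=
    LinearIndependent.of_comp (Submodule.subtype _) h1
  have : Module.Finite ℂ (Submodule.span ℂ (Set.range fun i => I.mkQ (symmetricQuadratic i))) :=
    FiniteDimensional.span_of_finite ℂ (Set.finite_range _)
  exact h6.fintype_card_le_finrank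

/-- A combination of symmetric quadratic polynomials in the ideal has zero coefficients; they are
indexed cyclically, starting from `γ`. -/
theorem symmetric_eq_zero (h : P.Admits j k I) (γ : Fin 3) {p q r c : Fin 3 → ℂ} {d n : ℂ}
    (hm : ∑ δ, (p δ • (S (γ + δ + 1) * S (γ + δ + 2) + S (γ + δ + 2) * S (γ + δ + 1))
      + q δ • (S0 * S (γ + δ) + S (γ + δ) * S0) + r δ • (S (γ + δ) * S (γ + δ))
      + c δ • S (γ + δ)) + d • S0 + n • (1 : FA) ∈ I) :
    p = 0 ∧ q = 0 ∧ r = 0 ∧ c = 0 := by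
  have h1 := Fintype.linearIndependent_iff.1 h.linearIndependent_symmetricQuadratic
    (Sum.elim (fun δ => p (δ - γ)) (Sum.elim (fun δ => q (δ - γ))
      (Sum.elim (Fin.cons 0 fun δ => r (δ - γ))
        (Sum.elim (Fin.cons d fun δ => c (δ - γ)) fun _ => n)))) (by
      simp only [← map_smul, ← map_sum]
      rw [Submodule.mkQ_apply, Submodule.Quotient.mk_eq_zero]
      convert hm using 1
      simp only [Fintype.sum_sum_type, Sum.elim_inl, Sum.elim_inr, symmetricQuadratic,
        Fin.sum_univ_succ (n := 3), Fin.cons_zero, Fin.cons_succ, zero_smul, zero_add,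
        Finset.univ_unique, Finset.sum_singleton, Finset.sum_add_distrib, S_eq, S0_eq]
      have hc : ∀ (f : Fin 3 → ℂ) (g : Fin 3 → FA),
          ∑ δ, f (δ - γ) • g δ = ∑ δ, f δ • g (γ + δ) := fun f g => by
        rw [← Equiv.sum_comp (Equiv.addLeft γ)]
        simp only [Equiv.coe_addLeft, add_sub_cancel_left]
      rw [hc p, hc q, hc r, hc c]
      abel)
  have hδ : ∀ δ : Fin 3, γ + δ - γ = δ := fun δ => add_sub_cancel_left γ δ
  refine ⟨funext fun δ => ?_, funext fun δ => ?_, funext fun δ => ?_, funext fun δ => ?_⟩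
  · simpa [hδ] using h1 (.inl (γ + δ))
  · simpa [hδ] using h1 (.inr (.inl (γ + δ)))
  · simpa [hδ] using h1 (.inr (.inr (.inl (γ + δ).succ)))
  · simpa [hδ] using h1 (.inr (.inr (.inr (.inl (γ + δ).succ))))

/-- Stability of the ideal determines the coefficients `l_γ`: modulo the relations, the defect
of `G_γ` is a quadratic polynomial with the coefficient `2 B_γ (2 h k_γ - l_γ)` at `S_α²`. -/
theorem l_eq (h : P.Admits j k I) {t : ℂ} (hB : ∀ γ, P.B γ = t * (j (γ + 1) - j (γ + 2)))
    (hB0 : ∀ γ, P.B γ ≠ 0) (γ : Fin 3) : P.l γ = 2 * t * k γ := by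
  have hG := h.stable (.inr γ)
  have hd : defect j k t (P.rel (.inr γ)) ∈ I := by
    rw [defect_apply]
    exact sub_mem (I.smul_mem _ hG) (sub_mem (h.ι_mul_mem 0 _) (h.mul_ι_mem 0 _))
  have e0 := P.defect_S (k := k) (hB γ)
  have e1 := P.defect_S (k := k) (hB (γ + 1))
  have e2 := P.defect_S (k := k) (hB (γ + 2))
  simp only [add_one_one, add_one_two, add_two_one, add_two_two] at e1 e2
  have hι : ∀ δ i, S δ * P.rel i ∈ I ∧ P.rel i * S δ ∈ I :=
    fun δ i => ⟨h.ι_mul_mem _ _, h.mul_ι_mem _ _⟩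
  -- remove from the defect of `G_γ` all products with a relation
  have hm := sub_mem hd (add_mem (add_mem (sub_mem (h.mul_ι_mem 0 (.inr γ))
    (h.ι_mul_mem 0 (.inr γ))) (I.smul_mem (P.B γ) (add_mem (add_mem
      (hι (γ + 1) (.inr (γ + 2))).1 (hι (γ + 2) (.inr (γ + 1))).2)
      (add_mem (hι (γ + 2) (.inr (γ + 1))).1 (hι (γ + 1) (.inr (γ + 2))).2))))
    (add_mem (sub_mem (I.smul_mem (P.l (γ + 1)) (h.rel_mem (.inr (γ + 2))))
      (I.smul_mem (P.l (γ + 2)) (h.rel_mem (.inr (γ + 1)))))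
      (sub_mem (I.smul_mem (2 * t * k (γ + 1) - P.l (γ + 1)) (h.rel_mem (.inr (γ + 2))))
        (I.smul_mem (2 * t * k (γ + 2) - P.l (γ + 2)) (h.rel_mem (.inr (γ + 1)))))))
  obtain ⟨-, -, hr, -⟩ := h.symmetric_eq_zero γ (p := ![0,
      (2 * t * k (γ + 2) - P.l (γ + 2)) * P.B (γ + 1)
        + P.B γ * (2 * t * k (γ + 2) - P.l (γ + 2)),
      -((2 * t * k (γ + 1) - P.l (γ + 1)) * P.B (γ + 2)
        + P.B γ * (2 * t * k (γ + 1) - P.l (γ + 1)))])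
    (q := 0) (r := ![0, 2 * P.B γ * (2 * t * k γ - P.l γ), -(2 * P.B γ * (2 * t * k γ - P.l γ))])
    (c := ![0, P.l (γ + 1) * (2 * t * k γ - P.l γ) - (2 * t * k (γ + 1) - P.l (γ + 1)) * P.l γ,
      P.l (γ + 2) * (2 * t * k γ - P.l γ) - (2 * t * k (γ + 2) - P.l (γ + 2)) * P.l γ])
    (d := 0) (n := 0) (by
      convert hm using 1
      rw [Fin.sum_univ_three]
      simp only [Matrix.cons_val_zero, Matrix.cons_val_one, Matrix.cons_val, Pi.zero_apply,
        add_zero, zero_smul, zero_add]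
      nth_rw 1 [P.rel_inr γ]
      simp only [map_add, map_sub, map_smul, defect_mul, defect_S0, e0, e1, e2]
      simp only [P.rel_inr, add_one_one, add_one_two, add_two_one, add_two_two, ← S0_eq]
      generalize S γ = x
      generalize S (γ + 1) = y
      generalize S (γ + 2) = z
      generalize S0 = w
      simp only [mul_add, mul_sub, add_mul, sub_mul, mul_smul_comm,
        smul_mul_assoc, mul_zero, zero_mul, mul_assoc]
      module)
  have h2 : 2 * P.B γ * (2 * t * k γ - P.l γ) = 0 := congrFun hr 1
  have h3 := (mul_eq_zero.1 h2).resolve_left (mul_ne_zero two_ne_zero (hB0 γ))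
  linear_combination -h3

/-- The cubic terms of the syzygies cancel, so their quadratic remainders belong to the ideal and
have zero coefficients. -/
theorem syzygy_coeffs (h : P.Admits j k I) {J : Fin 3 → ℂ}
    (hJ : ∀ γ, P.A γ * P.B γ * J γ = J (γ + 1) - J (γ + 2)) :
    (∑ γ, J γ * P.M γ * P.B γ = 0) ∧ ∀ γ,
      P.K γ * P.B γ * J γ = P.l γ * (J (γ + 1) * P.A (γ + 1) - J (γ + 2) * P.A (γ + 2)) ∧
      2 * J γ * P.B γ * P.N γ
        = P.l γ * (J (γ + 1) * P.M (γ + 1) - J (γ + 2) * P.M (γ + 2)) := by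
  have key : ∀ γ, (J γ * P.M γ * P.B γ + J (γ + 1) * P.M (γ + 1) * P.B (γ + 1)
      + J (γ + 2) * P.M (γ + 2) * P.B (γ + 2) = 0) ∧
      P.K (γ + 1) * P.B (γ + 1) * J (γ + 1)
        - P.l (γ + 1) * (J (γ + 2) * P.A (γ + 2) - J γ * P.A γ) = 0 ∧
      2 * J (γ + 1) * P.B (γ + 1) * P.N (γ + 1)
        - P.l (γ + 1) * (J (γ + 2) * P.M (γ + 2) - J γ * P.M γ) = 0 := by
    intro γ
    have hι : ∀ δ i, S δ * P.rel i ∈ I ∧ P.rel i * S δ ∈ I :=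
      fun δ i => ⟨h.ι_mul_mem _ _, h.mul_ι_mem _ _⟩
    have hι0 : ∀ i, S0 * P.rel i ∈ I ∧ P.rel i * S0 ∈ I :=
      fun i => ⟨h.ι_mul_mem _ _, h.mul_ι_mem _ _⟩
    have hm := sub_mem (add_mem
      (I.smul_mem (J γ) (add_mem (add_mem (sub_mem (hι0 (.inl γ)).1 (hι0 (.inl γ)).2)
        (I.smul_mem (P.A γ) (add_mem (hι0 (.inr γ)).1 (hι0 (.inr γ)).2)))
        (I.smul_mem (P.M γ) (h.rel_mem (.inr γ)))))
      (I.smul_mem (J (γ + 2)) (sub_mem (add_mem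
        (sub_mem (hι (γ + 1) (.inr (γ + 2))).1 (hι (γ + 1) (.inr (γ + 2))).2)
        (I.smul_mem (P.B (γ + 2))
          (add_mem (hι (γ + 1) (.inl (γ + 2))).1 (hι (γ + 1) (.inl (γ + 2))).2)))
        (I.smul_mem (P.l (γ + 1)) (h.rel_mem (.inl (γ + 2)))))))
      (I.smul_mem (J (γ + 1)) (sub_mem (sub_mem
        (sub_mem (hι (γ + 2) (.inr (γ + 1))).1 (hι (γ + 2) (.inr (γ + 1))).2)
        (I.smul_mem (P.B (γ + 1))
          (add_mem (hι (γ + 2) (.inl (γ + 1))).1 (hι (γ + 2) (.inl (γ + 1))).2)))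
        (I.smul_mem (P.l (γ + 2)) (h.rel_mem (.inl (γ + 1))))))
    have j1 := hJ (γ + 1)
    have j2 := hJ (γ + 2)
    simp only [add_one_one, add_one_two, add_two_one, add_two_two] at j1 j2
    rw [P.syzygy, hJ, j1, j2] at hm
    simp only [sub_self, zero_smul, zero_add] at hm
    obtain ⟨hp, hq, -, hc⟩ := h.symmetric_eq_zero γ
      (p := ![J γ * P.M γ * P.B γ + J (γ + 1) * P.M (γ + 1) * P.B (γ + 1)
        + J (γ + 2) * P.M (γ + 2) * P.B (γ + 2), 0, 0])
      (q := ![0, P.K (γ + 2) * P.B (γ + 2) * J (γ + 2)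
          - P.l (γ + 2) * (J γ * P.A γ - J (γ + 1) * P.A (γ + 1)),
        P.K (γ + 1) * P.B (γ + 1) * J (γ + 1)
          - P.l (γ + 1) * (J (γ + 2) * P.A (γ + 2) - J γ * P.A γ)]) (r := 0)
      (c := ![0, 2 * J (γ + 2) * P.B (γ + 2) * P.N (γ + 2)
          - P.l (γ + 2) * (J γ * P.M γ - J (γ + 1) * P.M (γ + 1)),
        2 * J (γ + 1) * P.B (γ + 1) * P.N (γ + 1)
          - P.l (γ + 1) * (J (γ + 2) * P.M (γ + 2) - J γ * P.M γ)])
      (d := J (γ + 1) * P.K (γ + 1) * P.l (γ + 2) - J (γ + 2) * P.K (γ + 2) * P.l (γ + 1))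
      (n := J (γ + 1) * P.N (γ + 1) * P.l (γ + 2) - J (γ + 2) * P.N (γ + 2) * P.l (γ + 1)) (by
        convert hm using 1
        rw [Fin.sum_univ_three]
        simp only [Matrix.cons_val_zero, Matrix.cons_val_one, Matrix.cons_val, Pi.zero_apply,
          add_zero, zero_smul, zero_add]
        abel)
    exact ⟨congrFun hp 0, congrFun hq 2, congrFun hc 2⟩
  refine ⟨(sum_cyclic (fun γ => J γ * P.M γ * P.B γ) 0).symm.trans (key 0).1, fun γ => ?_⟩
  obtain ⟨-, h1, h2⟩ := key (γ + 2)
  simp only [add_two_one, add_two_two] at h1 h2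
  exact ⟨sub_eq_zero.1 h1, sub_eq_zero.1 h2⟩

end Admits

end Coeffs

/-! ### Parametrisation of the quantisation ideals -/

theorem vandermonde_ne_zero {j : Fin 3 → ℂ} (hj : Function.Injective j) :
    (j 0 - j 1) * (j 1 - j 2) * (j 2 - j 0) ≠ 0 :=
  mul_ne_zero (mul_ne_zero (sub_ne_zero.2 (hj.ne (by decide))) (sub_ne_zero.2 (hj.ne (by decide))))
    (sub_ne_zero.2 (hj.ne (by decide)))

/-- The triples `J` on the affine plane `∑ J_γ j_α j_β (j_α - j_β) = ∑ j_α j_β (j_α - j_β)` are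
the denominators of the five-parameter family. The right-hand side is written in factored form. -/
theorem exists_eq_den {j : Fin 3 → ℂ} (hj : Function.Injective j) {h : ℂ} (hh : h ≠ 0)
    {J : Fin 3 → ℂ}
    (hn : ∑ γ, J γ * j (γ + 1) * j (γ + 2) * (j (γ + 1) - j (γ + 2))
      = -((j 0 - j 1) * (j 1 - j 2) * (j 2 - j 0))) :
    ∃ C D : ℂ, J = den j h C D := by
  have hv := vandermonde_ne_zero hj
  rw [Fin.sum_univ_three] at hn
  simp only [show (0 : Fin 3) + 1 = 1 from rfl, show (0 : Fin 3) + 2 = 2 from rfl,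
    show (1 : Fin 3) + 1 = 2 from rfl, show (1 : Fin 3) + 2 = 0 from rfl,
    show (2 : Fin 3) + 1 = 0 from rfl, show (2 : Fin 3) + 2 = 1 from rfl] at hn
  -- `D` and `C` are found by pairing `J = den j h C D` with the vectors `j_α - j_β`, which
  -- annihilates the terms with `1` and `C`, and `j_α² - j_β²`, which annihilates the constant
  obtain ⟨D, hD⟩ : ∃ D, h ^ 2 * ((j 0 - j 1) * (j 1 - j 2) * (j 2 - j 0)) * D
      = J 0 * (j 1 - j 2) + J 1 * (j 2 - j 0) + J 2 * (j 0 - j 1) :=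
    ⟨_, mul_div_cancel₀ _ (mul_ne_zero (pow_ne_zero 2 hh) hv)⟩
  obtain ⟨C, hC⟩ : ∃ C, h ^ 2 * ((j 0 - j 1) * (j 1 - j 2) * (j 2 - j 0)) * C
      = J 0 * (j 1 ^ 2 - j 2 ^ 2) + J 1 * (j 2 ^ 2 - j 0 ^ 2) + J 2 * (j 0 ^ 2 - j 1 ^ 2)
        - (j 0 + j 1 + j 2)
          * (J 0 * (j 1 - j 2) + J 1 * (j 2 - j 0) + J 2 * (j 0 - j 1)) :=
    ⟨_, mul_div_cancel₀ _ (mul_ne_zero (pow_ne_zero 2 hh) hv)⟩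
  refine ⟨C, D, funext fun γ => mul_left_cancel₀ hv ?_⟩
  rw [den]
  fin_cases γ
  · change (j 0 - j 1) * (j 1 - j 2) * (j 2 - j 0) * J 0 = (j 0 - j 1) * (j 1 - j 2) * (j 2 - j 0)
      * (1 + h ^ 2 * j 0 * (C + (j 2 + j 1) * D))
    linear_combination -hn - j 0 * hC - j 0 * (j 2 + j 1) * hD
  · change (j 0 - j 1) * (j 1 - j 2) * (j 2 - j 0) * J 1 = (j 0 - j 1) * (j 1 - j 2) * (j 2 - j 0)
      * (1 + h ^ 2 * j 1 * (C + (j 0 + j 2) * D))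
    linear_combination -hn - j 1 * hC - j 1 * (j 0 + j 2) * hD
  · change (j 0 - j 1) * (j 1 - j 2) * (j 2 - j 0) * J 2 = (j 0 - j 1) * (j 1 - j 2) * (j 2 - j 0)
      * (1 + h ^ 2 * j 2 * (C + (j 1 + j 0) * D))
    linear_combination -hn - j 2 * hC - j 2 * (j 1 + j 0) * hD

/-- Once `J`, `B` and `l` are those of the quantum algebra, the equations for `K`, `M` and `N` leave
only the two parameters `A` and `B`. -/
theorem Coeffs.exists_eq_quantumCoeffs (P : Coeffs) {j k : Fin 3 → ℂ}
    (hj : Function.Injective j) {h C D : ℂ} (hh : h ≠ 0) (hd : ∀ γ, den j h C D γ ≠ 0)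
    (hJ : ∀ γ, P.A γ * P.B γ * den j h C D γ = den j h C D (γ + 1) - den j h C D (γ + 2))
    (hB : ∀ γ, P.B γ = h * (j (γ + 1) - j (γ + 2))) (hl : ∀ γ, P.l γ = 2 * h * k γ)
    (hM : ∑ γ, den j h C D γ * P.M γ * P.B γ = 0)
    (hKN : ∀ γ, P.K γ * P.B γ * den j h C D γ = P.l γ
        * (den j h C D (γ + 1) * P.A (γ + 1) - den j h C D (γ + 2) * P.A (γ + 2)) ∧
      2 * den j h C D γ * P.B γ * P.N γ = P.l γ
        * (den j h C D (γ + 1) * P.M (γ + 1) - den j h C D (γ + 2) * P.M (γ + 2))) :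
    ∃ A B : ℂ, P = quantumCoeffs j k h A B C D := by
  have hδ : ∀ γ, h * (j (γ + 1) - j (γ + 2)) ≠ 0 := fun γ =>
    mul_ne_zero hh (sub_ne_zero.2 (hj.ne (by clear * -; decide +revert)))
  have hA : ∀ γ, den j h C D γ * P.A γ = h * (C + D * j γ) := by
    intro γ
    have h1 := hJ γ
    rw [hB] at h1
    refine mul_left_cancel₀ (hδ γ) ?_
    have h2 : den j h C D (γ + 1) - den j h C D (γ + 2)
        = h ^ 2 * (j (γ + 1) - j (γ + 2)) * (C + D * j γ) := by
      simp only [den, add_one_one, add_one_two, add_two_one, add_two_two]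
      ring
    linear_combination h1 + h2
  obtain ⟨A, B, hAB⟩ : ∃ A B : ℂ, ∀ γ, den j h C D γ * P.M γ = 2 * h * (A + B * j γ) := by
    have h01 : j 0 - j 1 ≠ 0 := sub_ne_zero.2 (hj.ne (by decide))
    obtain ⟨B, hB'⟩ : ∃ B, 2 * h * (j 0 - j 1) * B
        = den j h C D 0 * P.M 0 - den j h C D 1 * P.M 1 :=
      ⟨_, mul_div_cancel₀ _ (mul_ne_zero (mul_ne_zero two_ne_zero hh) h01)⟩
    obtain ⟨A, hA'⟩ : ∃ A, 2 * h * A = den j h C D 0 * P.M 0 - 2 * h * (B * j 0) :=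
      ⟨_, mul_div_cancel₀ _ (mul_ne_zero two_ne_zero hh)⟩
    refine ⟨A, B, fun γ => ?_⟩
    fin_cases γ
    · change den j h C D 0 * P.M 0 = 2 * h * (A + B * j 0)
      linear_combination -hA'
    · change den j h C D 1 * P.M 1 = 2 * h * (A + B * j 1)
      linear_combination -hA' + hB'
    · change den j h C D 2 * P.M 2 = 2 * h * (A + B * j 2)
      rw [Fin.sum_univ_three, hB, hB, hB] at hM
      simp only [show (0 : Fin 3) + 1 = 1 from rfl, show (0 : Fin 3) + 2 = 2 from rfl,
        show (1 : Fin 3) + 1 = 2 from rfl, show (1 : Fin 3) + 2 = 0 from rfl,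
        show (2 : Fin 3) + 1 = 0 from rfl, show (2 : Fin 3) + 2 = 1 from rfl] at hM
      refine mul_left_cancel₀ (mul_ne_zero hh h01) ?_
      linear_combination hM - h * (j 2 - j 0) * hB' - h * (j 0 - j 1) * hA'
  refine ⟨A, B, ?_⟩
  have eA : P.A = (quantumCoeffs j k h A B C D).A := funext fun γ =>
    (eq_div_iff (hd γ)).2 (by rw [mul_comm, hA])
  have eM : P.M = (quantumCoeffs j k h A B C D).M := funext fun γ =>
    (eq_div_iff (hd γ)).2 (by rw [mul_comm, hAB])
  have eK : P.K = (quantumCoeffs j k h A B C D).K := funext fun γ =>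
    (eq_div_iff (hd γ)).2 (mul_left_cancel₀ (hδ γ) (by
      have h1 := (hKN γ).1
      rw [hA, hA, hB, hl] at h1
      linear_combination h1))
  have eN : P.N = (quantumCoeffs j k h A B C D).N := funext fun γ =>
    (eq_div_iff (hd γ)).2 (mul_left_cancel₀ (hδ γ) (mul_left_cancel₀ (two_ne_zero (α := ℂ)) (by
      have h1 := (hKN γ).2
      rw [hAB, hAB, hB, hl] at h1
      linear_combination h1)))
  have eB : P.B = (quantumCoeffs j k h A B C D).B := funext hB
  have el : P.l = (quantumCoeffs j k h A B C D).l := funext hl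
  cases P
  simp only at eA eM eK eN eB el
  rw [eA, eM, eK, eN, eB, el]

theorem Coeffs.Admits.exists_quantumRel {P : Coeffs} {j k : Fin 3 → ℂ} {I : Submodule ℂ FA}
    (hP : P.Admits j k I) (hj : Function.Injective j) (hnd : P.Nondegenerate)
    (haff : P.IsAffine j) :
    ∃ h A B C D : ℂ, h ≠ 0 ∧ Inequalities j h C D ∧ P.rel = quantumRel j k h A B C D := by
  have ht := fun γ => (hnd γ).2
  have hB0 := fun γ => (hnd γ).1
  obtain ⟨h, hh, hB⟩ := hP.exists_B_eq hj ht hB0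
  obtain ⟨J', hJ', hJ0'⟩ := hP.exists_param ht
  have hτ := haff J' ⟨fun h0 => hJ0' 0 (congrFun h0 0), hJ'⟩
  have hv := vandermonde_ne_zero hj
  -- rescale the homogeneous parameters into the affine chart
  set τ := ∑ γ, J' γ * j (γ + 1) * j (γ + 2) * (j (γ + 1) - j (γ + 2)) with hτ'
  set ρ := -((j 0 - j 1) * (j 1 - j 2) * (j 2 - j 0)) / τ with hρ
  have hρ0 : ρ ≠ 0 := div_ne_zero (neg_ne_zero.2 hv) hτ
  obtain ⟨C, D, hCD⟩ := exists_eq_den hj hh (J := fun γ => ρ * J' γ) (by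
    rw [← div_mul_cancel₀ (-((j 0 - j 1) * (j 1 - j 2) * (j 2 - j 0))) hτ, ← hρ, hτ',
      Finset.mul_sum]
    exact Finset.sum_congr rfl fun γ _ => by ring)
  have hd : ∀ γ, den j h C D γ ≠ 0 := fun γ => by
    rw [← hCD]; exact mul_ne_zero hρ0 (hJ0' γ)
  have hJ : ∀ γ, P.A γ * P.B γ * den j h C D γ = den j h C D (γ + 1) - den j h C D (γ + 2) := by
    intro γ
    rw [← hCD]
    linear_combination ρ * hJ' γ
  have hσ := sig_ne_zero ht hJ hd
  obtain ⟨hM, hKN⟩ := hP.syzygy_coeffs hJ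
  obtain ⟨A, B, hAB⟩ := P.exists_eq_quantumCoeffs hj hh hd hJ hB (hP.l_eq hB hB0) hM hKN
  exact ⟨h, A, B, C, D, hh,
    (inequalities_iff j h C D).2 ⟨hP.quartic_ne_zero ht hJ hσ, hσ, hd⟩,
    by rw [← quantumCoeffs_rel, ← hAB]⟩

end

end ZhukovskyVolterra

open ZhukovskyVolterra in
theorem mainTheorem1 (j k : Fin 3 → ℂ) (hj : Function.Injective j) :
    -- every non-degenerate quantisation ideal has the five-parameter commutation relations
    (∀ P : Coeffs, P.Nondegenerate → P.IsAffine j →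
      (IsQuantisationIdeal j k (idealOf P.rel) ∨ IsCubicQuantisation j k P.rel) →
      ∃ h A B C D : ℂ, h ≠ 0 ∧ Inequalities j h C D ∧ P.rel = quantumRel j k h A B C D) ∧
    -- the parameters are arbitrary apart from the inequalities
    (∀ h A B C D : ℂ, Inequalities j h C D →
      (∃ P : Coeffs, P.rel = quantumRel j k h A B C D) ∧
      IsStable j k (idealOf (quantumRel j k h A B C D)) ∧
      IsCubicQuantisation j k (quantumRel j k h A B C D)) ∧
    -- the classical limit
    (∀ A B C D : ℂ → ℂ, AnalyticAt ℂ A 0 → AnalyticAt ℂ B 0 →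
      AnalyticAt ℂ C 0 → AnalyticAt ℂ D 0 →
      (∀ᶠ h in 𝓝 (0 : ℂ), Inequalities j h (C h) (D h)) ∧
      (∀ γ : Fin 3,
        ClassicalLimit (fun h => (-h)⁻¹ • abel (commRhs j k h (A h) (B h) (C h) (D h) γ))
          (bracket j k (-1) (A 0) (B 0) (C 0) (D 0) (s (γ + 1)) (s (γ + 2))) ∧
        ClassicalLimit (fun h => (-h)⁻¹ • abel (commRhs₀ j k h γ))
          (bracket j k (-1) (A 0) (B 0) (C 0) (D 0) (s γ) s0) ∧
        ClassicalLimit (fun h => h⁻¹ • abel (commRhs j k h (A h) (B h) (C h) (D h) γ))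
          (bracket j k 1 (-A 0) (-B 0) (-C 0) (-D 0) (s (γ + 1)) (s (γ + 2))) ∧
        ClassicalLimit (fun h => h⁻¹ • abel (commRhs₀ j k h γ))
          (bracket j k 1 (-A 0) (-B 0) (-C 0) (-D 0) (s γ) s0))) ∧
    -- the limiting brackets are Poisson brackets
    (∀ (e a b c d : ℂ) (f g u : CP),
      bracket j k e a b c d f g = -bracket j k e a b c d g f ∧
      bracket j k e a b c d f (g * u) =
        bracket j k e a b c d f g * u + g * bracket j k e a b c d f u ∧
      bracket j k e a b c d f (bracket j k e a b c d g u)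
        + bracket j k e a b c d g (bracket j k e a b c d u f)
        + bracket j k e a b c d u (bracket j k e a b c d f g) = 0) := by
  refine ⟨fun P hnd haff hP => ?_, fun h A B C D hI => ⟨⟨_, quantumCoeffs_rel j k h A B C D⟩, ?_,
    isCubicQuantisation_quantumRel j k h A B C D hI⟩, fun A B C D hA hB hC hD =>
      ⟨eventually_inequalities j hC.continuousAt hD.continuousAt, fun γ => ?_⟩,
    fun e a b c d f g u => ⟨bracket_antisymm j k e a b c d f g, bracket_mul j k e a b c d f g u,
      jacobi j k e a b c d f g u⟩⟩
  · rcases hP with hP | hP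
    · exact hP.admits.exists_quantumRel hj hnd haff
    · exact hP.admits.exists_quantumRel hj hnd haff
  · exact isStable_of_ddt_mem fun i => consequencesLE_le_idealOf _ _
      ((isCubicQuantisation_quantumRel j k h A B C D hI).1 i)
  · have h1 := classicalLimit_commRhs j k hA.continuousAt hB.continuousAt hC.continuousAt
      hD.continuousAt γ
    have h2 := classicalLimit_commRhs₀ j k γ
    simp only [bracket_s_s, bracket_s_s0, bracketSS_neg, bracketS0S_neg, neg_neg]
    exact ⟨h1, h2, h1.inv, h2.inv⟩
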